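/- **Source language.** Terms are first-order terms over variables, function symbols, integers and lists. A *goal* $\mathcal Q$ is a finite conjunction (possibly empty: $\square$, also written $true$) of user-predicate atoms, built-in atoms, and embedded implications $H\Rightarrow G$, where $H$ is a *rule* $p(\overline t)\leftarrow\mathcal B$ ($p$ a user predicate, $\mathcal B$ a goal) and $G$ is a goal. A *program* $\Pi$ is a finite set of rules. Rules, including assumed hypotheses, are universally quantified and are used only through variants with new variables. Each built-in predicate is given by a fixed, possibly infinite, set of facts. Most general unifiers (mgus) are idempotent. **HSLD resolution.** This is the transition relation $\rightsquigarrow$ on states $\langle\leftarrow\mathcal Q,\theta,\Pi\rangle$ given by: (1) if $A\leftarrow\mathcal B$ is a new variant of a rule of $\Pi$ (or of a fact of the built-in predicate of $A'$, with $\mathcal B=true$) and $\sigma$ is an mgu of $A$ and $A'$, then $\langle\leftarrow A'\wedge\mathcal Q',\theta,\Pi\rangle\rightsquigarrow\langle\leftarrow(\mathcal B\wedge\mathcal Q')\sigma,\theta\sigma,\Pi\rangle$; (2) if $\langle\leftarrow G,id,\Pi\cup\{H\}\rangle\rightsquigarrow^*\langle\square,\sigma,\Pi\cup\{H\}\rangle$,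 then $\langle\leftarrow(H\Rightarrow G)\wedge\mathcal Q',\theta,\Pi\rangle\rightsquigarrow\langle\leftarrow\mathcal Q'\sigma,\theta\sigma,\Pi\rangle$. **Translation.** A context identifier is a finite sequence $s$ of integers; $\epsilon$ is the empty one, $s.i$ appends $i$, and $\preceq$ is the prefix order. It is represented by a list with the latest index first. For a current context identifier $S$, the translation of a goal is obtained conjunct by conjunct. A built-in atom is unchanged. A user atom $q(\overline t)$ becomes $q(\overline t,L,I,C,S)$ with $L,I,C$ new variables. An embedded implication $H\Rightarrow G$ with $H\equiv r(\overline t)\leftarrow\mathcal B$ becomes $\Rightarrow(h,[\overline X],G',J,S)$, where $h$ is a new rule identifier, $J$ is a new variable, $\overline X$ are the variables shared by $H$ and the rest of the enclosing rule (or of the initial goal), and $G'$ is the translation of $G$ for $S.J$. In addition, it contributes to the translated program the rule $$r(\overline t,[\overline X],h,S.J,S')\leftarrow reg(h,[\overline X],C^R)\wedge chk(C^R,S')\wedge\mathcal B',$$ where $S',C^R$ are new variables and $\mathcal B'$ is the translation of $\mathcal B$ for $S'$. A program rule $p(\overline s)\leftarrow\mathcal B$ becomes $p(\overline s,[\,],k,\epsilon,S)\leftarrow\mathcal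 B'$, with $k$ a new rule identifier, $S$ a new variable and $\mathcal B'$ the translation of $\mathcal B$ for $S$. For a program $\Pi$ and an initial goal $\leftarrow\mathcal Q$, let $\mathcal Q'$ be the translation of $\mathcal Q$ for $\epsilon$, and let $\Pi'$ consist of the translations of the rules of $\Pi$ together with all the rules contributed by the embedded implications in $\Pi$ and in $\mathcal Q$. **SLD resolution.** States are $\langle\leftarrow\mathcal Q,\theta,\Pi\rangle$, and the leftmost atom is selected. User, built-in and $reg/3$ atoms are resolved with new variants of clauses in the usual way, and the clauses $$\Rightarrow(I,X,G,J,S)\leftarrow get\_ci(J)\wedge reg\_rule(I,X,J,S)\wedge call(G),\qquad reg\_rule(I,X,J,S)\leftarrow assertz(reg(I,X,S.J))$$ are available. A call $get\_ci(J)$ unifies $J$ with an integer that it has not returned before, $assertz(c)$ adds the clause $c$ to the program component of the state, $call(G)$ executes $G$, and $chk(s_1,s_2)$ succeeds iff $s_1\preceq s_2$. Write $\to$ for this transition relation. **Proposition.** Let $\Pi$ be a program and $\leftarrow\mathcal Q$ a goal, with translations $\Pi'$ and $\mathcal Q'$. Let $W$ be any finite set of variables that contains $\mathcal Var(\mathcal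 Q)\cup\mathcal Var(\mathcal Q')$. In the derivations below, variants are renamed with variables outside $W$ that have not been used before. Then there exists a successful HSLD derivation $$\langle\leftarrow\mathcal Q,id,\Pi\rangle\rightsquigarrow^*\langle\square,\sigma,\Pi\rangle$$ iff there exists a successful SLD derivation $$\langle\leftarrow\mathcal Q',id,\Pi'\rangle\to^*\langle\square,\sigma',\Pi''\rangle,$$ with $\sigma=\sigma'\,[\mathcal Var(\mathcal Q)]$, that is, $x\sigma=x\sigma'$ for all $x\in\mathcal Var(\mathcal Q)$. Precisely, for every such HSLD derivation there is such an SLD derivation with $\sigma=\sigma'\,[\mathcal Var(\mathcal Q)]$, and for every such SLD derivation there is such an HSLD derivation with $\sigma=\sigma'\,[\mathcal Var(\mathcal Q)]$. Moreover, for every such SLD derivation, $\Pi''=\Pi'\cup\Pi_{reg}$, where $\Pi_{reg}$ is the set of all the facts asserted in it, and each of these is a registration $reg(h,[t_1,\dots,t_n],s.j)$ with $h$ the identifier of a translated hypothesis of $\Pi'$ and $s.j$ a context identifier. -/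

import Mathlib

namespace HypLP

universe u v w

/-! ### Terms and substitutions -/

/-- First-order terms over the function symbols `F`, with the integers and the list constructors of
Prolog.  Variables are natural numbers. A symbol `f : F` may be used with every arity. -/
inductive Term (F : Type*) where
  | var (x : ℕ)
  | int (z : ℤ)
  | nil
  | cons (h t : Term F)
  | fn (f : F) {n : ℕ} (ts : Fin n → Term F)

/-- Substitutions, as functions on variables. -/
abbrev Subst (F : Type*) := ℕ → Term F

namespace Term

variable {F : Type*}

/-- The instance `t σ`. -/
def subst (σ : Subst F) : Term F → Term F
  | var x => σ x
  | int z => int z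
  | nil => nil
  | cons h t => cons (h.subst σ) (t.subst σ)
  | fn f ts => fn f (fun i => (ts i).subst σ)

/-- The variables of a term. -/
def vars : Term F → Finset ℕ
  | var x => {x}
  | int _ => ∅
  | nil => ∅
  | cons h t => h.vars ∪ t.vars
  | fn _ ts => Finset.univ.biUnion (fun i => (ts i).vars)

/-- The Prolog list `[t₁, …, tₙ]`. -/
def list (ts : List (Term F)) : Term F := ts.foldr cons nil

/-- The term for a context identifier: the list of its indexes, latest index first.
The empty context identifier `ε` is `[]` and `s.i` is `[i|s]`. -/
def ctx (c : List ℤ) : Term F := list (c.map int)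

end Term

/-- The identity substitution. -/
def Subst.id {F : Type*} : Subst F := Term.var

/-- The composition `θσ` (first `θ`, then `σ`). -/
def Subst.comp {F : Type*} (θ σ : Subst F) : Subst F := fun x => (θ x).subst σ

/-- The substitution that renames variables by the permutation `ρ`. -/
def renameBy {F : Type*} (ρ : Equiv.Perm ℕ) : Subst F := fun x => Term.var (ρ x)

/-- Instance of an argument list. -/
def substArgs {F : Type*} (σ : Subst F) (ts : List (Term F)) : List (Term F) :=
  ts.map (Term.subst σ)

/-- Variables of an argument list. -/
def varsArgs {F : Type*} : List (Term F) → Finset ℕ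
  | [] => ∅
  | t :: ts => t.vars ∪ varsArgs ts

/-- `σ` is an (idempotent) most general unifier of the argument lists `ts` and `us`. -/
structure IsMGU {F : Type*} (σ : Subst F) (ts us : List (Term F)) : Prop where
  unifies : substArgs σ ts = substArgs σ us
  general : ∀ τ : Subst F, substArgs τ ts = substArgs τ us → ∃ δ : Subst F, τ = σ.comp δ
  idempotent : σ.comp σ = σ

/-! ### Hypothetical programs and goals

`F`, `P`, `K` are the function symbols, the user predicates and the built-in predicates. -/

/-- Goals: finite conjunctions of calls to user predicates, calls to built-in predicates, and
embedded implications, written as the leftmost conjunct followed by the rest of the goal.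
`nil` is the empty goal `□`, which is also the body `true` of a fact.
In `imp p ts b g q`, the first conjunct is `(p(ts) ← b) ⇒ g`. -/
inductive Goal (F P K : Type*) where
  | nil
  | user (p : P) (ts : List (Term F)) (rest : Goal F P K)
  | builtin (k : K) (ts : List (Term F)) (rest : Goal F P K)
  | imp (p : P) (ts : List (Term F)) (body : Goal F P K) (g : Goal F P K) (rest : Goal F P K)

namespace Goal

variable {F P K : Type*}

/-- Conjunction of goals. -/
def append : Goal F P K → Goal F P K → Goal F P K
  | nil, r => r
  | user p ts q, r => user p ts (q.append r)
  | builtin k ts q, r => builtin k ts (q.append r)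
  | imp p ts b g q, r => imp p ts b g (q.append r)

/-- Instance of a goal. A substitution acts on both sides of an embedded implication. -/
def subst (σ : Subst F) : Goal F P K → Goal F P K
  | nil => nil
  | user p ts q => user p (substArgs σ ts) (q.subst σ)
  | builtin k ts q => builtin k (substArgs σ ts) (q.subst σ)
  | imp p ts b g q => imp p (substArgs σ ts) (b.subst σ) (g.subst σ) (q.subst σ)

/-- All variables of a goal. -/
def vars : Goal F P K → Finset ℕ
  | nil => ∅
  | user _ ts q => varsArgs ts ∪ q.vars
  | builtin _ ts q => varsArgs ts ∪ q.vars
  | imp _ ts b g q => varsArgs ts ∪ b.vars ∪ g.vars ∪ q.vars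

end Goal

/-- Rules `p(args) ← body`. -/
structure Rule (F P K : Type*) where
  pred : P
  args : List (Term F)
  body : Goal F P K

namespace Rule

variable {F P K : Type*}

def subst (σ : Subst F) (R : Rule F P K) : Rule F P K :=
  ⟨R.pred, substArgs σ R.args, R.body.subst σ⟩

def vars (R : Rule F P K) : Finset ℕ := varsArgs R.args ∪ R.body.vars

end Rule

/-! ### Hypothetical SLD resolution -/

/-- States `⟨← goal, sub, prog⟩`. The component `used` only does the bookkeeping for standardising
apart: it holds the variables that may no longer be used to rename rules. -/
structure HState (F P K : Type*) where
  goal : Goal F P K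
  sub : Subst F
  prog : Set (Rule F P K)
  used : Finset ℕ

/- The rules of a program, hypotheses included, are universally quantified, so a rule is used through
a variant with new variables. Built-in predicates are given by a (possibly infinite) set of
facts: `B k` holds the argument lists of the facts for the built-in `k`. -/
mutual

/-- One step of hypothetical SLD resolution. -/
inductive HStep {F : Type u} {P : Type v} {K : Type w} (B : K → Set (List (Term F))) :
    HState F P K → HState F P K → Prop where
  | rule {p : P} {ts : List (Term F)} {q : Goal F P K} {θ σ : Subst F}
      {prog : Set (Rule F P K)} {used : Finset ℕ} {R R' : Rule F P K} (ρ : Equiv.Perm ℕ)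
      (hR : R ∈ prog) (hR' : R' = R.subst (renameBy ρ)) (hfresh : Disjoint R'.vars used)
      (hp : R'.pred = p) (hσ : IsMGU σ R'.args ts) :
      HStep B ⟨.user p ts q, θ, prog, used⟩
        ⟨(R'.body.append q).subst σ, θ.comp σ, prog, used ∪ R'.vars⟩
  | builtin {k : K} {ts us us' : List (Term F)} {q : Goal F P K} {θ σ : Subst F}
      {prog : Set (Rule F P K)} {used : Finset ℕ} (ρ : Equiv.Perm ℕ)
      (hB : us ∈ B k) (hus' : us' = substArgs (renameBy ρ) us)
      (hfresh : Disjoint (varsArgs us') used) (hσ : IsMGU σ us' ts) :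
      HStep B ⟨.builtin k ts q, θ, prog, used⟩
        ⟨q.subst σ, θ.comp σ, prog, used ∪ varsArgs us'⟩
  | hyp {p : P} {ts : List (Term F)} {b g q : Goal F P K} {θ σ : Subst F}
      {prog prog' : Set (Rule F P K)} {used used' : Finset ℕ}
      (hprog' : prog' = prog ∪ {⟨p, ts, b⟩})
      (hsub : HSteps B ⟨g, Subst.id, prog', used⟩ ⟨.nil, σ, prog', used'⟩) :
      HStep B ⟨.imp p ts b g q, θ, prog, used⟩ ⟨q.subst σ, θ.comp σ, prog, used'⟩

/-- Finite sequences of steps. -/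
inductive HSteps {F : Type u} {P : Type v} {K : Type w} (B : K → Set (List (Term F))) :
    HState F P K → HState F P K → Prop where
  | refl (s : HState F P K) : HSteps B s s
  | head {s t u : HState F P K} (hst : HStep B s t) (htu : HSteps B t u) : HSteps B s u

end

/-- There is a successful derivation `⟨← Q, id, prog⟩ →* ⟨□, σ, prog⟩` in which the rules are renamed
outside the set of variables `used`. -/
def HSucceeds {F P K : Type*} (B : K → Set (List (Term F))) (prog : Set (Rule F P K))
    (used : Finset ℕ) (Q : Goal F P K) (σ : Subst F) : Prop :=
  ∃ used', HSteps B ⟨Q, Subst.id, prog, used⟩ ⟨.nil, σ, prog, used'⟩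

/-! ### The target language -/

/-- Goals of the translated programs.
* `user p ts` is a call to a translated user predicate, with its four additional arguments in `ts`;
* `imp i xs g ic sc` is `⇒(i, xs, g, ic, sc)`, `getCi t` is `get_ci(t)`,
  `regRule i xs ic sc` is `reg_rule(i, xs, ic, sc)`, `assertReg i xs c` is
  `assertz(reg(i, xs, c))`, `reg i xs c` is `reg(i, xs, c)`, `chk c d` is `chk(c, d)` and
  `call g` is `call(g)`. -/
inductive TGoal (F P K : Type*) where
  | nil
  | user (p : P) (ts : List (Term F)) (rest : TGoal F P K)
  | builtin (k : K) (ts : List (Term F)) (rest : TGoal F P K)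
  | imp (i xs : Term F) (g : TGoal F P K) (ic sc : Term F) (rest : TGoal F P K)
  | getCi (t : Term F) (rest : TGoal F P K)
  | regRule (i xs ic sc : Term F) (rest : TGoal F P K)
  | assertReg (i xs c : Term F) (rest : TGoal F P K)
  | reg (i xs c : Term F) (rest : TGoal F P K)
  | chk (c d : Term F) (rest : TGoal F P K)
  | call (g : TGoal F P K) (rest : TGoal F P K)

namespace TGoal

variable {F P K : Type*}

def append : TGoal F P K → TGoal F P K → TGoal F P K
  | nil, r => r
  | user p ts q, r => user p ts (q.append r)
  | builtin k ts q, r => builtin k ts (q.append r)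
  | imp i xs g ic sc q, r => imp i xs g ic sc (q.append r)
  | getCi t q, r => getCi t (q.append r)
  | regRule i xs ic sc q, r => regRule i xs ic sc (q.append r)
  | assertReg i xs c q, r => assertReg i xs c (q.append r)
  | reg i xs c q, r => reg i xs c (q.append r)
  | chk c d q, r => chk c d (q.append r)
  | call g q, r => call g (q.append r)

def subst (σ : Subst F) : TGoal F P K → TGoal F P K
  | nil => nil
  | user p ts q => user p (substArgs σ ts) (q.subst σ)
  | builtin k ts q => builtin k (substArgs σ ts) (q.subst σ)
  | imp i xs g ic sc q =>
      imp (i.subst σ) (xs.subst σ) (g.subst σ) (ic.subst σ) (sc.subst σ) (q.subst σ)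
  | getCi t q => getCi (t.subst σ) (q.subst σ)
  | regRule i xs ic sc q =>
      regRule (i.subst σ) (xs.subst σ) (ic.subst σ) (sc.subst σ) (q.subst σ)
  | assertReg i xs c q => assertReg (i.subst σ) (xs.subst σ) (c.subst σ) (q.subst σ)
  | reg i xs c q => reg (i.subst σ) (xs.subst σ) (c.subst σ) (q.subst σ)
  | chk c d q => chk (c.subst σ) (d.subst σ) (q.subst σ)
  | call g q => call (g.subst σ) (q.subst σ)

def vars : TGoal F P K → Finset ℕ
  | nil => ∅
  | user _ ts q => varsArgs ts ∪ q.vars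
  | builtin _ ts q => varsArgs ts ∪ q.vars
  | imp i xs g ic sc q => i.vars ∪ xs.vars ∪ g.vars ∪ ic.vars ∪ sc.vars ∪ q.vars
  | getCi t q => t.vars ∪ q.vars
  | regRule i xs ic sc q => i.vars ∪ xs.vars ∪ ic.vars ∪ sc.vars ∪ q.vars
  | assertReg i xs c q => i.vars ∪ xs.vars ∪ c.vars ∪ q.vars
  | reg i xs c q => i.vars ∪ xs.vars ∪ c.vars ∪ q.vars
  | chk c d q => c.vars ∪ d.vars ∪ q.vars
  | call g q => g.vars ∪ q.vars

end TGoal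

/-- Clauses of the translated programs: rules `p(ts) ← body` for user predicates and
facts `reg(i, xs, c)`. -/
inductive TClause (F P K : Type*) where
  | rule (p : P) (ts : List (Term F)) (body : TGoal F P K)
  | regFact (i xs c : Term F)

namespace TClause

variable {F P K : Type*}

def vars : TClause F P K → Finset ℕ
  | rule _ ts b => varsArgs ts ∪ b.vars
  | regFact i xs c => i.vars ∪ xs.vars ∪ c.vars

def subst (σ : Subst F) : TClause F P K → TClause F P K
  | rule p ts b => rule p (substArgs σ ts) (b.subst σ)
  | regFact i xs c => regFact (i.subst σ) (xs.subst σ) (c.subst σ)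

end TClause

/-! ### SLD resolution for translated programs -/

/-- States `⟨← goal, sub, prog⟩`. The program is part of the state because `assertz` extends it.
`used` holds the variables that may no longer be used to rename clauses, `ids` the integers that
`get_ci` has returned so far. -/
structure SState (F P K : Type*) where
  goal : TGoal F P K
  sub : Subst F
  prog : Set (TClause F P K)
  used : Finset ℕ
  ids : Finset ℤ

/-- One step of SLD resolution with the leftmost selection rule. Calls to user predicates, to `reg`
and to built-in predicates are resolved with variants of clauses; `imp` and `regRule` are resolved
with the clauses
`⇒(I, X, G, J, S) ← get_ci(J) ∧ reg_rule(I, X, J, S) ∧ call(G)` and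
`reg_rule(I, X, J, S) ← assertz(reg(I, X, S.J))`;
`get_ci` returns an integer that it has not returned before, `assertz` adds a clause to the program,
and `chk` checks that the first context identifier is a prefix of the second one
(a suffix of the lists, which are reversed). -/
inductive SStep {F P K : Type*} (B : K → Set (List (Term F))) :
    SState F P K → SState F P K → Prop where
  | rule {p : P} {ts us : List (Term F)} {b q : TGoal F P K} {θ σ : Subst F}
      {prog : Set (TClause F P K)} {used : Finset ℕ} {ids : Finset ℤ} {C : TClause F P K}
      (ρ : Equiv.Perm ℕ) (hC : C ∈ prog) (hC' : C.subst (renameBy ρ) = .rule p us b)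
      (hfresh : Disjoint (C.subst (renameBy ρ)).vars used) (hσ : IsMGU σ us ts) :
      SStep B ⟨.user p ts q, θ, prog, used, ids⟩
        ⟨(b.append q).subst σ, θ.comp σ, prog, used ∪ (C.subst (renameBy ρ)).vars, ids⟩
  | reg {i xs c i' xs' c' : Term F} {q : TGoal F P K} {θ σ : Subst F}
      {prog : Set (TClause F P K)} {used : Finset ℕ} {ids : Finset ℤ} {C : TClause F P K}
      (ρ : Equiv.Perm ℕ) (hC : C ∈ prog) (hC' : C.subst (renameBy ρ) = .regFact i' xs' c')
      (hfresh : Disjoint (C.subst (renameBy ρ)).vars used)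
      (hσ : IsMGU σ [i', xs', c'] [i, xs, c]) :
      SStep B ⟨.reg i xs c q, θ, prog, used, ids⟩
        ⟨q.subst σ, θ.comp σ, prog, used ∪ (C.subst (renameBy ρ)).vars, ids⟩
  | builtin {k : K} {ts us us' : List (Term F)} {q : TGoal F P K} {θ σ : Subst F}
      {prog : Set (TClause F P K)} {used : Finset ℕ} {ids : Finset ℤ} (ρ : Equiv.Perm ℕ)
      (hB : us ∈ B k) (hus' : us' = substArgs (renameBy ρ) us)
      (hfresh : Disjoint (varsArgs us') used) (hσ : IsMGU σ us' ts) :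
      SStep B ⟨.builtin k ts q, θ, prog, used, ids⟩
        ⟨q.subst σ, θ.comp σ, prog, used ∪ varsArgs us', ids⟩
  | imp {i xs ic sc : Term F} {g q : TGoal F P K} {θ : Subst F}
      {prog : Set (TClause F P K)} {used : Finset ℕ} {ids : Finset ℤ} :
      SStep B ⟨.imp i xs g ic sc q, θ, prog, used, ids⟩
        ⟨.getCi ic (.regRule i xs ic sc (.call g q)), θ, prog, used, ids⟩
  | getCi {t : Term F} {q : TGoal F P K} {θ σ : Subst F}
      {prog : Set (TClause F P K)} {used : Finset ℕ} {ids : Finset ℤ} (z : ℤ)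
      (hz : z ∉ ids) (hσ : IsMGU σ [t] [.int z]) :
      SStep B ⟨.getCi t q, θ, prog, used, ids⟩
        ⟨q.subst σ, θ.comp σ, prog, used, insert z ids⟩
  | regRule {i xs ic sc : Term F} {q : TGoal F P K} {θ : Subst F}
      {prog : Set (TClause F P K)} {used : Finset ℕ} {ids : Finset ℤ} :
      SStep B ⟨.regRule i xs ic sc q, θ, prog, used, ids⟩
        ⟨.assertReg i xs (.cons ic sc) q, θ, prog, used, ids⟩
  | assertReg {i xs c : Term F} {q : TGoal F P K} {θ : Subst F}
      {prog : Set (TClause F P K)} {used : Finset ℕ} {ids : Finset ℤ} :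
      SStep B ⟨.assertReg i xs c q, θ, prog, used, ids⟩
        ⟨q, θ, prog ∪ {.regFact i xs c}, used, ids⟩
  | chk {c d : List ℤ} {q : TGoal F P K} {θ : Subst F}
      {prog : Set (TClause F P K)} {used : Finset ℕ} {ids : Finset ℤ} (hcd : c <:+ d) :
      SStep B ⟨.chk (.ctx c) (.ctx d) q, θ, prog, used, ids⟩ ⟨q, θ, prog, used, ids⟩
  | call {g q : TGoal F P K} {θ : Subst F}
      {prog : Set (TClause F P K)} {used : Finset ℕ} {ids : Finset ℤ} :
      SStep B ⟨.call g q, θ, prog, used, ids⟩ ⟨g.append q, θ, prog, used, ids⟩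

/-- The fact that is asserted in the step from a state, if its leftmost goal is an `assertz`. -/
def SState.asserted {F P K : Type*} (s : SState F P K) : Set (TClause F P K) :=
  match s.goal with
  | .assertReg i xs c _ => {.regFact i xs c}
  | _ => ∅

/-- `SSteps B s A t`: there is a derivation from `s` to `t`, and `A` is the set of all the
`reg/3` assertions that are made in it. -/
inductive SSteps {F P K : Type*} (B : K → Set (List (Term F))) :
    SState F P K → Set (TClause F P K) → SState F P K → Prop where
  | refl (s : SState F P K) : SSteps B s ∅ s
  | head {s t u : SState F P K} {A : Set (TClause F P K)} (hst : SStep B s t)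
      (htu : SSteps B t A u) : SSteps B s (s.asserted ∪ A) u

/-- There is a successful derivation `⟨← Q, id, prog⟩ →* ⟨□, σ, prog'⟩` in which clauses are
renamed outside the set of variables `used`, and `A` is the set of the assertions made in it. -/
def SSucceeds {F P K : Type*} (B : K → Set (List (Term F))) (prog : Set (TClause F P K))
    (used : Finset ℕ) (Q : TGoal F P K) (σ : Subst F) (A prog' : Set (TClause F P K)) : Prop :=
  ∃ used' ids', SSteps B ⟨Q, Subst.id, prog, used, ∅⟩ A ⟨.nil, σ, prog', used', ids'⟩

/-! ### Translation -/

/-- Result of a translation: the goal, the list of the translated hypotheses of its embedded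
implications, and the next unused variable and rule identifier. -/
structure Translated (F P K : Type*) where
  goal : TGoal F P K
  hyps : List (TClause F P K)
  nextVar : ℕ
  nextId : ℕ

/-- The list of variables in a finite set, as a term. -/
def varList {F : Type*} (X : Finset ℕ) : Term F := .list ((X.sort (· ≤ ·)).map .var)

/-- Translation of a goal for the current context identifier `S`. `outer` is the set of the variables
of the enclosing rule that occur outside the goal; the variables from `v` on and the rule
identifiers from `i` on are new. For an embedded implication `H ⇒ G`,
* `v` is `I^C`, `v + 1` the current context identifier in the translation of `H`, `v + 2` is `C^R`;
* `X` is the list of the variables that occur both in `H` and in the rest of the rule. -/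
def Goal.translate {F P K : Type*} :
    Goal F P K → (S : Term F) → (outer : Finset ℕ) → (v i : ℕ) → Translated F P K
  | .nil, _, _, v, i => ⟨.nil, [], v, i⟩
  | .user p ts q, S, outer, v, i =>
      let r := q.translate S (outer ∪ varsArgs ts) (v + 3) i
      { goal := .user p (ts ++ [.var v, .var (v + 1), .var (v + 2), S]) r.goal
        hyps := r.hyps
        nextVar := r.nextVar
        nextId := r.nextId }
  | .builtin k ts q, S, outer, v, i =>
      let r := q.translate S (outer ∪ varsArgs ts) v i
      { goal := .builtin k ts r.goal
        hyps := r.hyps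
        nextVar := r.nextVar
        nextId := r.nextId }
  | .imp p ts b g q, S, outer, v, i =>
      let X : Term F := varList ((varsArgs ts ∪ b.vars) ∩ (outer ∪ g.vars ∪ q.vars))
      let SH : Term F := .cons (.var v) S
      let rb := b.translate (.var (v + 1)) (outer ∪ varsArgs ts ∪ g.vars ∪ q.vars) (v + 3) (i + 1)
      let rg := g.translate SH (outer ∪ varsArgs ts ∪ b.vars ∪ q.vars) rb.nextVar rb.nextId
      let rq := q.translate S (outer ∪ varsArgs ts ∪ b.vars ∪ g.vars) rg.nextVar rg.nextId
      let H : TClause F P K := .rule p (ts ++ [X, .int i, SH, .var (v + 1)])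
        (.reg (.int i) X (.var (v + 2)) (.chk (.var (v + 2)) (.var (v + 1)) rb.goal))
      { goal := .imp (.int i) X rg.goal (.var v) S rq.goal
        hyps := H :: (rb.hyps ++ rg.hyps ++ rq.hyps)
        nextVar := rq.nextVar
        nextId := rq.nextId }

/-- A variable larger than all those of a finite set. -/
def freshVar (X : Finset ℕ) : ℕ := X.sup id + 1

/-- Translation of a program rule, with rule identifier `i`: the rule
`p(args, [], i, ε, S) ← body'` and the translated hypotheses of its embedded implications;
the second component is the next unused rule identifier. -/
def Rule.translate {F P K : Type*} (R : Rule F P K) (i : ℕ) : List (TClause F P K) × ℕ :=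
  let S := freshVar R.vars
  let r := R.body.translate (.var S) (varsArgs R.args) (S + 1) (i + 1)
  (.rule R.pred (R.args ++ [.nil, .int i, .nil, .var S]) r.goal :: r.hyps, r.nextId)

/-- Translation of the rules of a program, with different rule identifiers, from `i` on. -/
def translateRules {F P K : Type*} : List (Rule F P K) → ℕ → List (TClause F P K) × ℕ
  | [], i => ([], i)
  | R :: Rs, i =>
      let r := R.translate i
      let rs := translateRules Rs r.2
      (r.1 ++ rs.1, rs.2)

/-- Translation of the initial goal, for the initial context identifier `ε`. -/
def translateQuery {F P K : Type*} (prog : List (Rule F P K)) (Q : Goal F P K) :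
    Translated F P K :=
  Q.translate .nil ∅ (freshVar Q.vars) (translateRules prog 0).2

/-- The goal translation of the initial goal. -/
def goalTranslation {F P K : Type*} (prog : List (Rule F P K)) (Q : Goal F P K) : TGoal F P K :=
  (translateQuery prog Q).goal

/-- The translated program: the translation of each rule, with the translated hypotheses of the
embedded implications in the program and in the initial goal. -/
def programTranslation {F P K : Type*} (prog : List (Rule F P K)) (Q : Goal F P K) :
    Set (TClause F P K) :=
  {C | C ∈ (translateRules prog 0).1 ++ (translateQuery prog Q).hyps}

/-- `C` is a registration `reg(i, [t₁, …, tₙ], s.j)` of a translated hypothesis (a rule of `prog` with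
rule identifier `i` that is guarded by a call to `reg`) for a context identifier `s.j`. -/
def IsRegistration {F P K : Type*} (prog : Set (TClause F P K)) (C : TClause F P K) : Prop :=
  ∃ (i : ℤ) (ts : List (Term F)) (j : ℤ) (s : List ℤ),
    C = .regFact (.int i) (.list ts) (.ctx (j :: s)) ∧
    ∃ (p : P) (us : List (Term F)) (X SH S CR : Term F) (b : TGoal F P K),
      TClause.rule p (us ++ [X, .int i, SH, S]) (.reg (.int i) X CR (.chk CR S b)) ∈ prog

end HypLP

open HypLP

namespace HypLP

universe u v w

/-! ### Terms and substitutions -/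

section Terms

variable {F : Type*}

-- Both calculi are run side by side, and an invariant (`Linked`) relates the two states. The goals
-- have the same shape (`Corresponds`). Their variables split into visible ones `V`, on which both
-- computed substitutions agree, and private ones `N`: the additional variables of the translation,
-- which the source never sees, and the local variables of hypotheses, which the translated goal
-- does not contain because it keeps only the list of shared variables. Answers agree on visible
-- variables, and neither side moves the local ones, so they agree on all of `Q`.
--
-- The programs are related by `ProgramInv`. Registrations are never retracted, whereas an assumed
-- hypothesis disappears when its implication has been solved; the prefix test makes up for this.
-- Every embedded implication extends the current context by an integer that was not returned
-- before, so the registrations whose context is a prefix of the current one are those of the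
-- implications still open (`ProgramInv.assume`, `ProgramInv.union`).
--
-- A source step with a hypothesis corresponds to three target steps: the call, the lookup with
-- `reg`, and `chk`. The two target unifications together say the same as the source unification
-- plus equations `z = δ z` for the additional variables and the shared variables of the clause
-- (`HypEntry.unify_iff`). If `σ` is a source mgu then `δσ` is a most general solution of the
-- combined problem (`IsPrincipal.eliminate`), and it factors through any idempotent mgu of the head
-- that fixes the variables fixed by `δσ` (`IsPrincipal.split`). Conversely, a target mgu may orient
-- equations between two variables differently from `δ`; a permutation of new variables repairs this
-- (`IsPrincipal.exists_rename`) and is absorbed into the variant of the source rule. Hence the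
-- answers are equal, and not only equal up to renaming. `IsResolution` collects what both
-- directions need, and `IsResolution.exists_linked` restores the invariant from it.
--
-- The given derivation also fixes a finite set `Z` of all variables that it ever uses. The
-- simulating derivation takes its surplus variables outside `Z`, so that variables which are new on
-- one side later are new on the other side too. `HBig.simulate` is the induction from source to
-- target. `SStepsN.reflect` is the converse, by induction on the length of the target derivation.

@[simp] theorem Term.subst_id (t : Term F) : t.subst Subst.id = t := by
  induction t with
  | var x => rfl
  | int z => rfl
  | nil => rfl
  | cons h t ihh iht => simp [Term.subst, ihh, iht]
  | fn f ts ih => simp [Term.subst, ih]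

theorem Term.subst_comp (σ τ : Subst F) (t : Term F) :
    t.subst (σ.comp τ) = (t.subst σ).subst τ := by
  induction t with
  | var x => rfl
  | int z => rfl
  | nil => rfl
  | cons h t ihh iht => simp [Term.subst, ihh, iht]
  | fn f ts ih => simp [Term.subst, ih]

theorem Subst.comp_assoc (σ τ υ : Subst F) : (σ.comp τ).comp υ = σ.comp (τ.comp υ) := by
  funext x
  simp [Subst.comp, ← Term.subst_comp]

@[simp] theorem Subst.id_comp (σ : Subst F) : Subst.id.comp σ = σ := rfl

@[simp] theorem Subst.comp_id (σ : Subst F) : σ.comp Subst.id = σ := by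
  funext x; simp [Subst.comp]

theorem Term.subst_eq_iff {σ τ : Subst F} {t : Term F} :
    t.subst σ = t.subst τ ↔ ∀ x ∈ t.vars, σ x = τ x := by
  induction t with
  | var x => simp [Term.subst, Term.vars]
  | int z => simp [Term.subst, Term.vars]
  | nil => simp [Term.subst, Term.vars]
  | cons h t ihh iht =>
    simp only [Term.subst, Term.vars, Term.cons.injEq, ihh, iht, Finset.mem_union]
    grind
  | fn f ts ih =>
    simp only [Term.subst, Term.vars, Term.fn.injEq, heq_eq_eq, true_and, funext_iff, ih,
      Finset.mem_biUnion, Finset.mem_univ]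
    grind

theorem Term.subst_congr {σ τ : Subst F} {t : Term F} (h : ∀ x ∈ t.vars, σ x = τ x) :
    t.subst σ = t.subst τ := Term.subst_eq_iff.2 h

theorem Term.subst_eq_self {σ : Subst F} {t : Term F} (h : ∀ x ∈ t.vars, σ x = .var x) :
    t.subst σ = t := by
  rw [Term.subst_congr (τ := Subst.id) h, Term.subst_id]

theorem Term.subst_eq_self_iff {σ : Subst F} {t : Term F} :
    t.subst σ = t ↔ ∀ x ∈ t.vars, σ x = .var x := by
  conv_lhs => rhs; rw [← Term.subst_id t]
  exact Term.subst_eq_iff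

theorem Term.mem_vars_subst {σ : Subst F} {t : Term F} {y : ℕ} :
    y ∈ (t.subst σ).vars ↔ ∃ x ∈ t.vars, y ∈ (σ x).vars := by
  induction t with
  | var x => simp [Term.subst, Term.vars]
  | int z => simp [Term.subst, Term.vars]
  | nil => simp [Term.subst, Term.vars]
  | cons h t ihh iht =>
    simp only [Term.subst, Term.vars, ihh, iht, Finset.mem_union]
    grind
  | fn f ts ih =>
    simp only [Term.subst, Term.vars, ih, Finset.mem_biUnion, Finset.mem_univ]
    grind

theorem Term.eq_var_of_subst_eq_var {σ : Subst F} {t : Term F} {x : ℕ}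
    (h : t.subst σ = .var x) : ∃ y, t = .var y := by
  cases t <;> simp_all [Term.subst]

/-- Pointwise form of idempotence: the variables in the range are fixed. Most calculations with
idempotent mgus below use it in this form. -/
theorem Subst.idempotent_iff {σ : Subst F} :
    σ.comp σ = σ ↔ ∀ x, ∀ y ∈ (σ x).vars, σ y = .var y := by
  simp only [funext_iff, Subst.comp, Term.subst_eq_self_iff]

@[simp] theorem mem_varsArgs {ts : List (Term F)} {x : ℕ} :
    x ∈ varsArgs ts ↔ ∃ t ∈ ts, x ∈ t.vars := by
  induction ts with
  | nil => simp [varsArgs]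
  | cons t ts ih => simp [varsArgs, ih]

theorem substArgs_comp (σ τ : Subst F) (ts : List (Term F)) :
    substArgs (σ.comp τ) ts = substArgs τ (substArgs σ ts) := by
  simp [substArgs, Term.subst_comp]

@[simp] theorem substArgs_id (ts : List (Term F)) : substArgs Subst.id ts = ts := by
  simp [substArgs, show Term.subst (Subst.id : Subst F) = _root_.id from
    funext Term.subst_id]

theorem substArgs_eq_iff {σ τ : Subst F} {ts : List (Term F)} :
    substArgs σ ts = substArgs τ ts ↔ ∀ x ∈ varsArgs ts, σ x = τ x := by
  simp only [substArgs, List.map_inj_left, Term.subst_eq_iff, mem_varsArgs]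
  grind

theorem substArgs_congr {σ τ : Subst F} {ts : List (Term F)}
    (h : ∀ x ∈ varsArgs ts, σ x = τ x) : substArgs σ ts = substArgs τ ts :=
  substArgs_eq_iff.2 h

theorem substArgs_eq_self {σ : Subst F} {ts : List (Term F)}
    (h : ∀ x ∈ varsArgs ts, σ x = .var x) : substArgs σ ts = ts := by
  rw [substArgs_congr (τ := Subst.id) h, substArgs_id]

theorem mem_varsArgs_substArgs {σ : Subst F} {ts : List (Term F)} {y : ℕ} :
    y ∈ varsArgs (substArgs σ ts) ↔ ∃ x ∈ varsArgs ts, y ∈ (σ x).vars := by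
  simp only [mem_varsArgs, substArgs, List.mem_map]
  constructor
  · rintro ⟨_, ⟨t, ht, rfl⟩, hy⟩
    obtain ⟨x, hx, hy⟩ := Term.mem_vars_subst.1 hy
    exact ⟨x, ⟨t, ht, hx⟩, hy⟩
  · rintro ⟨x, ⟨t, ht, hx⟩, hy⟩
    exact ⟨_, ⟨t, ht, rfl⟩, Term.mem_vars_subst.2 ⟨x, hx, hy⟩⟩

@[simp] theorem substArgs_append (σ : Subst F) (ts us : List (Term F)) :
    substArgs σ (ts ++ us) = substArgs σ ts ++ substArgs σ us := by
  simp [substArgs]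

@[simp] theorem Term.subst_list (σ : Subst F) (ts : List (Term F)) :
    (Term.list ts).subst σ = .list (substArgs σ ts) := by
  induction ts with
  | nil => rfl
  | cons t ts ih =>
    simp only [Term.list, substArgs, List.foldr_cons, Term.subst, List.map_cons] at ih ⊢
    rw [ih]

@[simp] theorem Term.vars_list (ts : List (Term F)) : (Term.list ts).vars = varsArgs ts := by
  induction ts with
  | nil => rfl
  | cons t ts ih =>
    simp only [Term.list, List.foldr_cons, Term.vars, varsArgs] at ih ⊢
    rw [ih]

theorem Term.list_injective : Function.Injective (Term.list : List (Term F) → Term F) := by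
  intro ts
  induction ts with
  | nil => intro us h; cases us <;> simp_all [Term.list]
  | cons t ts ih =>
    intro us h
    cases us with
    | nil => simp_all [Term.list]
    | cons u us =>
      simp only [Term.list, List.foldr_cons, Term.cons.injEq] at h
      rw [h.1, ih h.2]

/-- Needed to read back the two context identifiers from the terms in a successful `chk`. -/
theorem Term.ctx_injective : Function.Injective (Term.ctx : List ℤ → Term F) := by
  intro c d h
  exact List.map_injective_iff.2 (fun a b h => by simpa using h) (Term.list_injective h)

@[simp] theorem Term.vars_ctx (c : List ℤ) : (Term.ctx c : Term F).vars = ∅ := by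
  ext x
  simp [Term.ctx]
  simp [Term.vars]

@[simp] theorem Term.subst_ctx (σ : Subst F) (c : List ℤ) : (Term.ctx c).subst σ = .ctx c :=
  Term.subst_eq_self (by simp)

theorem Term.ctx_cons (z : ℤ) (c : List ℤ) :
    (Term.ctx (z :: c) : Term F) = .cons (.int z) (.ctx c) := rfl

/-- Variables that are solved by a list are thereby excluded from the variable-to-variable bindings
that may need a renaming. -/
theorem Term.list_ne_var (ts : List (Term F)) (x : ℕ) : Term.list ts ≠ .var x := by
  cases ts <;> simp [Term.list]

@[simp] theorem renameBy_apply (ρ : Equiv.Perm ℕ) (x : ℕ) :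
    (renameBy ρ : Subst F) x = .var (ρ x) := rfl

theorem renameBy_comp (ρ π : Equiv.Perm ℕ) :
    (renameBy ρ : Subst F).comp (renameBy π) = renameBy (ρ.trans π) := rfl

theorem Term.mem_vars_renameBy {ρ : Equiv.Perm ℕ} {t : Term F} {y : ℕ} :
    y ∈ (t.subst (renameBy ρ)).vars ↔ ∃ x ∈ t.vars, ρ x = y := by
  simp [Term.mem_vars_subst, Term.vars, eq_comm]

/-- Separates the equations for the original arguments of a predicate from those for its four
additional ones. -/
theorem substArgs_eq_append_iff {τ : Subst F} {ts us ts' us' : List (Term F)}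
    (h : us.length = us'.length) :
    substArgs τ (ts ++ us) = substArgs τ (ts' ++ us') ↔
      substArgs τ ts = substArgs τ ts' ∧ substArgs τ us = substArgs τ us' := by
  rw [substArgs_append, substArgs_append]
  constructor
  · intro h'
    exact List.append_inj' h' (by simpa [substArgs] using h)
  · rintro ⟨h1, h2⟩
    rw [h1, h2]

@[simp] theorem mem_varList_vars {X : Finset ℕ} {x : ℕ} :
    x ∈ (varList X : Term F).vars ↔ x ∈ X := by
  simp [varList, Term.vars]

theorem varList_subst_eq_iff {X : Finset ℕ} {σ τ : Subst F} :
    (varList X : Term F).subst σ = (varList X).subst τ ↔ ∀ x ∈ X, σ x = τ x := by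
  simp [Term.subst_eq_iff]

theorem varList_subst_eq_list (X : Finset ℕ) (σ : Subst F) :
    (varList X : Term F).subst σ = .list (substArgs σ ((X.sort (· ≤ ·)).map .var)) := by
  simp [varList]

/-- The number of symbols of a term. -/
def Term.size : Term F → ℕ
  | .var _ => 1
  | .int _ => 1
  | .nil => 1
  | .cons h t => h.size + t.size + 1
  | .fn _ ts => (∑ i, (ts i).size) + 1

/-- The occurs check: an instance of a term is strictly larger than the instance of any variable
that occurs properly inside it. -/
theorem Term.size_subst_le {σ : Subst F} {t : Term F} {x : ℕ} (hx : x ∈ t.vars) :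
    (σ x).size ≤ (t.subst σ).size ∧ (t ≠ .var x → (σ x).size < (t.subst σ).size) := by
  induction t with
  | var y =>
    obtain rfl : x = y := by simpa [Term.vars] using hx
    simp [Term.subst]
  | int z => simp [Term.vars] at hx
  | nil => simp [Term.vars] at hx
  | cons h t ihh iht =>
    simp only [Term.vars, Finset.mem_union] at hx
    have : (σ x).size < ((Term.cons h t).subst σ).size := by
      simp only [Term.subst, Term.size]
      rcases hx with hx | hx
      · have := (ihh hx).1; omega
      · have := (iht hx).1; omega
    exact ⟨this.le, fun _ => this⟩
  | fn f ts ih =>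
    simp only [Term.vars, Finset.mem_biUnion, Finset.mem_univ, true_and] at hx
    obtain ⟨i, hi⟩ := hx
    have : (σ x).size < ((Term.fn f ts).subst σ).size := by
      simp only [Term.subst, Term.size]
      have h1 := (ih i hi).1
      have h2 := Finset.single_le_sum (f := fun i => ((ts i).subst σ).size)
        (fun _ _ => Nat.zero_le _) (Finset.mem_univ i)
      omega
    exact ⟨this.le, fun _ => this⟩

/-! ### Most general unifiers -/

/-- `σ` is an idempotent most general solution of the constraint `E`. -/
def IsPrincipal (E : Subst F → Prop) (σ : Subst F) : Prop :=
  E σ ∧ ∀ τ, E τ → σ.comp τ = τ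

/-- Idempotence lets a unifier `τ` serve as its own factor: from `τ = σδ` and `σσ = σ` follows `στ =
τ`. The form with an arbitrary constraint is the useful one, since simultaneous unifications and
equations for solved variables are constraints as well. -/
theorem isMGU_iff {σ : Subst F} {ts us : List (Term F)} :
    IsMGU σ ts us ↔ IsPrincipal (fun τ => substArgs τ ts = substArgs τ us) σ := by
  constructor
  · intro h
    refine ⟨h.unifies, fun τ hτ => ?_⟩
    obtain ⟨δ, rfl⟩ := h.general τ hτ
    rw [← Subst.comp_assoc, h.idempotent]
  · intro h
    exact ⟨h.1, fun τ hτ => ⟨τ, (h.2 τ hτ).symm⟩, h.2 σ h.1⟩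

theorem IsPrincipal.idempotent {E : Subst F → Prop} {σ : Subst F} (h : IsPrincipal E σ) :
    σ.comp σ = σ := h.2 σ h.1

theorem IsPrincipal.congr {E E' : Subst F → Prop} {σ : Subst F} (h : IsPrincipal E σ)
    (hE : ∀ τ, E τ ↔ E' τ) : IsPrincipal E' σ :=
  ⟨(hE _).1 h.1, fun τ hτ => h.2 τ ((hE _).2 hτ)⟩

/-- `σ` moves only variables in `A`, and maps them to terms over `A`. -/
def SupportedOn (σ : Subst F) (A : Set ℕ) : Prop :=
  (∀ x ∉ A, σ x = .var x) ∧ ∀ x ∈ A, ∀ y ∈ (σ x).vars, y ∈ A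

theorem SupportedOn.mono {σ : Subst F} {A A' : Set ℕ} (h : SupportedOn σ A) (hA : A ⊆ A') :
    SupportedOn σ A' := by
  refine ⟨fun x hx => h.1 x (fun hx' => hx (hA hx')), fun x hx y hy => ?_⟩
  by_cases hxA : x ∈ A
  · exact hA (h.2 x hxA y hy)
  · rw [h.1 x hxA] at hy
    have : y = x := by simpa [Term.vars] using hy
    rwa [this]

theorem SupportedOn.comp {σ τ : Subst F} {A : Set ℕ} (hσ : SupportedOn σ A)
    (hτ : SupportedOn τ A) : SupportedOn (σ.comp τ) A := by
  refine ⟨fun x hx => ?_, fun x hx y hy => ?_⟩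
  · simp [Subst.comp, hσ.1 x hx, Term.subst, hτ.1 x hx]
  · obtain ⟨z, hz, hy⟩ := Term.mem_vars_subst.1 hy
    exact hτ.2 z (hσ.2 x hx z hz) y hy

theorem supportedOn_id (A : Set ℕ) : SupportedOn (Subst.id : Subst F) A := by
  refine ⟨fun x _ => rfl, fun x hx y hy => ?_⟩
  have : y = x := by simpa [Subst.id, Term.vars] using hy
  rwa [this]

/-- An idempotent most general solution of a constraint on the variables in `A` is relevant. -/
theorem IsPrincipal.supportedOn {E : Subst F → Prop} {σ : Subst F} (h : IsPrincipal E σ)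
    (hcomp : ∀ σ τ, E σ → E (σ.comp τ)) {A : Set ℕ}
    (hA : ∀ τ τ', (∀ x ∈ A, τ x = τ' x) → E τ → E τ') : SupportedOn σ A := by
  have hid := Subst.idempotent_iff.1 h.idempotent
  have h1 : ∀ x ∉ A, σ x = .var x := by
    intro x hx
    -- Resetting `x ∉ A` to itself in `σ` gives another solution, through which `σ` must factor. So
    -- `σ x` is a variable, and idempotence leaves no other choice than `x`.
    have hτ := h.2 (Function.update σ x (.var x)) (hA σ _ (fun y hy => by
      rw [Function.update_of_ne]; rintro rfl; exact hx hy) h.1)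
    have hx1 := congrFun hτ x
    simp only [Subst.comp, Function.update_self] at hx1
    obtain ⟨y, hy⟩ := Term.eq_var_of_subst_eq_var hx1
    by_cases hyx : y = x
    · rw [hy, hyx]
    · exfalso
      rw [hy] at hx1
      have := hid x y (by rw [hy]; simp [Term.vars])
      simp [Term.subst, Function.update_of_ne hyx, this] at hx1
      exact hyx hx1
  refine ⟨h1, fun x hx z hz => ?_⟩
  by_contra hzA
  -- Suppose that `z ∉ A` occurs in `σ x`. The substitution `τ` below is a solution because it
  -- agrees with `σκ` on `A`. Since `τ` fixes `z`, the variable occurs in `(σ x)τ = τ x`; but `κ`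
  -- has removed it from there.
  set κ : Subst F := Function.update Term.var z .nil with hκ
  set τ : Subst F := fun w => if w = z then .var z else (σ w).subst κ with hτdef
  have hτ := congrFun (h.2 τ (hA (σ.comp κ) _ (fun y hy => by
    have : y ≠ z := by rintro rfl; exact hzA hy
    simp [hτdef, this, Subst.comp]) (hcomp _ _ h.1))) x
  have hxz : x ≠ z := by rintro rfl; exact hzA hx
  have hmem : z ∈ (τ x).vars := by
    rw [← hτ]
    exact Term.mem_vars_subst.2 ⟨z, hz, by simp [hτdef, Term.vars]⟩
  simp only [hτdef, hxz, if_false] at hmem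
  obtain ⟨w, _, hw⟩ := Term.mem_vars_subst.1 hmem
  by_cases hwz : w = z
  · simp [hκ, hwz, Term.vars] at hw
  · simp [hκ, hwz, Term.vars] at hw
    exact hwz hw.symm

theorem IsMGU.supportedOn {σ : Subst F} {ts us : List (Term F)} (h : IsMGU σ ts us) :
    SupportedOn σ {x | x ∈ varsArgs ts ∨ x ∈ varsArgs us} := by
  refine (isMGU_iff.1 h).supportedOn (fun σ τ hσ => ?_) (fun τ τ' hτ hE => ?_)
  · rw [substArgs_comp, substArgs_comp, hσ]
  · rwa [← substArgs_congr (σ := τ) (fun x hx => hτ x (Or.inl hx)),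
      ← substArgs_congr (σ := τ) (fun x hx => hτ x (Or.inr hx))]

/-- Constraints can be solved one after the other: precomposition with `σ` does not change a
solution of `E`, so the second constraint may be posed for `σ.comp υ`. This describes two
consecutive resolution steps. -/
theorem IsPrincipal.join {E E' : Subst F → Prop} {σ τ : Subst F} (hσ : IsPrincipal E σ)
    (hcomp : ∀ σ τ, E σ → E (σ.comp τ))
    (hτ : IsPrincipal (fun υ => E' (σ.comp υ)) τ) :
    IsPrincipal (fun υ => E υ ∧ E' υ) (σ.comp τ) := by
  refine ⟨⟨hcomp _ _ hσ.1, hτ.1⟩, fun υ hυ => ?_⟩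
  have h1 := hσ.2 υ hυ.1
  rw [Subst.comp_assoc, hτ.2 υ (by simpa only [h1] using hυ.2), h1]

/-- An idempotent most general solution of a conjunction factors through every idempotent most general
solution of the first conjunct that fixes the variables that it fixes. -/
theorem IsPrincipal.split {E E' : Subst F → Prop} {Θ σ : Subst F}
    (hΘ : IsPrincipal (fun υ => E υ ∧ E' υ) Θ) (hcomp : ∀ σ τ, E σ → E (σ.comp τ))
    (hσ : IsPrincipal E σ) (hfix : ∀ x, Θ x = .var x → σ x = .var x) :
    ∃ τ, IsPrincipal (fun υ => E' (σ.comp υ)) τ ∧ σ.comp τ = Θ := by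
  classical
  have hσid := Subst.idempotent_iff.1 hσ.idempotent
  have hΘid := Subst.idempotent_iff.1 hΘ.idempotent
  have h1 : σ.comp Θ = Θ := hσ.2 Θ hΘ.1.1
  have h2 : Θ.comp σ = Θ := by
    funext x
    exact Term.subst_eq_self (fun y hy => hfix y (hΘid x y hy))
  set τ : Subst F := fun x => if σ x = .var x then Θ x else .var x with hτ
  have h3 : σ.comp τ = Θ := by
    rw [← h1]
    funext x
    refine Term.subst_congr (fun y hy => ?_)
    simp [hτ, hσid x y hy]
  refine ⟨τ, ⟨show E' (σ.comp τ) by rw [h3]; exact hΘ.1.2, fun υ hυ => ?_⟩, h3⟩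
  have h4 := hΘ.2 (σ.comp υ) ⟨hcomp _ _ hσ.1, hυ⟩
  rw [← Subst.comp_assoc, h2] at h4
  funext x
  by_cases hx : σ x = .var x
  · have := congrFun h4 x
    simp only [Subst.comp, hx, Term.subst, hτ, if_true] at this ⊢
    exact this
  · simp [Subst.comp, hτ, hx, Term.subst]

theorem Subst.eliminate_comp {x : ℕ} {t : Term F} {τ : Subst F} (h : τ x = t.subst τ) :
    Subst.comp (Function.update Term.var x t) τ = τ := by
  funext y
  by_cases hy : y = x
  · subst hy; simp [Subst.comp, h]
  · simp [Subst.comp, hy, Term.subst]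

theorem isPrincipal_eliminate {x : ℕ} {t : Term F} (hx : x ∉ t.vars) :
    IsPrincipal (fun τ : Subst F => τ x = t.subst τ) (Function.update Term.var x t) := by
  refine ⟨?_, fun τ hτ => Subst.eliminate_comp hτ⟩
  show Function.update Term.var x t x = t.subst (Function.update Term.var x t)
  rw [Function.update_self, Term.subst_eq_self]
  intro y hy
  rw [Function.update_of_ne]
  rintro rfl
  exact hx hy

theorem isPrincipal_of_forall {E : Subst F → Prop} (h : ∀ τ, E τ) : IsPrincipal E Subst.id :=
  ⟨h _, fun _ _ => rfl⟩

/-- The equation is oriented so that no variable fixed by `Θ` gets bound. If `Θ` fixes `x`, then `t`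
is a variable that `Θ` sends to `x`, and that one is eliminated; otherwise `x` is, and comparing
sizes under `Θ` gives the occurs check. -/
theorem exists_isPrincipal_var {Θ : Subst F} {x : ℕ} {t : Term F} (h : Θ x = t.subst Θ) :
    ∃ σ, IsPrincipal (fun τ : Subst F => τ x = t.subst τ) σ ∧
      ∀ y, Θ y = .var y → σ y = .var y := by
  by_cases ht : t = .var x
  · subst ht
    exact ⟨Subst.id, isPrincipal_of_forall (fun _ => rfl), fun _ _ => rfl⟩
  by_cases hx : Θ x = .var x
  · obtain ⟨y, rfl⟩ := Term.eq_var_of_subst_eq_var (h.symm.trans hx)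
    have hyx : x ≠ y := fun h => ht (by rw [h])
    refine ⟨_, (isPrincipal_eliminate (x := y) (t := .var x) ?_).congr fun τ => eq_comm,
      fun z hz => ?_⟩
    · simpa [Term.vars] using hyx.symm
    · rw [Function.update_of_ne]
      rintro rfl
      simp only [Term.subst, hx, hz, Term.var.injEq] at h
      exact hyx h
  · refine ⟨_, isPrincipal_eliminate (x := x) (t := t) (fun hmem => ?_), fun z hz => ?_⟩
    · have := (Term.size_subst_le (σ := Θ) hmem).2 ht
      rw [h] at this
      exact lt_irrefl _ this
    · rw [Function.update_of_ne]
      rintro rfl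
      exact hx hz

/-- Unification of the arguments of a function symbol, one argument at a time. Each argument is
treated after instantiation by the solution `σ` of the previous ones, and `σΘ = Θ` keeps the given
unifier available. -/
theorem exists_isPrincipal_of_sequence {Θ : Subst F} {n : ℕ} (E : Fin n → Subst F → Prop)
    (hcomp : ∀ i σ τ, E i σ → E i (σ.comp τ)) (hΘ : ∀ i, E i Θ)
    (h : ∀ i (σ : Subst F), σ.comp Θ = Θ → ∃ τ, IsPrincipal (fun υ => E i (σ.comp υ)) τ ∧
      ∀ y, Θ y = .var y → τ y = .var y) :
    ∃ σ, IsPrincipal (fun τ => ∀ i, E i τ) σ ∧ ∀ y, Θ y = .var y → σ y = .var y := by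
  induction n with
  | zero => exact ⟨Subst.id, isPrincipal_of_forall (fun _ i => i.elim0), fun _ _ => rfl⟩
  | succ n ih =>
    obtain ⟨σ, hσ, hfix⟩ := ih (fun i => E i.castSucc) (fun i => hcomp _) (fun i => hΘ _)
      (fun i => h _)
    have hσΘ : σ.comp Θ = Θ := hσ.2 Θ (fun i => hΘ _)
    obtain ⟨τ, hτ, hfix'⟩ := h (Fin.last n) σ hσΘ
    refine ⟨σ.comp τ, (hσ.join (fun σ τ hσ i => hcomp _ _ _ (hσ i)) hτ).congr fun υ => ?_, ?_⟩
    · rw [Fin.forall_fin_succ']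
    · intro y hy
      simp [Subst.comp, hfix y hy, Term.subst, hfix' y hy]

/-- Unifiable terms have an idempotent most general unifier that fixes every variable that is fixed by
a given unifier. -/
theorem exists_isPrincipal_unifier (Θ : Subst F) (u : Term F) :
    ∀ s t : Term F, s.subst Θ = u → t.subst Θ = u →
      ∃ σ, IsPrincipal (fun τ : Subst F => s.subst τ = t.subst τ) σ ∧
        ∀ y, Θ y = .var y → σ y = .var y := by
  have hvar : ∀ (x : ℕ) (u t : Term F), (Term.var x).subst Θ = u → t.subst Θ = u →
      (∃ σ, IsPrincipal (fun τ : Subst F => (Term.var x).subst τ = t.subst τ) σ ∧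
        ∀ y, Θ y = .var y → σ y = .var y) :=
    fun x u t h1 h2 => exists_isPrincipal_var (h1.trans h2.symm)
  have hvar' : ∀ (x : ℕ) (u t : Term F), (Term.var x).subst Θ = u → t.subst Θ = u →
      (∃ σ, IsPrincipal (fun τ : Subst F => t.subst τ = (Term.var x).subst τ) σ ∧
        ∀ y, Θ y = .var y → σ y = .var y) := by
    intro x u t h1 h2
    obtain ⟨σ, hσ, hfix⟩ := hvar x u t h1 h2
    exact ⟨σ, hσ.congr fun τ => eq_comm, hfix⟩
  -- The induction is on the common instance `u` and not on `s` and `t`: the unifier found for the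
  -- first components is applied to the remaining ones, which may make these larger, but their
  -- instance under `Θ` stays a proper subterm of `u`.
  induction u with
  | var x =>
    intro s t hs ht
    obtain ⟨y, rfl⟩ := Term.eq_var_of_subst_eq_var hs
    exact hvar _ _ _ hs ht
  | int z =>
    intro s t hs ht
    cases s with
    | var x => exact hvar _ _ _ hs ht
    | int z =>
      cases t with
      | var x => exact hvar' _ _ _ ht hs
      | _ => simp_all [Term.subst] <;>
        exact ⟨Subst.id, isPrincipal_of_forall (fun _ => trivial), fun _ _ => rfl⟩
    | _ => simp [Term.subst] at hs
  | nil =>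
    intro s t hs ht
    cases s with
    | var x => exact hvar _ _ _ hs ht
    | nil =>
      cases t with
      | var x => exact hvar' _ _ _ ht hs
      | nil => exact ⟨Subst.id, isPrincipal_of_forall (fun _ => rfl), fun _ _ => rfl⟩
      | _ => simp [Term.subst] at ht
    | _ => simp [Term.subst] at hs
  | cons a b iha ihb =>
    intro s t hs ht
    cases s with
    | var x => exact hvar _ _ _ hs ht
    | cons s1 s2 =>
      cases t with
      | var x => exact hvar' _ _ _ ht hs
      | cons t1 t2 =>
        simp only [Term.subst, Term.cons.injEq] at hs ht
        obtain ⟨σ, hσ, hfix⟩ := iha s1 t1 hs.1 ht.1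
        have hσΘ : σ.comp Θ = Θ := hσ.2 Θ (hs.1.trans ht.1.symm)
        obtain ⟨τ, hτ, hfix'⟩ := ihb (s2.subst σ) (t2.subst σ)
          (by rw [← Term.subst_comp, hσΘ, hs.2]) (by rw [← Term.subst_comp, hσΘ, ht.2])
        refine ⟨σ.comp τ, (hσ.join (E' := fun υ => s2.subst υ = t2.subst υ)
          (fun σ τ hσ => by rw [Term.subst_comp, Term.subst_comp, hσ])
          (hτ.congr fun υ => by rw [Term.subst_comp, Term.subst_comp])).congr
            fun υ => by simp [Term.subst], ?_⟩
        intro y hy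
        simp [Subst.comp, hfix y hy, Term.subst, hfix' y hy]
      | _ => simp [Term.subst] at ht
    | _ => simp [Term.subst] at hs
  | @fn f n us ih =>
    intro s t hs ht
    cases s with
    | var x => exact hvar _ _ _ hs ht
    | @fn f1 n1 ss =>
      cases t with
      | var x => exact hvar' _ _ _ ht hs
      | @fn f2 n2 ts =>
        simp only [Term.subst, Term.fn.injEq] at hs ht
        obtain ⟨rfl, rfl, hs⟩ := hs
        obtain ⟨rfl, rfl, ht⟩ := ht
        simp only [heq_eq_eq, funext_iff] at hs ht
        obtain ⟨σ, hσ, hfix⟩ := exists_isPrincipal_of_sequence (Θ := Θ)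
          (fun i υ => (ss i).subst υ = (ts i).subst υ)
          (fun i σ τ hσ => by rw [Term.subst_comp, Term.subst_comp, hσ])
          (fun i => (hs i).trans (ht i).symm) (fun i σ hσΘ => by
            obtain ⟨τ, hτ, hfix⟩ := ih i ((ss i).subst σ) ((ts i).subst σ)
              (by rw [← Term.subst_comp, hσΘ, hs]) (by rw [← Term.subst_comp, hσΘ, ht])
            exact ⟨τ, hτ.congr fun υ => by rw [Term.subst_comp, Term.subst_comp], hfix⟩)
        exact ⟨σ, hσ.congr fun υ => by simp [Term.subst, funext_iff], hfix⟩
      | _ => simp [Term.subst] at ht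
    | _ => simp [Term.subst] at hs

/-- Packing the arguments into a list term reduces this to the unification of two terms. The control
over the fixed variables is what `IsPrincipal.split` asks for. -/
theorem exists_isMGU {Θ : Subst F} {ss ts : List (Term F)}
    (h : substArgs Θ ss = substArgs Θ ts) :
    ∃ σ, IsMGU σ ss ts ∧ ∀ y, Θ y = .var y → σ y = .var y := by
  have h' : (Term.list ss).subst Θ = (Term.list ts).subst Θ := by simp [h]
  obtain ⟨σ, hσ, hfix⟩ := exists_isPrincipal_unifier Θ _ _ _ h' rfl
  exact ⟨σ, isMGU_iff.2 (hσ.congr fun τ => by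
    rw [Term.subst_list, Term.subst_list, Term.list_injective.eq_iff]), hfix⟩

/-! ### Elimination of solved variables -/

/-- Here `δ.comp τ = τ` expresses that `τ` satisfies the solved equations `z = δ z`, and `hE` says
that `E` does not see the solved variables. The other constraint can be solved by itself and `δ` put
in front. -/
theorem IsPrincipal.eliminate {E E' : Subst F → Prop} {δ σ : Subst F} (hσ : IsPrincipal E σ)
    (hδ : δ.comp δ = δ) (hE' : ∀ τ, E' τ ↔ δ.comp τ = τ ∧ E τ)
    (hE : ∀ τ, E (δ.comp τ) ↔ E τ) : IsPrincipal E' (δ.comp σ) := by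
  refine ⟨(hE' _).2 ⟨by rw [← Subst.comp_assoc, hδ], (hE _).2 hσ.1⟩, fun τ hτ => ?_⟩
  obtain ⟨h1, h2⟩ := (hE' τ).1 hτ
  rw [Subst.comp_assoc, hσ.2 τ h2, h1]

/-- The substitution that acts as `Θδ` on the variables fixed by `δ`. -/
noncomputable def Subst.reduce (δ Θ : Subst F) : Subst F :=
  open Classical in fun x => if δ x = .var x then (Θ x).subst δ else .var x

/-- Converse of `IsPrincipal.eliminate`. The values of `Θ` may contain solved variables when `Θ`
orients an equation between variables differently from `δ`; the additional application of `δ`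
removes them, at the price of changing `Θ`. -/
theorem IsPrincipal.reduce {E E' : Subst F → Prop} {δ Θ : Subst F} (hΘ : IsPrincipal E' Θ)
    (hδ : δ.comp δ = δ) (hE' : ∀ τ, E' τ ↔ δ.comp τ = τ ∧ E τ)
    (hE : ∀ τ, E (δ.comp τ) ↔ E τ) (hcomp : ∀ σ τ, E σ → E (σ.comp τ)) :
    IsPrincipal E (Subst.reduce δ Θ) := by
  have h0 := ((hE' _).1 hΘ.1).1
  have h1 : δ.comp (Subst.reduce δ Θ) = Θ.comp δ := by
    conv_rhs => rw [← h0, Subst.comp_assoc]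
    funext x
    refine Term.subst_congr fun y hy => ?_
    have := Subst.idempotent_iff.1 hδ x y hy
    simp [Subst.reduce, this, Subst.comp]
  refine ⟨(hE _).1 (by rw [h1]; exact hcomp _ _ ((hE' _).1 hΘ.1).2), fun τ hτ => ?_⟩
  have h2 := hΘ.2 (δ.comp τ) ((hE' _).2 ⟨by rw [← Subst.comp_assoc, hδ], (hE _).2 hτ⟩)
  funext x
  by_cases hx : δ x = .var x
  · have := congrFun h2 x
    simp only [Subst.comp, hx, Term.subst] at this
    simp only [Subst.comp, Subst.reduce, hx, if_true, ← this, ← Term.subst_comp]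
  · simp [Subst.comp, Subst.reduce, hx, Term.subst]

/-- If the solved variables are eliminated from a constraint, then after a renaming of some solved
variables by the variables for which they stand, the most general solution is unchanged. -/
theorem IsPrincipal.exists_rename {E E' : Subst F → Prop} {δ Θ : Subst F}
    (hΘ : IsPrincipal E' Θ) (hδ : δ.comp δ = δ) (hE' : ∀ τ, E' τ ↔ δ.comp τ = τ ∧ E τ)
    (hE : ∀ τ, E (δ.comp τ) ↔ E τ) (hcomp : ∀ σ τ, E σ → E (σ.comp τ)) :
    ∃ (π : Equiv.Perm ℕ) (σ : Subst F),
      IsPrincipal (fun τ => E ((renameBy π).comp τ)) σ ∧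
      (∀ x, π x ≠ x → ∃ e u, δ e = .var u ∧ δ e ≠ .var e ∧ (x = e ∨ x = u)) ∧
      ∀ x, δ x = .var x → σ (π x) = Θ x := by
  classical
  have hδΘ := ((hE' _).1 hΘ.1).1
  have hid := Subst.idempotent_iff.1 hΘ.idempotent
  -- The variables that `δ` eliminates but `Θ` keeps. For such an `e` the value `δ e` has to be a
  -- variable `u e`, and `Θ` binds `u e` to `e`: the equation is oriented the other way round.
  set P : ℕ → Prop := fun e => Θ e = .var e ∧ δ e ≠ .var e with hP
  have hu : ∀ e, P e → ∃ u, δ e = .var u ∧ u ≠ e ∧ Θ u = .var e := by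
    intro e he
    have h1 := congrFun hδΘ e
    rw [he.1] at h1
    obtain ⟨u, hu⟩ := Term.eq_var_of_subst_eq_var h1
    refine ⟨u, hu, ?_, ?_⟩
    · rintro rfl
      exact he.2 hu
    · simpa [Subst.comp, hu, Term.subst] using h1
  choose! u hu1 hu2 hu3 using hu
  have huinj : ∀ e e', P e → P e' → u e = u e' → e = e' := by
    intro e e' he he' h
    have h1 := hu3 e he
    rw [h, hu3 e' he'] at h1
    simpa using h1.symm
  have hnP : ∀ e, P e → ¬ P (u e) := by
    intro e he h
    have := h.1
    rw [hu3 e he] at this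
    exact hu2 e he (by simpa using this.symm)
  -- The involution that exchanges every such `e` with `u e`. The two families are disjoint, and `u`
  -- is injective on `P` because `Θ` recovers `e` from `u e`.
  set f : ℕ → ℕ := fun x =>
    if P x then u x else if h : ∃ e, P e ∧ u e = x then h.choose else x with hf
  have hf1 : ∀ e, P e → f e = u e := fun e he => by simp only [hf, he, if_true]
  have hf2 : ∀ e, P e → f (u e) = e := by
    intro e he
    have h : ∃ e', P e' ∧ u e' = u e := ⟨e, he, rfl⟩
    simp only [hf, hnP e he, if_false, h, dif_pos]
    exact huinj _ _ h.choose_spec.1 he h.choose_spec.2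
  have hf3 : ∀ x, ¬ P x → (¬ ∃ e, P e ∧ u e = x) → f x = x := by
    intro x h1 h2
    simp only [hf, h1, h2, if_false, dif_neg, not_false_eq_true]
  have hff : Function.Involutive f := by
    intro x
    by_cases h1 : P x
    · rw [hf1 x h1, hf2 x h1]
    by_cases h2 : ∃ e, P e ∧ u e = x
    · obtain ⟨e, he, rfl⟩ := h2
      rw [hf2 e he, hf1 e he]
    · rw [hf3 x h1 h2, hf3 x h1 h2]
  set π : Equiv.Perm ℕ := hff.toPerm with hπ
  have hπf : ∀ x, π x = f x := fun x => rfl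
  set r : Subst F := renameBy π with hr
  have hrr : r.comp r = Subst.id := by
    funext x
    simp [hr, Subst.comp, Term.subst, hπf, hff x, Subst.id]
  -- On the range of `Θ`, which consists of variables fixed by `Θ`, the substitution `δ` is no more
  -- than this renaming.
  have hΘδ : Θ.comp δ = Θ.comp r := by
    funext x
    refine Term.subst_congr fun w hw => ?_
    have hw := hid x w hw
    simp only [hr, renameBy_apply, hπf]
    by_cases h1 : δ w = .var w
    · rw [h1, hf3 w (fun h => h.2 h1)]
      rintro ⟨e, he, rfl⟩
      rw [hu3 e he] at hw
      exact hu2 e he (by simpa using hw.symm)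
    · rw [hf1 w ⟨hw, h1⟩, hu1 w ⟨hw, h1⟩]
  have hσ := hΘ.reduce hδ hE' hE hcomp
  -- Conjugation by the involution turns a principal solution of `E` into one of the renamed
  -- constraint, and the outer `r` undoes the `δ` that was applied to the values of `Θ`.
  refine ⟨π, r.comp ((Subst.reduce δ Θ).comp r), ⟨?_, fun τ hτ => ?_⟩, ?_, ?_⟩
  · show E (r.comp _)
    rw [← Subst.comp_assoc, hrr, Subst.id_comp]
    exact hcomp _ _ hσ.1
  · rw [Subst.comp_assoc, Subst.comp_assoc, hσ.2 _ hτ, ← Subst.comp_assoc, hrr, Subst.id_comp]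
  · intro x hx
    rw [hπf] at hx
    by_cases h1 : P x
    · exact ⟨x, u x, hu1 x h1, h1.2, Or.inl rfl⟩
    by_cases h2 : ∃ e, P e ∧ u e = x
    · obtain ⟨e, he, rfl⟩ := h2
      exact ⟨e, u e, hu1 e he, he.2, Or.inr rfl⟩
    · exact absurd (hf3 x h1 h2) hx
  · intro x hx
    have h1 : ((Θ x).subst δ).subst r = Θ x := by
      have := congrFun hΘδ x
      simp only [Subst.comp] at this
      rw [this, ← Term.subst_comp, hrr, Term.subst_id]
    simp only [Subst.comp, hr, renameBy_apply, Term.subst, hπf, hff x]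
    simpa [Subst.reduce, hx] using h1

/-- A map that is injective on a finite set of variables extends to a permutation. -/
theorem exists_perm_eqOn (s : Finset ℕ) (f : ℕ → ℕ) (hf : Set.InjOn f s) :
    ∃ ρ : Equiv.Perm ℕ, ∀ x ∈ s, ρ x = f x := by
  induction s using Finset.induction_on with
  | empty => exact ⟨1, by simp⟩
  | insert a s ha ih =>
    obtain ⟨ρ, hρ⟩ := ih (hf.mono (by simp))
    refine ⟨ρ.trans (Equiv.swap (ρ a) (f a)), fun x hx => ?_⟩
    by_cases hxa : x = a
    · subst hxa; simp
    · have hxs : x ∈ s := (Finset.mem_insert.1 hx).resolve_left hxa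
      have h1 : ρ x ≠ ρ a := fun h => hxa (ρ.injective h)
      have h2 : f x ≠ f a := fun h => hxa (hf (by simp [hxs]) (by simp) h)
      rw [← hρ x hxs] at h2
      rw [Equiv.trans_apply, Equiv.swap_apply_of_ne_of_ne h1 h2, hρ x hxs]

end Terms

/-! ### Goals -/

section Goals

variable {F P K : Type*}

theorem Goal.subst_comp (σ τ : Subst F) (G : Goal F P K) :
    G.subst (σ.comp τ) = (G.subst σ).subst τ := by
  induction G <;> simp_all [Goal.subst, substArgs_comp]

@[simp] theorem Goal.subst_id (G : Goal F P K) : G.subst Subst.id = G := by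
  induction G <;> simp_all [Goal.subst]

theorem Goal.subst_append (σ : Subst F) (G G' : Goal F P K) :
    (G.append G').subst σ = (G.subst σ).append (G'.subst σ) := by
  induction G <;> simp_all [Goal.subst, Goal.append]

theorem Goal.mem_vars_subst {σ : Subst F} {G : Goal F P K} {y : ℕ} :
    y ∈ (G.subst σ).vars ↔ ∃ x ∈ G.vars, y ∈ (σ x).vars := by
  induction G with
  | nil => simp [Goal.subst, Goal.vars]
  | user p ts q ih | builtin p ts q ih =>
    simp only [Goal.subst, Goal.vars, Finset.mem_union, mem_varsArgs_substArgs, ih]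
    grind
  | imp p ts b g q ihb ihg ihq =>
    simp only [Goal.subst, Goal.vars, Finset.mem_union, mem_varsArgs_substArgs, ihb, ihg, ihq]
    grind

theorem TGoal.subst_comp (σ τ : Subst F) (G : TGoal F P K) :
    G.subst (σ.comp τ) = (G.subst σ).subst τ := by
  induction G <;> simp_all [TGoal.subst, substArgs_comp, Term.subst_comp]

@[simp] theorem TGoal.subst_id (G : TGoal F P K) : G.subst Subst.id = G := by
  induction G <;> simp_all [TGoal.subst]

theorem TGoal.subst_append (σ : Subst F) (G G' : TGoal F P K) :
    (G.append G').subst σ = (G.subst σ).append (G'.subst σ) := by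
  induction G <;> simp_all [TGoal.subst, TGoal.append]

@[simp] theorem TGoal.append_nil (G : TGoal F P K) : G.append .nil = G := by
  induction G <;> simp_all [TGoal.append]

theorem TGoal.append_assoc (G G' G'' : TGoal F P K) :
    (G.append G').append G'' = G.append (G'.append G'') := by
  induction G <;> simp_all [TGoal.append]

theorem TGoal.mem_vars_subst {σ : Subst F} {G : TGoal F P K} {y : ℕ} :
    y ∈ (G.subst σ).vars ↔ ∃ x ∈ G.vars, y ∈ (σ x).vars := by
  induction G <;> simp only [TGoal.subst, TGoal.vars, Finset.mem_union, mem_varsArgs_substArgs,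
    Term.mem_vars_subst, Finset.notMem_empty, false_and, exists_false, *] <;> grind

theorem TClause.mem_vars_subst {σ : Subst F} {C : TClause F P K} {y : ℕ} :
    y ∈ (C.subst σ).vars ↔ ∃ x ∈ C.vars, y ∈ (σ x).vars := by
  cases C <;> simp only [TClause.subst, TClause.vars, Finset.mem_union, mem_varsArgs_substArgs,
    Term.mem_vars_subst, TGoal.mem_vars_subst] <;> grind

theorem TClause.mem_vars_renameBy {ρ : Equiv.Perm ℕ} {C : TClause F P K} {y : ℕ} :
    y ∈ (C.subst (renameBy ρ)).vars ↔ ∃ x ∈ C.vars, ρ x = y := by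
  simp [TClause.mem_vars_subst, Term.vars, eq_comm]

theorem Rule.mem_vars_renameBy {ρ : Equiv.Perm ℕ} {R : Rule F P K} {y : ℕ} :
    y ∈ (R.subst (renameBy ρ)).vars ↔ ∃ x ∈ R.vars, ρ x = y := by
  simp only [Rule.subst, Rule.vars, Finset.mem_union, mem_varsArgs_substArgs,
    Goal.mem_vars_subst, renameBy_apply, Term.vars, Finset.mem_singleton]
  grind

end Goals

/-! ### Hypotheses of embedded implications -/

/-- A hypothesis `pred(args) ← body` of an embedded implication with the data of its translation: the
variables `outer` of the rest of the enclosing rule, the first new variable, the context identifier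
of the implication and the rule identifier. -/
structure HypEntry (F P K : Type*) where
  pred : P
  args : List (Term F)
  body : Goal F P K
  outer : Finset ℕ
  next : ℕ
  ctx : Term F
  id : ℕ

section Entries

variable {F P K : Type*}

namespace HypEntry

/-- The variables of the hypothesis. -/
def vars (e : HypEntry F P K) : Finset ℕ := varsArgs e.args ∪ e.body.vars

/-- The variables that the hypothesis shares with the rest of the rule. -/
def shared (e : HypEntry F P K) : Finset ℕ := e.vars ∩ e.outer

/-- The translation of the body of the hypothesis. -/
def tbody (e : HypEntry F P K) : TGoal F P K :=
  (e.body.translate (.var (e.next + 1)) (e.outer ∪ varsArgs e.args) (e.next + 3) (e.id + 1)).goal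

/-- The body of the translated hypothesis. -/
def guarded (e : HypEntry F P K) : TGoal F P K :=
  .reg (.int e.id) (varList e.shared) (.var (e.next + 2))
    (.chk (.var (e.next + 2)) (.var (e.next + 1)) e.tbody)

/-- The translated hypothesis. -/
def clause (e : HypEntry F P K) : TClause F P K :=
  .rule e.pred
    (e.args ++ [varList e.shared, .int e.id, .cons (.var e.next) e.ctx, .var (e.next + 1)])
    e.guarded

end HypEntry

/-- The hypotheses of the embedded implications of a goal, in the order of their translations. -/
def Goal.entries : Goal F P K → (S : Term F) → (outer : Finset ℕ) → (v i : ℕ) →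
    List (HypEntry F P K)
  | .nil, _, _, _, _ => []
  | .user _ ts q, S, outer, v, i => q.entries S (outer ∪ varsArgs ts) (v + 3) i
  | .builtin _ ts q, S, outer, v, i => q.entries S (outer ∪ varsArgs ts) v i
  | .imp p ts b g q, S, outer, v, i =>
      let rb : Translated F P K :=
        b.translate (.var (v + 1)) (outer ∪ g.vars ∪ q.vars ∪ varsArgs ts) (v + 3) (i + 1)
      let rg : Translated F P K := g.translate (.cons (.var v) S)
        (outer ∪ varsArgs ts ∪ b.vars ∪ q.vars) rb.nextVar rb.nextId
      ⟨p, ts, b, outer ∪ g.vars ∪ q.vars, v, S, i⟩ ::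
        (b.entries (.var (v + 1)) (outer ∪ g.vars ∪ q.vars ∪ varsArgs ts) (v + 3) (i + 1) ++
          g.entries (.cons (.var v) S) (outer ∪ varsArgs ts ∪ b.vars ∪ q.vars) rb.nextVar rb.nextId ++
          q.entries S (outer ∪ varsArgs ts ∪ b.vars ∪ g.vars) rg.nextVar rg.nextId)

/-- The hypothesis entries of the body of a hypothesis. -/
def HypEntry.entries (e : HypEntry F P K) : List (HypEntry F P K) :=
  e.body.entries (.var (e.next + 1)) (e.outer ∪ varsArgs e.args) (e.next + 3) (e.id + 1)

/-- The variables that are local to a hypothesis of an embedded implication of a goal. -/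
def Goal.locals : Goal F P K → (outer : Finset ℕ) → Finset ℕ
  | .nil, _ => ∅
  | .user _ ts q, outer => q.locals (outer ∪ varsArgs ts)
  | .builtin _ ts q, outer => q.locals (outer ∪ varsArgs ts)
  | .imp _ ts b g q, outer =>
      -- There is no recursive call for `b`: a variable local to a hypothesis nested in `b` occurs
      -- nowhere outside `b`, so this difference already contains it.
      ((varsArgs ts ∪ b.vars) \ (outer ∪ g.vars ∪ q.vars)) ∪
        g.locals (outer ∪ varsArgs ts ∪ b.vars ∪ q.vars) ∪
        q.locals (outer ∪ varsArgs ts ∪ b.vars ∪ g.vars)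

theorem Goal.locals_subset {G : Goal F P K} : ∀ {outer : Finset ℕ} {x : ℕ},
    x ∈ G.locals outer → x ∈ G.vars ∧ x ∉ outer := by
  induction G with
  | nil => simp [Goal.locals]
  | user p ts q ih | builtin p ts q ih =>
    intro outer x hx
    have := ih hx
    simp only [Goal.vars, Finset.mem_union] at this ⊢
    tauto
  | imp p ts b g q ihb ihg ihq =>
    intro outer x hx
    simp only [Goal.locals, Finset.mem_union, Finset.mem_sdiff] at hx
    simp only [Goal.vars, Finset.mem_union]
    rcases hx with (hx | hx) | hx
    · tauto
    · have := ihg hx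
      simp only [Finset.mem_union] at this
      tauto
    · have := ihq hx
      simp only [Finset.mem_union] at this
      tauto

theorem union_outer_comm (A X Y Z : Finset ℕ) : A ∪ X ∪ Y ∪ Z = A ∪ Y ∪ Z ∪ X := by
  ext x; simp only [Finset.mem_union]; tauto

/-- The translation of an embedded implication. -/
theorem Goal.translate_imp (p : P) (ts : List (Term F)) (b g q : Goal F P K) (S : Term F)
    (outer : Finset ℕ) (v i : ℕ) :
    let e : HypEntry F P K := ⟨p, ts, b, outer ∪ g.vars ∪ q.vars, v, S, i⟩
    let rb : Translated F P K := b.translate (.var (v + 1)) (e.outer ∪ varsArgs ts) (v + 3) (i + 1)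
    let rg : Translated F P K := g.translate (.cons (.var v) S)
      (outer ∪ varsArgs ts ∪ b.vars ∪ q.vars) rb.nextVar rb.nextId
    let rq : Translated F P K :=
      q.translate S (outer ∪ varsArgs ts ∪ b.vars ∪ g.vars) rg.nextVar rg.nextId
    (Goal.imp p ts b g q).translate S outer v i =
      ⟨.imp (.int i) (varList e.shared) rg.goal (.var v) S rq.goal,
        e.clause :: (rb.hyps ++ rg.hyps ++ rq.hyps), rq.nextVar, rq.nextId⟩ := by
  simp only [Goal.translate, HypEntry.clause, HypEntry.guarded, HypEntry.tbody, HypEntry.shared,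
    HypEntry.vars, union_outer_comm outer (varsArgs ts)]

theorem Goal.translate_hyps (G : Goal F P K) : ∀ (S : Term F) (outer : Finset ℕ) (v i : ℕ),
    (G.translate S outer v i).hyps = (G.entries S outer v i).map HypEntry.clause := by
  induction G with
  | nil => intros; rfl
  | user p ts q ih | builtin p ts q ih => intros; exact ih ..
  | imp p ts b g q ihb ihg ihq =>
    intros
    rw [Goal.translate_imp]
    simp [Goal.entries, ihb, ihg, ihq]

theorem Goal.translate_le (G : Goal F P K) : ∀ (S : Term F) (outer : Finset ℕ) (v i : ℕ),
    v ≤ (G.translate S outer v i).nextVar ∧ i ≤ (G.translate S outer v i).nextId := by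
  induction G with
  | nil => intros; exact ⟨le_rfl, le_rfl⟩
  | user p ts q ih =>
    intro S outer v i
    have := ih S (outer ∪ varsArgs ts) (v + 3) i
    simp only [Goal.translate]
    omega
  | builtin p ts q ih => intros; exact ih ..
  | imp p ts b g q ihb ihg ihq =>
    intro S outer v i
    rw [Goal.translate_imp]
    have h1 := ihb (.var (v + 1)) (outer ∪ g.vars ∪ q.vars ∪ varsArgs ts) (v + 3) (i + 1)
    generalize b.translate (.var (v + 1)) (outer ∪ g.vars ∪ q.vars ∪ varsArgs ts) (v + 3) (i + 1)
      = rb at h1 ⊢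
    have h2 := ihg (.cons (.var v) S) (outer ∪ varsArgs ts ∪ b.vars ∪ q.vars) rb.nextVar rb.nextId
    simp only
    generalize g.translate (.cons (.var v) S) (outer ∪ varsArgs ts ∪ b.vars ∪ q.vars) rb.nextVar
      rb.nextId = rg at h2 ⊢
    have h3 := ihq S (outer ∪ varsArgs ts ∪ b.vars ∪ g.vars) rg.nextVar rg.nextId
    omega

/-- The counter hands out consecutive disjoint ranges to the hypothesis itself, `b`, `g` and `q`.
Distinct identifiers ensure later that a registration can only be matched by the clause of the
hypothesis for which it was made. -/
theorem Goal.entries_id (G : Goal F P K) : ∀ (S : Term F) (outer : Finset ℕ) (v i : ℕ),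
    (∀ e ∈ G.entries S outer v i, i ≤ e.id ∧ e.id < (G.translate S outer v i).nextId) ∧
    ((G.entries S outer v i).map HypEntry.id).Nodup := by
  induction G with
  | nil => intros; simp [Goal.entries]
  | user p ts q ih | builtin p ts q ih => intros; exact ih ..
  | imp p ts b g q ihb ihg ihq =>
    intro S outer v i
    rw [Goal.translate_imp]
    simp only [Goal.entries]
    have h1 := ihb (.var (v + 1)) (outer ∪ g.vars ∪ q.vars ∪ varsArgs ts) (v + 3) (i + 1)
    have l1 := b.translate_le (.var (v + 1)) (outer ∪ g.vars ∪ q.vars ∪ varsArgs ts) (v + 3) (i + 1)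
    generalize b.translate (.var (v + 1)) (outer ∪ g.vars ∪ q.vars ∪ varsArgs ts) (v + 3) (i + 1)
      = rb at h1 l1 ⊢
    have h2 := ihg (.cons (.var v) S) (outer ∪ varsArgs ts ∪ b.vars ∪ q.vars) rb.nextVar rb.nextId
    have l2 := g.translate_le (.cons (.var v) S) (outer ∪ varsArgs ts ∪ b.vars ∪ q.vars)
      rb.nextVar rb.nextId
    generalize g.translate (.cons (.var v) S) (outer ∪ varsArgs ts ∪ b.vars ∪ q.vars) rb.nextVar
      rb.nextId = rg at h2 l2 ⊢
    have h3 := ihq S (outer ∪ varsArgs ts ∪ b.vars ∪ g.vars) rg.nextVar rg.nextId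
    have l3 := q.translate_le S (outer ∪ varsArgs ts ∪ b.vars ∪ g.vars) rg.nextVar rg.nextId
    generalize q.translate S (outer ∪ varsArgs ts ∪ b.vars ∪ g.vars) rg.nextVar rg.nextId = rq
      at h3 l3 ⊢
    constructor
    · intro e he
      simp only [List.mem_cons, List.mem_append] at he
      rcases he with rfl | (he | he) | he
      · exact ⟨le_rfl, by simp only; omega⟩
      · have := h1.1 e he; omega
      · have := h2.1 e he; omega
      · have := h3.1 e he; omega
    · simp only [List.map_cons, List.map_append, List.nodup_cons, List.nodup_append, List.mem_append,
        List.mem_map, not_or, not_exists, not_and]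
      refine ⟨⟨⟨fun e he h => ?_, fun e he h => ?_⟩, fun e he h => ?_⟩,
        ⟨h1.2, h2.2, ?_⟩, h3.2, ?_⟩
      · have := h1.1 e he; omega
      · have := h2.1 e he; omega
      · have := h3.1 e he; omega
      · rintro _ ⟨e, he, rfl⟩ _ ⟨e', he', rfl⟩
        have := h1.1 e he
        have := h2.1 e' he'
        omega
      · rintro _ (⟨e, he, rfl⟩ | ⟨e, he, rfl⟩) _ ⟨e', he', rfl⟩
        · have := h1.1 e he
          have := h3.1 e' he'
          omega
        · have := h2.1 e he
          have := h3.1 e' he'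
          omega

/-- The table of hypotheses contains the hypotheses in the body of `e`, and the variables that are
introduced in the translation of `e` are new. -/
structure HypEntry.WellFormed (T : Set (HypEntry F P K)) (e : HypEntry F P K) : Prop where
  vars_lt : ∀ x ∈ e.vars, x < e.next
  outer_lt : ∀ x ∈ e.outer, x < e.next
  entries_mem : ∀ e' ∈ e.entries, e' ∈ T

theorem Goal.entries_wellFormed (G : Goal F P K) : ∀ (S : Term F) (outer : Finset ℕ) (v i : ℕ),
    (∀ x ∈ G.vars, x < v) → (∀ x ∈ outer, x < v) →
    ∀ e ∈ G.entries S outer v i, e.WellFormed {e | e ∈ G.entries S outer v i} := by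
  have mono : ∀ {T T' : Set (HypEntry F P K)} {e}, HypEntry.WellFormed T e → T ⊆ T' →
      HypEntry.WellFormed T' e := fun h hT => ⟨h.1, h.2, fun e' he' => hT (h.3 e' he')⟩
  induction G with
  | nil => simp [Goal.entries]
  | user p ts q ih =>
    intro S outer v i h1 h2
    simp only [Goal.vars, Finset.mem_union] at h1
    exact ih S _ _ _ (fun x hx => by have := h1 x (Or.inr hx); omega) (fun x hx => by
      rcases Finset.mem_union.1 hx with hx | hx
      · have := h2 x hx; omega
      · have := h1 x (Or.inl hx); omega)
  | builtin p ts q ih =>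
    intro S outer v i h1 h2
    simp only [Goal.vars, Finset.mem_union] at h1
    exact ih S _ _ _ (fun x hx => h1 x (Or.inr hx)) (fun x hx => by
      rcases Finset.mem_union.1 hx with hx | hx
      · exact h2 x hx
      · exact h1 x (Or.inl hx))
  | imp p ts b g q ihb ihg ihq =>
    intro S outer v i h1 h2 e he
    simp only [Goal.vars, Finset.mem_union] at h1
    have l1 := b.translate_le (.var (v + 1)) (outer ∪ g.vars ∪ q.vars ∪ varsArgs ts) (v + 3) (i + 1)
    simp only [Goal.entries] at he ⊢
    generalize b.translate (.var (v + 1)) (outer ∪ g.vars ∪ q.vars ∪ varsArgs ts) (v + 3) (i + 1)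
      = rb at he l1 ⊢
    have l2 := g.translate_le (.cons (.var v) S) (outer ∪ varsArgs ts ∪ b.vars ∪ q.vars)
      rb.nextVar rb.nextId
    generalize g.translate (.cons (.var v) S) (outer ∪ varsArgs ts ∪ b.vars ∪ q.vars) rb.nextVar
      rb.nextId = rg at he l2 ⊢
    simp only [List.mem_cons, List.mem_append] at he
    rcases he with rfl | (he | he) | he
    · refine ⟨fun x hx => h1 x ?_, fun x hx => ?_, fun e' he' => ?_⟩
      · simp only [HypEntry.vars, Finset.mem_union] at hx
        tauto
      · simp only [Finset.mem_union] at hx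
        rcases hx with (hx | hx) | hx
        · exact h2 x hx
        · exact h1 x (by tauto)
        · exact h1 x (by tauto)
      · simp only [HypEntry.entries] at he'
        simp only [Set.mem_ofPred_eq, List.mem_cons, List.mem_append, he', true_or, or_true]
    · refine mono (ihb _ _ _ _ (fun x hx => ?_) (fun x hx => ?_) e he) fun e' he' => ?_
      · have := h1 x (by tauto); omega
      · simp only [Finset.mem_union] at hx
        rcases hx with ((hx | hx) | hx) | hx
        · have := h2 x hx; omega
        all_goals have := h1 x (by tauto); omega
      · have he' : e' ∈ b.entries _ _ _ _ := he'
        simp only [Set.mem_ofPred_eq, List.mem_cons, List.mem_append, he', true_or, or_true]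
    · refine mono (ihg _ _ _ _ (fun x hx => ?_) (fun x hx => ?_) e he) fun e' he' => ?_
      · have := h1 x (by tauto); omega
      · simp only [Finset.mem_union] at hx
        rcases hx with ((hx | hx) | hx) | hx
        · have := h2 x hx; omega
        all_goals have := h1 x (by tauto); omega
      · have he' : e' ∈ g.entries _ _ _ _ := he'
        simp only [Set.mem_ofPred_eq, List.mem_cons, List.mem_append, he', true_or, or_true]
    · refine mono (ihq _ _ _ _ (fun x hx => ?_) (fun x hx => ?_) e he) fun e' he' => ?_
      · have := h1 x (by tauto); omega
      · simp only [Finset.mem_union] at hx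
        rcases hx with ((hx | hx) | hx) | hx
        · have := h2 x hx; omega
        all_goals have := h1 x (by tauto); omega
      · have he' : e' ∈ q.entries _ _ _ _ := he'
        simp only [Set.mem_ofPred_eq, List.mem_cons, List.mem_append, he', or_true]

/-- A translated implication mentions its hypothesis only through the list of shared variables, so
the local variables drop out of the translated goal. They are therefore private to the source. -/
theorem Goal.translate_vars (G : Goal F P K) : ∀ (S : Term F) (outer : Finset ℕ) (v i x : ℕ),
    x ∈ (G.translate S outer v i).goal.vars →
      x ∈ S.vars ∨ v ≤ x ∨ (x ∈ G.vars ∧ x ∉ G.locals outer) := by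
  induction G with
  | nil => simp [Goal.translate, TGoal.vars]
  | user p ts q ih =>
    intro S outer v i x hx
    simp only [Goal.translate, TGoal.vars, Finset.mem_union] at hx
    have hloc : x ∈ q.locals (outer ∪ varsArgs ts) → x ∉ varsArgs ts := fun h h' =>
      (Goal.locals_subset h).2 (Finset.mem_union_right _ h')
    simp only [Goal.vars, Finset.mem_union, Goal.locals]
    rcases hx with hx | hx
    · obtain ⟨t, ht, hxt⟩ := mem_varsArgs.1 hx
      simp only [List.mem_append, List.mem_cons, List.not_mem_nil, or_false] at ht
      rcases ht with ht | rfl | rfl | rfl | rfl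
      · have : x ∈ varsArgs ts := mem_varsArgs.2 ⟨t, ht, hxt⟩
        tauto
      · simp [Term.vars] at hxt; omega
      · simp [Term.vars] at hxt; omega
      · simp [Term.vars] at hxt; omega
      · exact Or.inl hxt
    · rcases ih _ _ _ _ _ hx with h | h | h
      · exact Or.inl h
      · exact Or.inr (Or.inl (by omega))
      · exact Or.inr (Or.inr ⟨Or.inr h.1, h.2⟩)
  | builtin p ts q ih =>
    intro S outer v i x hx
    simp only [Goal.translate, TGoal.vars, Finset.mem_union] at hx
    have hloc : x ∈ q.locals (outer ∪ varsArgs ts) → x ∉ varsArgs ts := fun h h' =>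
      (Goal.locals_subset h).2 (Finset.mem_union_right _ h')
    simp only [Goal.vars, Finset.mem_union, Goal.locals]
    rcases hx with hx | hx
    · tauto
    · rcases ih _ _ _ _ _ hx with h | h | h
      · exact Or.inl h
      · exact Or.inr (Or.inl h)
      · exact Or.inr (Or.inr ⟨Or.inr h.1, h.2⟩)
  | imp p ts b g q ihb ihg ihq =>
    intro S outer v i x hx
    rw [Goal.translate_imp] at hx
    have l1 := b.translate_le (.var (v + 1)) (outer ∪ g.vars ∪ q.vars ∪ varsArgs ts) (v + 3) (i + 1)
    simp only at hx
    generalize b.translate (.var (v + 1)) (outer ∪ g.vars ∪ q.vars ∪ varsArgs ts) (v + 3) (i + 1)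
      = rb at hx l1
    have l2 := g.translate_le (.cons (.var v) S) (outer ∪ varsArgs ts ∪ b.vars ∪ q.vars)
      rb.nextVar rb.nextId
    have h2 := ihg (.cons (.var v) S) (outer ∪ varsArgs ts ∪ b.vars ∪ q.vars) rb.nextVar rb.nextId x
    generalize g.translate (.cons (.var v) S) (outer ∪ varsArgs ts ∪ b.vars ∪ q.vars) rb.nextVar
      rb.nextId = rg at hx h2 l2
    have h3 := ihq S (outer ∪ varsArgs ts ∪ b.vars ∪ g.vars) rg.nextVar rg.nextId x
    generalize q.translate S (outer ∪ varsArgs ts ∪ b.vars ∪ g.vars) rg.nextVar rg.nextId = rq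
      at hx h3
    have hg : x ∈ g.locals (outer ∪ varsArgs ts ∪ b.vars ∪ q.vars) →
        x ∈ g.vars ∧ x ∉ outer ∧ x ∉ varsArgs ts ∧ x ∉ b.vars ∧ x ∉ q.vars := fun h => by
      simpa only [Finset.mem_union, not_or, and_assoc] using Goal.locals_subset h
    have hq : x ∈ q.locals (outer ∪ varsArgs ts ∪ b.vars ∪ g.vars) →
        x ∈ q.vars ∧ x ∉ outer ∧ x ∉ varsArgs ts ∧ x ∉ b.vars ∧ x ∉ g.vars := fun h => by
      simpa only [Finset.mem_union, not_or, and_assoc] using Goal.locals_subset h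
    simp only [TGoal.vars, Finset.mem_union, mem_varList_vars, HypEntry.shared, HypEntry.vars,
      Finset.mem_inter, Term.vars, Finset.notMem_empty, false_or, Finset.mem_singleton] at hx h2 h3
    simp only [Goal.vars, Finset.mem_union, Goal.locals, Finset.mem_sdiff]
    rcases hx with (((hx | hx) | hx) | hx) | hx
    · refine Or.inr (Or.inr ⟨Or.inl (Or.inl hx.1), ?_⟩)
      rintro ((h | h) | h)
      · exact h.2 hx.2
      · exact hx.1.elim (hg h).2.2.1 (hg h).2.2.2.1
      · exact hx.1.elim (hq h).2.2.1 (hq h).2.2.2.1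
    · rcases h2 hx with (h | h) | h | h
      · omega
      · exact Or.inl h
      · omega
      · refine Or.inr (Or.inr ⟨Or.inl (Or.inr h.1), ?_⟩)
        rintro ((h' | h') | h')
        · exact h'.2 (Or.inl (Or.inr h.1))
        · exact h.2 h'
        · exact (hq h').2.2.2.2 h.1
    · omega
    · exact Or.inl hx
    · rcases h3 hx with h | h | h
      · exact Or.inl h
      · omega
      · refine Or.inr (Or.inr ⟨Or.inr h.1, ?_⟩)
        rintro ((h' | h') | h')
        · exact h'.2 (Or.inr h.1)
        · exact (hg h').2.2.2.2 h.1
        · exact h.2 h'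

end Entries

/-! ### Big-step hypothetical resolution -/

section BigStep

variable {F : Type u} {P : Type v} {K : Type w}

/-- `HBig B prog used G σ used'`: the goal `G` succeeds with the composition `σ` of the most general
unifiers. -/
inductive HBig (B : K → Set (List (Term F))) :
    Set (Rule F P K) → Finset ℕ → Goal F P K → Subst F → Finset ℕ → Prop where
  | nil {prog : Set (Rule F P K)} {used : Finset ℕ} : HBig B prog used .nil Subst.id used
  | rule {p : P} {ts : List (Term F)} {q : Goal F P K} {σ τ : Subst F}
      {prog : Set (Rule F P K)} {used used' : Finset ℕ} {R : Rule F P K} (ρ : Equiv.Perm ℕ)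
      (hR : R ∈ prog) (hfresh : Disjoint (R.subst (renameBy ρ)).vars used)
      (hp : R.pred = p) (hσ : IsMGU σ (R.subst (renameBy ρ)).args ts)
      (h : HBig B prog (used ∪ (R.subst (renameBy ρ)).vars)
        (((R.subst (renameBy ρ)).body.append q).subst σ) τ used') :
      HBig B prog used (.user p ts q) (σ.comp τ) used'
  | builtin {k : K} {ts us : List (Term F)} {q : Goal F P K} {σ τ : Subst F}
      {prog : Set (Rule F P K)} {used used' : Finset ℕ} (ρ : Equiv.Perm ℕ)
      (hB : us ∈ B k) (hfresh : Disjoint (varsArgs (substArgs (renameBy ρ) us)) used)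
      (hσ : IsMGU σ (substArgs (renameBy ρ) us) ts)
      (h : HBig B prog (used ∪ varsArgs (substArgs (renameBy ρ) us)) (q.subst σ) τ used') :
      HBig B prog used (.builtin k ts q) (σ.comp τ) used'
  | hyp {p : P} {ts : List (Term F)} {b g q : Goal F P K} {σ τ : Subst F}
      {prog : Set (Rule F P K)} {used used' used'' : Finset ℕ}
      (hg : HBig B (prog ∪ {⟨p, ts, b⟩}) used g σ used')
      (hq : HBig B prog used' (q.subst σ) τ used'') :
      HBig B prog used (.imp p ts b g q) (σ.comp τ) used''

theorem HBig.used_subset {B : K → Set (List (Term F))} {prog : Set (Rule F P K)}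
    {used used' : Finset ℕ} {G : Goal F P K} {σ : Subst F} (h : HBig B prog used G σ used') :
    used ⊆ used' := by
  induction h with
  | nil => exact subset_rfl
  | rule _ _ _ _ _ _ ih => exact Finset.subset_union_left.trans ih
  | builtin _ _ _ _ _ ih => exact Finset.subset_union_left.trans ih
  | hyp _ _ ih ih' => exact ih.trans ih'

/-- A step for an implication contains an entire derivation. The big-step relation replaces the
mutual induction by an ordinary one and keeps only the composition of the mgus. -/
theorem HSteps.toBig {B : K → Set (List (Term F))} {s t : HState F P K} (h : HSteps B s t)
    (ht : t.goal = .nil) :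
    ∃ σ, t.sub = s.sub.comp σ ∧ t.prog = s.prog ∧ HBig B s.prog s.used s.goal σ t.used := by
  -- The motive for single steps says that the step can be put in front of any big-step derivation
  -- from its result.
  refine HSteps.rec
    (motive_1 := fun s t _ => t.prog = s.prog ∧ ∃ σ, t.sub = s.sub.comp σ ∧
      ∀ τ used', HBig B t.prog t.used t.goal τ used' → HBig B s.prog s.used s.goal (σ.comp τ) used')
    (motive_2 := fun s t _ => t.goal = .nil →
      ∃ σ, t.sub = s.sub.comp σ ∧ t.prog = s.prog ∧ HBig B s.prog s.used s.goal σ t.used)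
    ?_ ?_ ?_ ?_ ?_ h ht
  · intro p ts q θ σ prog used R R' ρ hR hR' hfresh hp hσ
    subst hR'
    exact ⟨rfl, σ, rfl, fun τ used' h => .rule ρ hR hfresh hp hσ h⟩
  · intro k ts us us' q θ σ prog used ρ hB hus' hfresh hσ
    subst hus'
    exact ⟨rfl, σ, rfl, fun τ used' h => .builtin ρ hB hfresh hσ h⟩
  · intro p ts b g q θ σ prog prog' used used' hprog' _ ih
    subst hprog'
    obtain ⟨σ', hσ', -, hbig⟩ := ih rfl
    simp only [Subst.id_comp] at hσ'
    subst hσ'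
    exact ⟨rfl, σ, rfl, fun τ used'' h => .hyp hbig h⟩
  · intro s hs
    refine ⟨Subst.id, by simp, rfl, ?_⟩
    rw [hs]
    exact .nil
  · rintro s t u _ _ ⟨hprog, σ, hσ, ih⟩ ih' hu
    obtain ⟨τ, hτ, hprog', hbig⟩ := ih' hu
    exact ⟨σ.comp τ, by rw [hτ, hσ, Subst.comp_assoc], hprog'.trans hprog, ih _ _ hbig⟩

theorem HBig.toSteps {B : K → Set (List (Term F))} {prog : Set (Rule F P K)}
    {used used' : Finset ℕ} {G : Goal F P K} {σ : Subst F} (h : HBig B prog used G σ used') :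
    ∀ θ, HSteps B ⟨G, θ, prog, used⟩ ⟨.nil, θ.comp σ, prog, used'⟩ := by
  induction h with
  | nil => intro θ; rw [Subst.comp_id]; exact .refl _
  | rule ρ hR hfresh hp hσ _ ih =>
    intro θ
    rw [← Subst.comp_assoc]
    exact .head (.rule ρ hR rfl hfresh hp hσ) (ih _)
  | builtin ρ hB hfresh hσ _ ih =>
    intro θ
    rw [← Subst.comp_assoc]
    exact .head (.builtin ρ hB rfl hfresh hσ) (ih _)
  | hyp _ _ ih ih' =>
    intro θ
    rw [← Subst.comp_assoc]
    exact .head (.hyp rfl (ih Subst.id)) (ih' _)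

theorem hSucceeds_iff {B : K → Set (List (Term F))} {prog : Set (Rule F P K)}
    {used : Finset ℕ} {Q : Goal F P K} {σ : Subst F} :
    HSucceeds B prog used Q σ ↔ ∃ used', HBig B prog used Q σ used' := by
  constructor
  · rintro ⟨used', h⟩
    obtain ⟨σ', hσ', -, hbig⟩ := h.toBig rfl
    simp only [Subst.id_comp] at hσ'
    subst hσ'
    exact ⟨used', hbig⟩
  · rintro ⟨used', h⟩
    exact ⟨used', h.toSteps Subst.id⟩

end BigStep

/-! ### Corresponding goals -/

section Correspondence

variable {F : Type u} {P : Type v} {K : Type w}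

/-- `η` instantiates the shared variables of the hypothesis `e` with terms over `V`, and renames its
local variables by `κ` with variables in `N`. -/
structure HypEntry.IsInstance (e : HypEntry F P K) (η : Subst F) (κ : ℕ → ℕ) (V N : Set ℕ) :
    Prop where
  shared : ∀ x ∈ e.shared, ∀ y ∈ (η x).vars, y ∈ V
  rename : ∀ x ∈ e.vars, x ∉ e.outer → η x = .var (κ x) ∧ κ x ∈ N
  inj : Set.InjOn κ {x | x ∈ e.vars ∧ x ∉ e.outer}

/-- The local variables have images in `N`, which the support of `σ` avoids, so only the terms for
the shared variables are instantiated. -/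
theorem HypEntry.IsInstance.subst {e : HypEntry F P K} {η : Subst F} {κ : ℕ → ℕ} {V V' N : Set ℕ}
    (h : e.IsInstance η κ V N) {σ : Subst F} (hσ : SupportedOn σ V') (hV : V ⊆ V')
    (hN : Disjoint V' N) : e.IsInstance (η.comp σ) κ V' N := by
  refine ⟨fun x hx y hy => ?_, fun x hx hx' => ?_, h.inj⟩
  · obtain ⟨z, hz, hy⟩ := Term.mem_vars_subst.1 hy
    exact hσ.2 z (hV (h.shared x hx z hz)) y hy
  · obtain ⟨h1, h2⟩ := h.rename x hx hx'
    refine ⟨?_, h2⟩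
    rw [Subst.comp, h1]
    exact hσ.1 _ (fun hV' => Set.disjoint_left.1 hN hV' h2)

/-- The rule `pred(args) ← body` is an instance of the hypothesis with identifier `i` in the table
`T`, and the instance of the list of its shared variables is `X`. -/
def IsHypInstance (T : Set (HypEntry F P K)) (V N : Set ℕ) (R : Rule F P K) (i : ℕ)
    (X : Term F) : Prop :=
  ∃ e ∈ T, ∃ η κ, e.IsInstance η κ V N ∧ R = ⟨e.pred, substArgs η e.args, e.body.subst η⟩ ∧
    i = e.id ∧ X = (varList e.shared).subst η

/-- `Corresponds T V N S G G' J`: the goal `G'` has the structure of the translation of `G` for the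
context identifier `S`. The variables on which the two goals agree are in `V`. The new variables in
`G'` are in `J`; they and the local variables of the hypotheses in `G` are in `N`. -/
inductive Corresponds (T : Set (HypEntry F P K)) (V N : Set ℕ) :
    Term F → Goal F P K → TGoal F P K → Set ℕ → Prop where
  | nil {S : Term F} : Corresponds T V N S .nil .nil ∅
  | user {S : Term F} {p : P} {ts : List (Term F)} {q : Goal F P K} {q' : TGoal F P K}
      {l i c : ℕ} {J : Set ℕ} (hts : ∀ x ∈ varsArgs ts, x ∈ V)
      (hlN : l ∈ N) (hiN : i ∈ N) (hcN : c ∈ N) (hli : l ≠ i) (hlc : l ≠ c) (hic : i ≠ c)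
      (hlJ : l ∉ J) (hiJ : i ∉ J) (hcJ : c ∉ J) (hq : Corresponds T V N S q q' J) :
      Corresponds T V N S (.user p ts q) (.user p (ts ++ [.var l, .var i, .var c, S]) q')
        ({l, i, c} ∪ J)
  | builtin {S : Term F} {k : K} {ts : List (Term F)} {q : Goal F P K} {q' : TGoal F P K}
      {J : Set ℕ} (hts : ∀ x ∈ varsArgs ts, x ∈ V) (hq : Corresponds T V N S q q' J) :
      Corresponds T V N S (.builtin k ts q) (.builtin k ts q') J
  | imp {S : Term F} {p : P} {ts : List (Term F)} {b g q : Goal F P K} {g' q' : TGoal F P K}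
      {i v : ℕ} {X : Term F} {J J' : Set ℕ} (hH : IsHypInstance T V N ⟨p, ts, b⟩ i X)
      (hvN : v ∈ N) (hvJ : v ∉ J) (hvJ' : v ∉ J') (hJ : Disjoint J J')
      (hg : Corresponds T V N (.cons (.var v) S) g g' J) (hq : Corresponds T V N S q q' J') :
      Corresponds T V N S (.imp p ts b g q) (.imp (.int i) X g' (.var v) S q') ({v} ∪ J ∪ J')

variable {T : Set (HypEntry F P K)} {V N : Set ℕ}

theorem Corresponds.subset {S : Term F} {G : Goal F P K} {G' : TGoal F P K} {J : Set ℕ}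
    (h : Corresponds T V N S G G' J) : J ⊆ N := by
  induction h with
  | nil => simp
  | user _ hlN hiN hcN _ _ _ _ _ _ _ ih =>
    rintro x (hx | hx)
    · rcases hx with rfl | rfl | rfl <;> assumption
    · exact ih hx
  | builtin _ _ ih => exact ih
  | imp _ hvN _ _ _ _ _ ih ih' =>
    rintro x ((rfl | hx) | hx)
    · exact hvN
    · exact ih hx
    · exact ih' hx

theorem Corresponds.mono {N' : Set ℕ} (hN : N ⊆ N') {S : Term F} {G : Goal F P K}
    {G' : TGoal F P K} {J : Set ℕ}
    (h : Corresponds T V N S G G' J) : Corresponds T V N' S G G' J := by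
  induction h with
  | nil => exact .nil
  | user hts hlN hiN hcN hli hlc hic hlJ hiJ hcJ _ ih =>
    exact .user hts (hN hlN) (hN hiN) (hN hcN) hli hlc hic hlJ hiJ hcJ ih
  | builtin hts _ ih => exact .builtin hts ih
  | imp hH hvN hvJ hvJ' hJ _ _ ih ih' =>
    refine .imp ?_ (hN hvN) hvJ hvJ' hJ ih ih'
    obtain ⟨e, he, η, κ, hη, h⟩ := hH
    exact ⟨e, he, η, κ, ⟨hη.1, fun x hx hx' => (hη.2 x hx hx').imp_right fun h => hN h, hη.3⟩, h⟩

theorem Corresponds.append {S : Term F} {G₁ G₂ : Goal F P K} {G₁' G₂' : TGoal F P K}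
    {J₁ J₂ : Set ℕ} (h₁ : Corresponds T V N S G₁ G₁' J₁) (h₂ : Corresponds T V N S G₂ G₂' J₂)
    (hJ : Disjoint J₁ J₂) :
    Corresponds T V N S (G₁.append G₂) (G₁'.append G₂') (J₁ ∪ J₂) := by
  induction h₁ with
  | nil => simpa [Goal.append, TGoal.append] using h₂
  | @user S p ts q q' l i c J hts hlN hiN hcN hli hlc hic hlJ hiJ hcJ _ ih =>
    rw [Set.disjoint_union_left] at hJ
    have hJ1 : ∀ x ∈ ({l, i, c} : Set ℕ), x ∉ J₂ := fun x hx => Set.disjoint_left.1 hJ.1 hx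
    rw [Set.union_assoc]
    exact .user hts hlN hiN hcN hli hlc hic
      (by simp [hlJ, hJ1 l]) (by simp [hiJ, hJ1 i]) (by simp [hcJ, hJ1 c]) (ih h₂ hJ.2)
  | builtin hts _ ih => exact .builtin hts (ih h₂ hJ)
  | @imp S p ts b g q g' q' i v X J J' hH hvN hvJ hvJ' hJJ' hg _ _ ih =>
    rw [Set.disjoint_union_left, Set.disjoint_union_left] at hJ
    rw [Set.union_assoc]
    refine .imp hH hvN hvJ ?_ ?_ hg (ih h₂ hJ.2)
    · have : v ∉ J₂ := Set.disjoint_left.1 hJ.1.1 rfl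
      simp [hvJ', this]
    · exact Set.disjoint_union_right.2 ⟨hJJ', hJ.1.2⟩

/-- Corresponding goals have corresponding instances, if the substitutions agree on the common
variables and leave the private variables alone. -/
theorem Corresponds.subst {V' : Set ℕ} {σ σ' : Subst F} (hσ : SupportedOn σ V') (hV : V ⊆ V')
    (hN : Disjoint V' N) (hσ' : ∀ x ∈ V, σ' x = σ x) {S : Term F} {G : Goal F P K}
    {G' : TGoal F P K} {J : Set ℕ} (h : Corresponds T V N S G G' J)
    (hJ : ∀ x ∈ J, σ' x = .var x) :
    Corresponds T V' N (S.subst σ') (G.subst σ) (G'.subst σ') J := by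
  have hargs : ∀ {ts : List (Term F)}, (∀ x ∈ varsArgs ts, x ∈ V) →
      substArgs σ' ts = substArgs σ ts ∧ ∀ x ∈ varsArgs (substArgs σ ts), x ∈ V' := by
    intro ts hts
    refine ⟨substArgs_congr fun x hx => hσ' x (hts x hx), fun x hx => ?_⟩
    obtain ⟨y, hy, hx⟩ := mem_varsArgs_substArgs.1 hx
    exact hσ.2 y (hV (hts y hy)) x hx
  induction h with
  | nil => exact .nil
  | @user S p ts q q' l i c J hts hlN hiN hcN hli hlc hic hlJ hiJ hcJ _ ih =>
    have hl := hJ l (by simp)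
    have hi := hJ i (by simp)
    have hc := hJ c (by simp)
    simp only [Goal.subst, TGoal.subst, substArgs_append, (hargs hts).1]
    simp only [substArgs, List.map_cons, List.map_nil, Term.subst, hl, hi, hc]
    exact .user (hargs hts).2 hlN hiN hcN hli hlc hic hlJ hiJ hcJ
      (ih fun x hx => hJ x (Or.inr hx))
  | builtin hts _ ih =>
    simp only [Goal.subst, TGoal.subst, (hargs hts).1]
    exact .builtin (hargs hts).2 (ih hJ)
  | @imp S p ts b g q g' q' i v X J J' hH hvN hvJ hvJ' hJJ' hg _ ihg ihq =>
    have hv := hJ v (by simp)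
    simp only [Goal.subst, TGoal.subst, Term.subst, hv] at ihg ⊢
    refine .imp ?_ hvN hvJ hvJ' hJJ' (ihg fun x hx => hJ x (Or.inl (Or.inr hx)))
      (ihq fun x hx => hJ x (Or.inr hx))
    obtain ⟨e, he, η, κ, hη, hR, hi, hX⟩ := hH
    refine ⟨e, he, η.comp σ, κ, hη.subst hσ hV hN, ?_, hi, ?_⟩
    · simp only [Rule.mk.injEq] at hR ⊢
      rw [hR.2.1, hR.2.2, substArgs_comp, Goal.subst_comp]
      exact ⟨hR.1, rfl, rfl⟩
    · rw [hX, Term.subst_comp]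
      refine Term.subst_congr fun x hx => hσ' x ?_
      obtain ⟨y, hy, hx⟩ := Term.mem_vars_subst.1 hx
      exact hη.shared y (mem_varList_vars.1 hy) x hx

/-- The instances of a goal and of its translation correspond. -/
theorem Goal.corresponds_translate {τ τ' : Subst F} {κ ι : ℕ → ℕ} (G : Goal F P K) :
    ∀ (S : Term F) (outer : Finset ℕ) (v i : ℕ),
    (∀ x ∈ G.vars, x < v) → (∀ x ∈ S.vars, x < v) →
    (∀ e ∈ G.entries S outer v i, e ∈ T) →
    (∀ x ∈ (G.translate S outer v i).goal.vars, x ∈ G.vars →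
      τ' x = τ x ∧ ∀ y ∈ (τ x).vars, y ∈ V) →
    (∀ x ∈ G.locals outer, τ x = .var (κ x) ∧ κ x ∈ N) → Set.InjOn κ (G.locals outer) →
    (∀ x ∈ (G.translate S outer v i).goal.vars, v ≤ x → τ' x = .var (ι x) ∧ ι x ∈ N) →
    Set.InjOn ι {x | x ∈ (G.translate S outer v i).goal.vars ∧ v ≤ x} →
    ∃ J, Corresponds T V N (S.subst τ') (G.subst τ) ((G.translate S outer v i).goal.subst τ') J ∧
      J ⊆ ι '' {x | x ∈ (G.translate S outer v i).goal.vars ∧ v ≤ x ∧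
        x < (G.translate S outer v i).nextVar} := by
  induction G with
  | nil => intros; exact ⟨∅, .nil, by simp⟩
  | user p ts q ih =>
    -- The three additional variables come from the counter values `v`, `v + 1`, `v + 2`, and those
    -- of the rest from `v + 3` on; injectivity of `ι` keeps their images apart.
    intro S outer v i h1 h2 hT hvis hloc hκ hjunk hι
    simp only [Goal.translate, TGoal.vars, Goal.vars, Finset.mem_union] at h1 hvis hjunk hι ⊢
    have hle := (q.translate_le S (outer ∪ varsArgs ts) (v + 3) i).1
    obtain ⟨J, hJ, hJs⟩ := ih S (outer ∪ varsArgs ts) (v + 3) i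
      (fun x hx => by have := h1 x (Or.inr hx); omega) (fun x hx => by have := h2 x hx; omega)
      hT (fun x hx hx' => hvis x (Or.inr hx) (Or.inr hx')) hloc hκ
      (fun x hx hx' => hjunk x (Or.inr hx) (by omega))
      (by
        refine hι.mono fun x hx => ?_
        exact ⟨Or.inr hx.1, by have := hx.2; omega⟩)
    have hmem : ∀ j < 3, v + j ∈ varsArgs (ts ++ [.var v, .var (v + 1), .var (v + 2), S]) := by
      intro j hj
      refine mem_varsArgs.2 ⟨.var (v + j), ?_, by simp [Term.vars]⟩
      interval_cases j <;> simp
    have hne : ∀ j < 3, ∀ k, j < k → v + k ∈ varsArgs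
        (ts ++ [.var v, .var (v + 1), .var (v + 2), S]) ∨
        v + k ∈ (q.translate S (outer ∪ varsArgs ts) (v + 3) i).goal.vars → ι (v + j) ≠ ι (v + k) :=
      fun j hj k hk hm h => by
        have := hι ⟨Or.inl (hmem j hj), by omega⟩ ⟨hm, by omega⟩ h
        omega
    have hnJ : ∀ j < 3, ι (v + j) ∉ J := by
      intro j hj h
      obtain ⟨x, ⟨hx, hx', -⟩, hxe⟩ := hJs h
      obtain ⟨k, rfl⟩ := Nat.exists_eq_add_of_le (show v ≤ x by omega)
      exact hne j hj k (by omega) (Or.inr hx) hxe.symm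
    have j0 := hjunk v (Or.inl (hmem 0 (by omega))) (by omega)
    have j1 := hjunk (v + 1) (Or.inl (hmem 1 (by omega))) (by omega)
    have j2 := hjunk (v + 2) (Or.inl (hmem 2 (by omega))) (by omega)
    have hts : ∀ x ∈ varsArgs ts, τ' x = τ x ∧ ∀ y ∈ (τ x).vars, y ∈ V := fun x hx => by
      refine hvis x (Or.inl ?_) (Or.inl hx)
      obtain ⟨t, ht, hx⟩ := mem_varsArgs.1 hx
      exact mem_varsArgs.2 ⟨t, by simp [ht], hx⟩
    refine ⟨{ι v, ι (v + 1), ι (v + 2)} ∪ J, ?_, ?_⟩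
    · simp only [Goal.subst, TGoal.subst, substArgs_append,
        substArgs_congr fun x hx => (hts x hx).1]
      simp only [substArgs, List.map_cons, List.map_nil, Term.subst, j0.1, j1.1, j2.1]
      refine .user (fun x hx => ?_) j0.2 j1.2 j2.2 (hne 0 (by omega) 1 (by omega)
        (Or.inl (hmem 1 (by omega)))) (hne 0 (by omega) 2 (by omega) (Or.inl (hmem 2 (by omega))))
        (hne 1 (by omega) 2 (by omega) (Or.inl (hmem 2 (by omega)))) (hnJ 0 (by omega))
        (hnJ 1 (by omega)) (hnJ 2 (by omega)) hJ
      obtain ⟨y, hy, hx⟩ := mem_varsArgs_substArgs.1 hx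
      exact (hts y hy).2 x hx
    · rintro x (hx | hx)
      · rcases hx with rfl | rfl | rfl
        · exact ⟨v, ⟨Or.inl (hmem 0 (by omega)), by omega, by omega⟩, rfl⟩
        · exact ⟨v + 1, ⟨Or.inl (hmem 1 (by omega)), by omega, by omega⟩, rfl⟩
        · exact ⟨v + 2, ⟨Or.inl (hmem 2 (by omega)), by omega, by omega⟩, rfl⟩
      · obtain ⟨y, ⟨hy, hy', hy''⟩, rfl⟩ := hJs hx
        exact ⟨y, ⟨Or.inr hy, by omega, hy''⟩, rfl⟩
  | builtin p ts q ih =>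
    intro S outer v i h1 h2 hT hvis hloc hκ hjunk hι
    simp only [Goal.translate, TGoal.vars, Goal.vars, Finset.mem_union] at h1 hvis hjunk hι ⊢
    obtain ⟨J, hJ, hJs⟩ := ih S (outer ∪ varsArgs ts) v i
      (fun x hx => h1 x (Or.inr hx)) h2
      hT (fun x hx hx' => hvis x (Or.inr hx) (Or.inr hx')) hloc hκ
      (fun x hx hx' => hjunk x (Or.inr hx) hx')
      (by
        refine hι.mono fun x hx => ?_
        exact ⟨Or.inr hx.1, hx.2⟩)
    have hts : ∀ x ∈ varsArgs ts, τ' x = τ x ∧ ∀ y ∈ (τ x).vars, y ∈ V := fun x hx =>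
      hvis x (Or.inl hx) (Or.inl hx)
    refine ⟨J, ?_, fun x hx => ?_⟩
    · simp only [Goal.subst, TGoal.subst, substArgs_congr fun x hx => (hts x hx).1]
      refine .builtin (fun x hx => ?_) hJ
      obtain ⟨y, hy, hx⟩ := mem_varsArgs_substArgs.1 hx
      exact (hts y hy).2 x hx
    · obtain ⟨y, ⟨hy, hy'⟩, rfl⟩ := hJs hx
      exact ⟨y, ⟨Or.inr hy, hy'⟩, rfl⟩
  | imp p ts b g q ihb ihg ihq =>
    intro S outer v i h1 h2 hT hvis hloc hκ hjunk hι
    rw [Goal.translate_imp] at hvis hjunk hι ⊢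
    simp only [Goal.entries] at hT
    simp only at hvis hjunk hι ⊢
    have l1 := b.translate_le (.var (v + 1)) (outer ∪ g.vars ∪ q.vars ∪ varsArgs ts) (v + 3) (i + 1)
    generalize b.translate (.var (v + 1)) (outer ∪ g.vars ∪ q.vars ∪ varsArgs ts) (v + 3) (i + 1)
      = rb at hT hvis hjunk hι l1 ⊢
    have l2 := g.translate_le (.cons (.var v) S) (outer ∪ varsArgs ts ∪ b.vars ∪ q.vars)
      rb.nextVar rb.nextId
    have i2 := ihg (.cons (.var v) S) (outer ∪ varsArgs ts ∪ b.vars ∪ q.vars)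
      rb.nextVar rb.nextId
    generalize g.translate (.cons (.var v) S) (outer ∪ varsArgs ts ∪ b.vars ∪ q.vars) rb.nextVar
      rb.nextId = rg at hT hvis hjunk hι i2 l2 ⊢
    have l3 := q.translate_le S (outer ∪ varsArgs ts ∪ b.vars ∪ g.vars) rg.nextVar rg.nextId
    have i3 := ihq S (outer ∪ varsArgs ts ∪ b.vars ∪ g.vars) rg.nextVar rg.nextId
    generalize q.translate S (outer ∪ varsArgs ts ∪ b.vars ∪ g.vars) rg.nextVar rg.nextId = rq
      at hvis hjunk hι i3 l3 ⊢
    simp only [TGoal.vars, Goal.vars, Finset.mem_union, mem_varList_vars, Term.vars,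
      Finset.mem_singleton, Finset.notMem_empty, false_or] at h1 hvis hjunk hι ⊢
    simp only [Goal.locals, Finset.mem_union, Finset.mem_sdiff, not_or] at hloc hκ
    obtain ⟨J, hJ, hJs⟩ := i2 (fun x hx => by have := h1 x (Or.inl (Or.inr hx)); omega)
      (fun x hx => by
        simp only [Term.vars, Finset.mem_union, Finset.mem_singleton] at hx
        rcases hx with hx | hx
        · omega
        · have := h2 x hx; omega)
      (fun e he => hT e (by simp only [List.mem_cons, List.mem_append, he, or_true, true_or]))
      (fun x hx hx' => hvis x (by simp only [hx, or_true, true_or]) (Or.inl (Or.inr hx')))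
      (fun x hx => hloc x (Or.inl (Or.inr hx)))
      (by
        refine hκ.mono fun x hx => ?_
        rw [Finset.mem_coe] at hx ⊢
        simp only [Finset.mem_union, hx, or_true, true_or])
      (fun x hx hx' => hjunk x (by simp only [hx, or_true, true_or]) (by omega))
      (by
        refine hι.mono fun x hx => ?_
        exact ⟨by simp only [hx.1, or_true, true_or], by have := hx.2; omega⟩)
    obtain ⟨J', hJ', hJs'⟩ := i3 (fun x hx => by have := h1 x (Or.inr hx); omega)
      (fun x hx => by have := h2 x hx; omega)
      (fun e he => hT e (by simp only [List.mem_cons, List.mem_append, he, or_true]))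
      (fun x hx hx' => hvis x (Or.inr hx) (Or.inr hx'))
      (fun x hx => hloc x (Or.inr hx))
      (by
        refine hκ.mono fun x hx => ?_
        rw [Finset.mem_coe] at hx ⊢
        simp only [Finset.mem_union, hx, or_true])
      (fun x hx hx' => hjunk x (Or.inr hx) (by omega))
      (by
        refine hι.mono fun x hx => ?_
        exact ⟨Or.inr hx.1, by have := hx.2; omega⟩)
    have jv := hjunk v (by simp only [or_true, true_or]) le_rfl
    refine ⟨{ι v} ∪ J ∪ J', ?_, ?_⟩
    · simp only [Goal.subst, TGoal.subst, Term.subst, jv.1] at hJ ⊢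
      -- The instance of the hypothesis is given by `τ` and `κ` themselves. Its shared variables
      -- occur in the translated goal, so `τ` and `τ'` agree on them.
      refine .imp ⟨_, hT _ List.mem_cons_self, τ, κ, ⟨fun x hx => ?_, fun x hx hx' => ?_, ?_⟩, rfl,
        rfl, ?_⟩ jv.2 (fun h => ?_) (fun h => ?_) ?_ hJ hJ'
      · refine (hvis x (by simp only [hx, true_or]) ?_).2
        simp only [HypEntry.shared, HypEntry.vars, Finset.mem_inter, Finset.mem_union] at hx
        exact Or.inl (Or.inl hx.1)
      · simp only [HypEntry.vars, Finset.mem_union, not_or] at hx hx'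
        exact hloc x (Or.inl (Or.inl ⟨hx, hx'⟩))
      · refine hκ.mono fun x hx => ?_
        obtain ⟨hx, hx'⟩ := hx
        simp only [HypEntry.vars, Finset.mem_union, not_or] at hx hx'
        simp only [Finset.coe_union, Finset.coe_sdiff, Set.mem_union, Set.mem_sdiff, Finset.mem_coe,
          not_or]
        exact Or.inl (Or.inl ⟨hx, hx'⟩)
      · refine varList_subst_eq_iff.2 fun x hx => (hvis x (by simp only [hx, true_or]) ?_).1
        simp only [HypEntry.shared, HypEntry.vars, Finset.mem_inter, Finset.mem_union] at hx
        exact Or.inl (Or.inl hx.1)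
      · obtain ⟨x, ⟨hx, hx', -⟩, hxe⟩ := hJs h
        have := hι ⟨by simp only [hx, or_true, true_or], by omega⟩
          ⟨by simp only [or_true, true_or], le_rfl⟩ hxe
        omega
      · obtain ⟨x, ⟨hx, hx', -⟩, hxe⟩ := hJs' h
        have := hι ⟨Or.inr hx, by omega⟩ ⟨by simp only [or_true, true_or], le_rfl⟩ hxe
        omega
      -- The new variables of `g` and `q` stem from counter ranges that meet only at the excluded
      -- bound `rg.nextVar`.
      · refine Set.disjoint_left.2 fun x hx hx' => ?_
        obtain ⟨y, ⟨hy, hy', hy''⟩, rfl⟩ := hJs hx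
        obtain ⟨z, ⟨hz, hz', -⟩, hze⟩ := hJs' hx'
        have := hι ⟨Or.inr hz, by omega⟩ ⟨by simp only [hy, or_true, true_or], by omega⟩ hze
        omega
    · rintro x ((rfl | hx) | hx)
      · exact ⟨v, ⟨by simp only [or_true, true_or], le_rfl, by omega⟩, rfl⟩
      · obtain ⟨y, ⟨hy, hy', hy''⟩, rfl⟩ := hJs hx
        exact ⟨y, ⟨by simp only [hy, or_true, true_or], by omega, by omega⟩, rfl⟩
      · obtain ⟨y, ⟨hy, hy', hy''⟩, rfl⟩ := hJs' hx
        exact ⟨y, ⟨Or.inr hy, by omega, by omega⟩, rfl⟩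

end Correspondence

/-! ### Resolution with translated clauses -/

section Resolution

variable {F : Type u} {P : Type v} {K : Type w}

theorem Subst.comp_self_of_solved {δ : Subst F} (h : ∀ x y, y ∈ (δ x).vars → δ x ≠ .var x →
    δ y = .var y) : δ.comp δ = δ := by
  refine Subst.idempotent_iff.2 fun x y hy => ?_
  by_cases hx : δ x = .var x
  · rw [hx] at hy
    rw [show y = x by simpa [Term.vars] using hy, hx]
  · exact h x y hy hx

/-- Most general unifiers after the elimination of the variables that are solved by `δ`. -/
theorem IsMGU.eliminate {E' : Subst F → Prop} {δ σ : Subst F} {us ts : List (Term F)}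
    (hσ : IsMGU σ us ts) (hδ : δ.comp δ = δ)
    (hE' : ∀ τ, E' τ ↔ δ.comp τ = τ ∧ substArgs τ us = substArgs τ ts)
    (hus : ∀ x ∈ varsArgs us, δ x = .var x) (hts : ∀ x ∈ varsArgs ts, δ x = .var x) :
    IsPrincipal E' (δ.comp σ) := by
  refine (isMGU_iff.1 hσ).eliminate hδ hE' fun τ => ?_
  rw [substArgs_comp, substArgs_comp, substArgs_eq_self hus, substArgs_eq_self hts]

theorem IsPrincipal.exists_isMGU_rename {E' : Subst F → Prop} {δ Θ : Subst F}
    {us ts : List (Term F)} (hΘ : IsPrincipal E' Θ) (hδ : δ.comp δ = δ)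
    (hE' : ∀ τ, E' τ ↔ δ.comp τ = τ ∧ substArgs τ us = substArgs τ ts)
    (hus : ∀ x ∈ varsArgs us, δ x = .var x) (hts : ∀ x ∈ varsArgs ts, δ x = .var x) :
    ∃ (π : Equiv.Perm ℕ) (σ : Subst F),
      IsMGU σ (substArgs (renameBy π) us) (substArgs (renameBy π) ts) ∧
      (∀ x, π x ≠ x → ∃ e u, δ e = .var u ∧ δ e ≠ .var e ∧ (x = e ∨ x = u)) ∧
      ∀ x, δ x = .var x → σ (π x) = Θ x := by
  obtain ⟨π, σ, hσ, h⟩ := hΘ.exists_rename hδ hE' (fun τ => by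
    rw [substArgs_comp, substArgs_comp, substArgs_eq_self hus, substArgs_eq_self hts])
    (fun σ τ h => by rw [substArgs_comp, substArgs_comp, h])
  exact ⟨π, σ, isMGU_iff.2 (hσ.congr fun τ => by rw [substArgs_comp, substArgs_comp]), h⟩

/-- `σ` resolves a call to a hypothetical rule with head `args` renamed by `α`, and `Θ` resolves, by
one or more steps, the translated call with a translated clause renamed by `ρ`. The set `D` consists of
the variables of the translated clause, of which those in `R` occur in the hypothetical rule, those
from `v` on are the new variables in the translated body, and `s` is the context identifier. -/
structure IsResolution (V N : Set ℕ) (c : List ℤ) (l i k : ℕ) (ts args : List (Term F))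
    (D R : Finset ℕ) (v s : ℕ) (ρ : Equiv.Perm ℕ) (α σ Θ : Subst F) : Prop where
  mgu : IsMGU σ (substArgs α args) ts
  visible : ∀ x ∈ V, Θ x = σ x
  hidden : ∀ x ∈ N, x ≠ l → x ≠ i → x ≠ k → Θ x = .var x
  clause : ∀ x ∈ D, x ∈ R → Θ (ρ x) = (α x).subst σ
  context : Θ (ρ s) = .ctx c
  junk : ∀ x ∈ D, v ≤ x → Θ (ρ x) = .var (ρ x)

namespace HypEntry

/-- The solution for the variables of the translated hypothesis that do not occur in the source. -/
def solutionAux (e : HypEntry F P K) (η : Subst F) (ρ : Equiv.Perm ℕ) (c d : List ℤ) : Subst F :=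
  fun z =>
    if ρ.symm z = e.next + 1 then .ctx c
    else if ρ.symm z = e.next + 2 then .ctx d
    else if ρ.symm z ∈ e.shared then η (ρ.symm z)
    else .var z

/-- The solution for the variables of the translated hypothesis and of the call that do not occur in the
source. -/
def solution (e : HypEntry F P K) (η : Subst F) (ρ : Equiv.Perm ℕ) (c d : List ℤ) (l i k : ℕ) :
    Subst F :=
  fun z =>
    if z = l then (varList e.shared).subst η
    else if z = i then .int e.id
    else if z = k then
      ((Term.cons (.var e.next) e.ctx).subst (renameBy ρ)).subst (e.solutionAux η ρ c d)
    else e.solutionAux η ρ c d z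

/-- The renaming of a hypothesis that uses `η` for its shared variables and `ρ` for the others. -/
def mixed (e : HypEntry F P K) (η : Subst F) (ρ : Equiv.Perm ℕ) : Subst F :=
  fun x => if x ∈ e.shared then η x else .var (ρ x)

/-- The head of the translated hypothesis. -/
def head (e : HypEntry F P K) : List (Term F) :=
  e.args ++ [varList e.shared, .int e.id, .cons (.var e.next) e.ctx, .var (e.next + 1)]

variable {T : Set (HypEntry F P K)} {e : HypEntry F P K} {η : Subst F} {ρ : Equiv.Perm ℕ}
  {c d : List ℤ} {l i k : ℕ}

theorem WellFormed.lt_of_mem_shared (he : e.WellFormed T) {x : ℕ} (hx : x ∈ e.shared) :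
    x < e.next :=
  he.vars_lt x (Finset.mem_inter.1 hx).1

theorem mem_clause_vars {x : ℕ} : x ∈ e.clause.vars ↔ x ∈ varsArgs e.args ∨ x ∈ e.shared ∨
    x = e.next ∨ x ∈ e.ctx.vars ∨ x = e.next + 1 ∨ x = e.next + 2 ∨ x ∈ e.tbody.vars := by
  have : x ∈ varsArgs (e.args ++
      [varList e.shared, .int e.id, .cons (.var e.next) e.ctx, .var (e.next + 1)]) ↔
      x ∈ varsArgs e.args ∨ x ∈ e.shared ∨ x = e.next ∨ x ∈ e.ctx.vars ∨ x = e.next + 1 := by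
    simp only [mem_varsArgs, List.mem_append, List.mem_cons, List.not_mem_nil, or_false]
    constructor
    · rintro ⟨t, (ht | rfl | rfl | rfl | rfl), hx⟩
      · exact Or.inl ⟨t, ht, hx⟩
      · simp_all
      · simp [Term.vars] at hx
      · simp [Term.vars] at hx; tauto
      · simp [Term.vars] at hx; tauto
    · rintro (⟨t, ht, hx⟩ | hx | hx | hx | hx)
      · exact ⟨t, Or.inl ht, hx⟩
      · exact ⟨varList e.shared, by simp, by simp [hx]⟩
      · exact ⟨.cons (.var e.next) e.ctx, by simp, by simp [Term.vars, hx]⟩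
      · exact ⟨.cons (.var e.next) e.ctx, by simp, by simp [Term.vars, hx]⟩
      · exact ⟨.var (e.next + 1), by simp, by simp [Term.vars, hx]⟩
  simp only [HypEntry.clause, HypEntry.guarded, TClause.vars, TGoal.vars, Finset.mem_union, this,
    mem_varList_vars, Term.vars, Finset.mem_singleton, Finset.notMem_empty, false_or]
  tauto

/-- Spells out the solved equations: the current context, the registered context, and one equation
for each shared variable. -/
theorem solutionAux_comp_iff (he : e.WellFormed T) {τ : Subst F} :
    (e.solutionAux η ρ c d).comp τ = τ ↔ τ (ρ (e.next + 1)) = .ctx c ∧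
      τ (ρ (e.next + 2)) = .ctx d ∧ ∀ x ∈ e.shared, τ (ρ x) = (η x).subst τ := by
  constructor
  · intro h
    refine ⟨?_, ?_, fun x hx => ?_⟩
    · rw [← h]
      simp [Subst.comp, solutionAux]
    · rw [← h]
      simp [Subst.comp, solutionAux]
    · have := he.lt_of_mem_shared hx
      conv_lhs => rw [← h]
      simp [Subst.comp, solutionAux, hx, show x ≠ e.next + 1 by omega, show x ≠ e.next + 2 by omega]
  · rintro ⟨h1, h2, h3⟩
    funext z
    obtain ⟨x, rfl⟩ := ρ.surjective z
    simp only [Subst.comp, solutionAux, Equiv.symm_apply_apply]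
    split_ifs with hx hx hx
    · rw [hx, h1, Term.subst_ctx]
    · rw [hx, h2, Term.subst_ctx]
    · exact (h3 x hx).symm
    · rfl

/-- `z` is a variable of the target language. -/
def IsSolved (e : HypEntry F P K) (ρ : Equiv.Perm ℕ) (l i k z : ℕ) : Prop :=
  z = l ∨ z = i ∨ z = k ∨ ∃ x, z = ρ x ∧ (x = e.next + 1 ∨ x = e.next + 2 ∨ x ∈ e.shared)

theorem solution_of_not_isSolved {z : ℕ} (hz : ¬ e.IsSolved ρ l i k z) :
    e.solution η ρ c d l i k z = .var z := by
  simp only [IsSolved, not_or, not_exists, not_and] at hz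
  simp [solution, solutionAux, hz]

/-- No solved variable occurs in a value of the solution. The hypotheses exclude the variables of
the call from the clause and all solved variables from the terms `η x`. -/
theorem solution_comp_self (hl : ¬ ∃ x, l = ρ x ∧ x ∈ e.clause.vars)
    (hi : ¬ ∃ x, i = ρ x ∧ x ∈ e.clause.vars) (hk : ¬ ∃ x, k = ρ x ∧ x ∈ e.clause.vars)
    (hη : ∀ x ∈ e.shared, ∀ y ∈ (η x).vars, ¬ e.IsSolved ρ l i k y) :
    (e.solution η ρ c d l i k).comp (e.solution η ρ c d l i k) = e.solution η ρ c d l i k := by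
  refine Subst.comp_self_of_solved fun z y hy hz => solution_of_not_isSolved ?_
  have haux : ∀ z y, y ∈ (e.solutionAux η ρ c d z).vars →
      (y = z ∧ ¬ (∃ x, z = ρ x ∧ (x = e.next + 1 ∨ x = e.next + 2 ∨ x ∈ e.shared))) ∨
        ¬ e.IsSolved ρ l i k y := by
    intro z y hy
    obtain ⟨x, rfl⟩ := ρ.surjective z
    simp only [solutionAux, Equiv.symm_apply_apply] at hy
    split_ifs at hy with h1 h2 h3
    · simp at hy
    · simp at hy
    · exact Or.inr (hη x h3 y hy)
    · left
      simp only [Term.vars, Finset.mem_singleton] at hy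
      refine ⟨hy, ?_⟩
      rintro ⟨x', hx', h⟩
      obtain rfl := ρ.injective hx'
      tauto
  simp only [solution] at hy hz
  split_ifs at hy hz with h1 h2 h3
  · obtain ⟨x, hx, hy⟩ := Term.mem_vars_subst.1 hy
    exact hη x (mem_varList_vars.1 hx) y hy
  · simp [Term.vars] at hy
  -- The value for `k` is the context argument in the head. Nothing is assumed about `e.ctx`, so it
  -- is instantiated by `solutionAux` first.
  · obtain ⟨x, hx, hy⟩ := Term.mem_vars_subst.1 hy
    obtain ⟨x', hx', rfl⟩ := Term.mem_vars_renameBy.1 hx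
    rcases haux _ _ hy with ⟨rfl, h⟩ | h
    · have hx' : x' ∈ e.clause.vars := by
        rw [mem_clause_vars]
        simp [Term.vars] at hx'
        tauto
      rintro (h' | h' | h' | h')
      · exact hl ⟨x', h'.symm, hx'⟩
      · exact hi ⟨x', h'.symm, hx'⟩
      · exact hk ⟨x', h'.symm, hx'⟩
      · exact h h'
    · exact h
  · rcases haux _ _ hy with ⟨rfl, h⟩ | h
    · rintro (h' | h' | h' | h')
      · exact h1 h'
      · exact h2 h'
      · exact h3 h'
      · exact h h'
    · exact h

/-- The unification problem of a translated call with a translated hypothesis and its registration is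
solved by `solution` and the unification problem of the source. -/
theorem unify_iff (he : e.WellFormed T) (hli : l ≠ i) (hlk : l ≠ k) (hik : i ≠ k)
    (hl : ¬ ∃ x, l = ρ x ∧ x ∈ e.clause.vars)
    (hi : ¬ ∃ x, i = ρ x ∧ x ∈ e.clause.vars) (hk : ¬ ∃ x, k = ρ x ∧ x ∈ e.clause.vars)
    {ts : List (Term F)} {τ : Subst F} :
    (substArgs τ (substArgs (renameBy ρ) e.head) =
        substArgs τ (ts ++ [.var l, .var i, .var k, .ctx c]) ∧
      substArgs τ [.int e.id, (varList e.shared).subst η, .ctx d] =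
        substArgs τ [.int e.id, (varList e.shared).subst (renameBy ρ), .var (ρ (e.next + 2))]) ↔
    (e.solution η ρ c d l i k).comp τ = τ ∧
      substArgs τ (substArgs (e.mixed η ρ) e.args) = substArgs τ ts := by
  have hsol : (e.solution η ρ c d l i k).comp τ = τ ↔ (e.solutionAux η ρ c d).comp τ = τ ∧
      τ l = ((varList e.shared).subst η).subst τ ∧ τ i = .int e.id ∧
      τ k = ((Term.cons (.var e.next) e.ctx).subst (renameBy ρ)).subst τ := by
    have hne : ∀ x ∈ e.clause.vars, ρ x ≠ l ∧ ρ x ≠ i ∧ ρ x ≠ k := fun x hx =>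
      ⟨fun h => hl ⟨x, h.symm, hx⟩, fun h => hi ⟨x, h.symm, hx⟩, fun h => hk ⟨x, h.symm, hx⟩⟩
    constructor
    · intro h
      have haux : (e.solutionAux η ρ c d).comp τ = τ := by
        rw [solutionAux_comp_iff he]
        have hx : ∀ x ∈ e.clause.vars, τ (ρ x) = (e.solutionAux η ρ c d (ρ x)).subst τ := by
          intro x hx
          conv_lhs => rw [← h]
          simp [Subst.comp, solution, hne x hx]
        refine ⟨?_, ?_, fun x hx' => ?_⟩
        · rw [hx _ (mem_clause_vars.2 (by simp))]
          simp [solutionAux]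
        · rw [hx _ (mem_clause_vars.2 (by simp))]
          simp [solutionAux]
        · have := he.lt_of_mem_shared hx'
          rw [hx _ (mem_clause_vars.2 (by simp [hx']))]
          simp [solutionAux, hx', show x ≠ e.next + 1 by omega, show x ≠ e.next + 2 by omega]
      refine ⟨haux, ?_, ?_, ?_⟩
      · conv_lhs => rw [← h]
        simp [Subst.comp, solution]
      · conv_lhs => rw [← h]
        simp [Subst.comp, solution, hli.symm, Term.subst]
      · conv_lhs => rw [← h]
        simp only [Subst.comp, solution, hlk.symm, hik.symm, if_false, if_true]
        rw [← Term.subst_comp _ τ, haux]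
    · rintro ⟨h0, h1, h2, h3⟩
      funext z
      simp only [Subst.comp, solution]
      split_ifs with hz hz hz
      · rw [hz, h1]
      · rw [hz, h2]; rfl
      · rw [hz, h3, ← Term.subst_comp _ τ, h0]
      · exact congrFun h0 z
  have hshared : (varList e.shared).subst ((renameBy ρ).comp τ) =
      (varList e.shared).subst (η.comp τ) ↔ ∀ x ∈ e.shared, τ (ρ x) = (η x).subst τ := by
    rw [varList_subst_eq_iff]; rfl
  -- Once `τ` satisfies the equations of the shared variables, it no longer distinguishes the head
  -- renamed by `ρ` from the instance that uses `η` on the shared variables.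
  have hargs : (∀ x ∈ e.shared, τ (ρ x) = (η x).subst τ) →
      substArgs τ (substArgs (e.mixed η ρ) e.args) =
        substArgs τ (substArgs (renameBy ρ) e.args) := by
    intro h
    rw [← substArgs_comp, ← substArgs_comp]
    refine substArgs_congr fun x _ => ?_
    simp only [Subst.comp, mixed, renameBy_apply]
    split_ifs with hx
    · exact (h x hx).symm
    · rfl
  rw [hsol, solutionAux_comp_iff he, HypEntry.head, substArgs_append,
    substArgs_eq_append_iff (by simp [substArgs])]
  simp only [substArgs, List.map_cons, List.map_nil, List.cons.injEq, and_true, Term.subst_ctx,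
    ← Term.subst_comp _ τ]
  simp only [Term.subst_comp _ τ]
  simp only [Term.subst, renameBy_apply, true_and]
  simp only [substArgs] at hargs
  constructor
  -- The equations `h2` to `h5` are those of the four additional arguments; `h6` and `h7` come from
  -- the registration, and `h6` is the one that determines the shared variables.
  · rintro ⟨⟨h1, h2, h3, h4, h5⟩, h6, h7⟩
    have hsh := hshared.1 (by rw [Term.subst_comp, Term.subst_comp, h6])
    exact ⟨⟨⟨h5, h7.symm, hsh⟩, by rw [← h2, h6], h3.symm, h4.symm⟩, by rw [hargs hsh, h1]⟩
  · rintro ⟨⟨⟨h5, h7, hsh⟩, h2, h3, h4⟩, h1⟩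
    have h6 := hshared.2 hsh
    rw [Term.subst_comp, Term.subst_comp] at h6
    exact ⟨⟨by rw [← h1, hargs hsh], by rw [h6, h2], h3.symm, h4.symm, h5⟩, h6.symm, h7.symm⟩

end HypEntry

end Resolution

-- Resolution steps with hypotheses and their registrations

section Resolution

variable {F : Type u} {P : Type v} {K : Type w}

theorem IsMGU.apply_eq_var {σ : Subst F} {us ts : List (Term F)} (h : IsMGU σ us ts) {x : ℕ}
    (hus : x ∉ varsArgs us) (hts : x ∉ varsArgs ts) : σ x = .var x :=
  h.supportedOn.1 x (not_or.2 ⟨hus, hts⟩)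

namespace HypEntry

variable {T : Set (HypEntry F P K)} {e : HypEntry F P K} {η : Subst F} {ρ : Equiv.Perm ℕ}
  {c d : List ℤ} {l i k : ℕ} {V N : Set ℕ} {ts : List (Term F)}

/-- The renaming `ρ` of a translated hypothesis and the instance `η` of its shared variables use new
variables for a call in which `V` and `N` occur. -/
structure FreshFor (e : HypEntry F P K) (η : Subst F) (ρ : Equiv.Perm ℕ) (V N : Set ℕ) : Prop where
  rename : ∀ x ∈ e.clause.vars, ρ x ∉ V ∧ ρ x ∉ N
  shared : ∀ x ∈ e.shared, ∀ y ∈ (η x).vars, y ∉ V ∧ y ∉ N ∧ ∀ z ∈ e.clause.vars, y ≠ ρ z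

/-- A call with the variables in `V` whose additional arguments are the variables `l`, `i`, `k`. -/
structure IsCall (V N : Set ℕ) (l i k : ℕ) (ts : List (Term F)) : Prop where
  disjoint : Disjoint V N
  args : ∀ x ∈ varsArgs ts, x ∈ V
  l_mem : l ∈ N
  i_mem : i ∈ N
  k_mem : k ∈ N
  l_ne_i : l ≠ i
  l_ne_k : l ≠ k
  i_ne_k : i ≠ k

theorem FreshFor.notMem_image (h : e.FreshFor η ρ V N) {x : ℕ} (hx : x ∈ N) :
    ¬ ∃ y, x = ρ y ∧ y ∈ e.clause.vars := by
  rintro ⟨y, rfl, hy⟩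
  exact (h.rename y hy).2 hx

theorem mem_clause_vars_of_isSolved {x : ℕ}
    (hx : x = e.next + 1 ∨ x = e.next + 2 ∨ x ∈ e.shared) : x ∈ e.clause.vars := by
  rw [mem_clause_vars]
  tauto

theorem FreshFor.not_isSolved_of_mem_V (h : e.FreshFor η ρ V N) (hc : IsCall V N l i k ts) {x : ℕ}
    (hx : x ∈ V) : ¬ e.IsSolved ρ l i k x := by
  have hV := Set.disjoint_left.1 hc.disjoint hx
  rintro (rfl | rfl | rfl | ⟨y, rfl, hy⟩)
  · exact hV hc.l_mem
  · exact hV hc.i_mem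
  · exact hV hc.k_mem
  · exact (h.rename y (mem_clause_vars_of_isSolved hy)).1 hx

theorem FreshFor.not_isSolved_of_mem_N (h : e.FreshFor η ρ V N) {x : ℕ}
    (hx : x ∈ N) (hl : x ≠ l) (hi : x ≠ i) (hk : x ≠ k) : ¬ e.IsSolved ρ l i k x := by
  rintro (rfl | rfl | rfl | ⟨y, rfl, hy⟩)
  · exact hl rfl
  · exact hi rfl
  · exact hk rfl
  · exact (h.rename y (mem_clause_vars_of_isSolved hy)).2 hx

theorem FreshFor.not_isSolved_of_mem_vars (h : e.FreshFor η ρ V N) (hc : IsCall V N l i k ts)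
    {x y : ℕ} (hx : x ∈ e.shared) (hy : y ∈ (η x).vars) : ¬ e.IsSolved ρ l i k y := by
  have h1 := h.shared x hx y hy
  rintro (rfl | rfl | rfl | ⟨z, rfl, hz⟩)
  · exact h1.2.1 hc.l_mem
  · exact h1.2.1 hc.i_mem
  · exact h1.2.1 hc.k_mem
  · exact h1.2.2 z (mem_clause_vars_of_isSolved hz) rfl

theorem FreshFor.not_isSolved_rename (h : e.FreshFor η ρ V N) (hc : IsCall V N l i k ts)
    {x : ℕ} (hx : x ∈ e.clause.vars) (h1 : x ≠ e.next + 1) (h2 : x ≠ e.next + 2)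
    (h3 : x ∉ e.shared) : ¬ e.IsSolved ρ l i k (ρ x) := by
  have h0 := h.rename x hx
  rintro (h' | h' | h' | ⟨z, hz', hz⟩)
  · exact h0.2 (h' ▸ hc.l_mem)
  · exact h0.2 (h' ▸ hc.i_mem)
  · exact h0.2 (h' ▸ hc.k_mem)
  · obtain rfl := ρ.injective hz'
    tauto

theorem FreshFor.solution_rename (h : e.FreshFor η ρ V N) (hc : IsCall V N l i k ts) {x : ℕ}
    (hx : x ∈ e.clause.vars) :
    e.solution η ρ c d l i k (ρ x) = if x = e.next + 1 then .ctx c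
      else if x = e.next + 2 then .ctx d else e.mixed η ρ x := by
  have h1 := h.rename x hx
  have hl : ρ x ≠ l := fun h' => h1.2 (h' ▸ hc.l_mem)
  have hi : ρ x ≠ i := fun h' => h1.2 (h' ▸ hc.i_mem)
  have hk : ρ x ≠ k := fun h' => h1.2 (h' ▸ hc.k_mem)
  simp [solution, hl, hi, hk, solutionAux, mixed]

theorem FreshFor.solution_comp_self (h : e.FreshFor η ρ V N) (hc : IsCall V N l i k ts) :
    (e.solution η ρ c d l i k).comp (e.solution η ρ c d l i k) = e.solution η ρ c d l i k :=
  HypEntry.solution_comp_self (h.notMem_image hc.l_mem) (h.notMem_image hc.i_mem)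
    (h.notMem_image hc.k_mem) fun _ hx _ hy => h.not_isSolved_of_mem_vars hc hx hy

theorem FreshFor.mixed_vars (h : e.FreshFor η ρ V N) (hc : IsCall V N l i k ts)
    (he : e.WellFormed T) {x y : ℕ} (hx : x ∈ e.clause.vars) (hx' : x ∈ e.vars)
    (hy : y ∈ (e.mixed η ρ x).vars) : ¬ e.IsSolved ρ l i k y := by
  have := he.vars_lt x hx'
  simp only [mixed] at hy
  split_ifs at hy with hs
  · exact h.not_isSolved_of_mem_vars hc hs hy
  · obtain rfl : y = ρ x := by simpa [Term.vars] using hy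
    exact h.not_isSolved_rename hc hx (by omega) (by omega) hs

theorem mem_clause_vars_of_mem_args {x : ℕ} (hx : x ∈ varsArgs e.args) :
    x ∈ e.clause.vars ∧ x ∈ e.vars :=
  ⟨mem_clause_vars.2 (Or.inl hx), Finset.mem_union_left _ hx⟩

theorem FreshFor.mixed_args_vars (h : e.FreshFor η ρ V N) (hc : IsCall V N l i k ts)
    (he : e.WellFormed T) :
    ∀ y ∈ varsArgs (substArgs (e.mixed η ρ) e.args), ¬ e.IsSolved ρ l i k y := by
  intro y hy
  obtain ⟨x, hx, hy⟩ := mem_varsArgs_substArgs.1 hy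
  obtain ⟨h1, h2⟩ := mem_clause_vars_of_mem_args hx
  exact h.mixed_vars hc he h1 h2 hy

theorem FreshFor.notMem_mixed_args_of_mem_N (h : e.FreshFor η ρ V N) {x : ℕ} (hx : x ∈ N) :
    x ∉ varsArgs (substArgs (e.mixed η ρ) e.args) := by
  intro hy
  obtain ⟨z, hz, hy⟩ := mem_varsArgs_substArgs.1 hy
  simp only [mixed] at hy
  split_ifs at hy with hs
  · exact (h.shared z hs x hy).2.1 hx
  · obtain rfl : x = ρ z := by simpa [Term.vars] using hy
    exact (h.rename z (mem_clause_vars_of_mem_args hz).1).2 hx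

theorem FreshFor.rename_notMem_mixed_args (h : e.FreshFor η ρ V N) (he : e.WellFormed T) {x : ℕ}
    (hx : x ∈ e.clause.vars) (hx' : e.next + 3 ≤ x) :
    ρ x ∉ varsArgs (substArgs (e.mixed η ρ) e.args) := by
  intro hy
  obtain ⟨z, hz, hy⟩ := mem_varsArgs_substArgs.1 hy
  simp only [mixed] at hy
  split_ifs at hy with hs
  · exact (h.shared z hs _ hy).2.2 x hx rfl
  · have := ρ.injective (show ρ x = ρ z by simpa [Term.vars] using hy)
    have := he.vars_lt z (mem_clause_vars_of_mem_args hz).2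
    omega

/-- The variant of the registration has variables foreign to the call and the clause, so the first
mgu leaves it alone. The second unification can thus be read as a constraint with both sides
instantiated by `σ₁`, as `IsPrincipal.join` and `IsPrincipal.split` require. -/
theorem FreshFor.substArgs_fact (h : e.FreshFor η ρ V N) (hc : IsCall V N l i k ts) {σ₁ : Subst F}
    (hσ₁ : IsMGU σ₁ (substArgs (renameBy ρ) e.head) (ts ++ [.var l, .var i, .var k, .ctx c])) :
    substArgs σ₁ [.int e.id, (varList e.shared).subst η, .ctx d] =
      [.int e.id, (varList e.shared).subst η, .ctx d] := by
  refine substArgs_eq_self fun y hy => hσ₁.apply_eq_var (fun hm => ?_) (fun hm => ?_)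
  all_goals
    obtain ⟨x, hx, hy⟩ : ∃ x ∈ e.shared, y ∈ (η x).vars := by
      simpa [Term.vars, Term.mem_vars_subst] using hy
    have h1 := h.shared x hx y hy
  · obtain ⟨z, hz, hzy⟩ := mem_varsArgs_substArgs.1 hm
    have hzc : z ∈ e.clause.vars := Finset.mem_union_left _ hz
    exact h1.2.2 z hzc (by simpa [Term.vars] using hzy)
  · simp only [mem_varsArgs, List.mem_append, List.mem_cons, List.not_mem_nil, or_false] at hm
    obtain ⟨t, (ht | rfl | rfl | rfl | rfl), hyt⟩ := hm
    · exact h1.1 (hc.args y (mem_varsArgs.2 ⟨t, ht, hyt⟩))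
    · rw [Term.vars, Finset.mem_singleton] at hyt
      exact h1.2.1 (hyt ▸ hc.l_mem)
    · rw [Term.vars, Finset.mem_singleton] at hyt
      exact h1.2.1 (hyt ▸ hc.i_mem)
    · rw [Term.vars, Finset.mem_singleton] at hyt
      exact h1.2.1 (hyt ▸ hc.k_mem)
    · simp at hyt

/-- A resolution step with a hypothesis is simulated with its translation. -/
theorem FreshFor.exists_target_resolution (h : e.FreshFor η ρ V N) (hc : IsCall V N l i k ts)
    (he : e.WellFormed T) {σ : Subst F}
    (hσ : IsMGU σ (substArgs (e.mixed η ρ) e.args) ts) :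
    ∃ σ₁ σ₂ : Subst F,
      IsMGU σ₁ (substArgs (renameBy ρ) e.head) (ts ++ [.var l, .var i, .var k, .ctx c]) ∧
      IsMGU σ₂ [.int e.id, (varList e.shared).subst η, .ctx d] (substArgs σ₁
        [.int e.id, (varList e.shared).subst (renameBy ρ), .var (ρ (e.next + 2))]) ∧
      IsResolution V N c l i k ts e.args e.clause.vars e.vars (e.next + 3) (e.next + 1) ρ
        (e.mixed η ρ) σ (σ₁.comp σ₂) ∧
      σ₁.comp σ₂ (ρ (e.next + 2)) = .ctx d := by
  set δ := e.solution η ρ c d l i k with hδ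
  have hδs : ∀ x, ¬ e.IsSolved ρ l i k x → δ x = .var x := fun x hx => solution_of_not_isSolved hx
  -- `δσ` is a most general solution of the unifications with the head and with the registration
  -- together. It still has to be divided into the mgus of two separate steps.
  have hΘ := hσ.eliminate (h.solution_comp_self hc) (fun τ => unify_iff (c := c) (d := d) he
    hc.l_ne_i hc.l_ne_k hc.i_ne_k (h.notMem_image hc.l_mem) (h.notMem_image hc.i_mem)
    (h.notMem_image hc.k_mem)) (fun x hx => solution_of_not_isSolved (h.mixed_args_vars hc he x hx))
    (fun x hx => solution_of_not_isSolved (h.not_isSolved_of_mem_V hc (hc.args x hx)))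
  rw [← hδ] at hΘ
  obtain ⟨σ₁, hσ₁, hfix⟩ := exists_isMGU hΘ.1.1
  obtain ⟨σ₂, hσ₂, hcomp⟩ := hΘ.split (E := fun τ => substArgs τ (substArgs (renameBy ρ) e.head) =
    substArgs τ (ts ++ [.var l, .var i, .var k, .ctx c]))
    (fun σ τ h => by rw [substArgs_comp, substArgs_comp, h]) (isMGU_iff.1 hσ₁) hfix
  have hfact := h.substArgs_fact (d := d) hc hσ₁
  refine ⟨σ₁, σ₂, hσ₁, isMGU_iff.2 (hσ₂.congr fun τ => ?_), ?_, ?_⟩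
  · rw [substArgs_comp, substArgs_comp, hfact]
  · rw [hcomp]
    refine ⟨hσ, fun x hx => ?_, fun x hx h1 h2 h3 => ?_, fun x hx hx' => ?_, ?_, fun x hx hx' => ?_⟩
    · simp [Subst.comp, hδs x (h.not_isSolved_of_mem_V hc hx), Term.subst]
    · rw [Subst.comp, hδs x (h.not_isSolved_of_mem_N hx h1 h2 h3)]
      exact hσ.apply_eq_var (h.notMem_mixed_args_of_mem_N hx)
        (fun hx' => Set.disjoint_left.1 hc.disjoint (hc.args x hx') hx)
    · have := he.vars_lt x hx'
      rw [Subst.comp, hδ, h.solution_rename hc hx, if_neg (by omega), if_neg (by omega)]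
    · rw [Subst.comp, hδ, h.solution_rename hc (mem_clause_vars_of_isSolved (by simp)), if_pos rfl,
        Term.subst_ctx]
    · have hs : x ∉ e.shared := fun hs => by
        have := he.lt_of_mem_shared hs
        omega
      rw [Subst.comp, hδs _ (h.not_isSolved_rename hc hx (by omega) (by omega) hs)]
      exact hσ.apply_eq_var (h.rename_notMem_mixed_args he hx hx')
        (fun hx' => (h.rename x hx).1 (hc.args _ hx'))
  · rw [hcomp, Subst.comp, hδ, h.solution_rename hc (mem_clause_vars_of_isSolved (by simp)),
      if_neg (by omega), if_pos rfl, Term.subst_ctx]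

/-- A resolution step with a translated hypothesis is simulated with the hypothesis. -/
theorem FreshFor.exists_source_resolution (h : e.FreshFor η ρ V N) (hc : IsCall V N l i k ts)
    (he : e.WellFormed T) {σ₁ σ₂ : Subst F}
    (hσ₁ : IsMGU σ₁ (substArgs (renameBy ρ) e.head) (ts ++ [.var l, .var i, .var k, .ctx c]))
    (hσ₂ : IsMGU σ₂ [.int e.id, (varList e.shared).subst η, .ctx d] (substArgs σ₁
        [.int e.id, (varList e.shared).subst (renameBy ρ), .var (ρ (e.next + 2))])) :
    ∃ (π : Equiv.Perm ℕ) (σ : Subst F),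
      IsResolution V N c l i k ts e.args e.clause.vars e.vars (e.next + 3) (e.next + 1) ρ
        ((e.mixed η ρ).comp (renameBy π)) σ (σ₁.comp σ₂) ∧
      σ₁.comp σ₂ (ρ (e.next + 2)) = .ctx d ∧
      ∀ x, π x ≠ x → (∃ y ∈ e.shared, x = ρ y) ∨ ∃ y ∈ e.shared, x ∈ (η y).vars := by
  have hfact := h.substArgs_fact (d := d) hc hσ₁
  set δ := e.solution η ρ c d l i k with hδ
  set Θ := σ₁.comp σ₂ with hΘdef
  have hδs : ∀ x, ¬ e.IsSolved ρ l i k x → δ x = .var x := fun x hx => solution_of_not_isSolved hx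
  have hE := fun τ => unify_iff (c := c) (d := d) (ts := ts) (τ := τ) he
    hc.l_ne_i hc.l_ne_k hc.i_ne_k (h.notMem_image hc.l_mem) (h.notMem_image hc.i_mem)
    (h.notMem_image hc.k_mem) (η := η)
  -- The two target mgus compose to a most general solution of both unifications together, from
  -- which `δ` can be eliminated.
  have hΘ := (isMGU_iff.1 hσ₁).join (τ := σ₂) (E' := fun τ =>
      substArgs τ [.int e.id, (varList e.shared).subst η, .ctx d] =
        substArgs τ [.int e.id, (varList e.shared).subst (renameBy ρ), .var (ρ (e.next + 2))])
    (fun σ τ h => by rw [substArgs_comp, substArgs_comp, h])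
    ((isMGU_iff.1 hσ₂).congr fun τ => by rw [substArgs_comp, substArgs_comp, hfact])
  rw [← hΘdef] at hΘ
  have hδΘ : δ.comp Θ = Θ := ((hE Θ).1 hΘ.1).1
  obtain ⟨π, σ, hσ, hπ, hσΘ⟩ := hΘ.exists_isMGU_rename (h.solution_comp_self hc) hE
    (fun x hx => solution_of_not_isSolved (h.mixed_args_vars hc he x hx))
    (fun x hx => solution_of_not_isSolved (h.not_isSolved_of_mem_V hc (hc.args x hx)))
  -- All other solved variables are bound to an integer or a list cell or list, so only the
  -- equations of shared variables can have been oriented the other way. Hence `π` moves only new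
  -- variables: those of the clause for shared variables and those of the registration.
  have hπ' : ∀ x, π x ≠ x → (∃ y ∈ e.shared, x = ρ y) ∨ ∃ y ∈ e.shared, x ∈ (η y).vars := by
    intro x hx
    obtain ⟨z, u, h1, h2, h3⟩ := hπ x hx
    have hz : e.IsSolved ρ l i k z := by
      by_contra hz
      exact h2 (solution_of_not_isSolved hz)
    rcases hz with rfl | rfl | rfl | ⟨y, rfl, hy⟩
    · simp only [solution, if_true, varList_subst_eq_list] at h1
      exact absurd h1 (Term.list_ne_var _ _)
    · simp [solution, hc.l_ne_i.symm] at h1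
    · simp [solution, hc.l_ne_k.symm, hc.i_ne_k.symm, Term.subst] at h1
    · rw [h.solution_rename hc (mem_clause_vars_of_isSolved hy)] at h1
      rcases hy with rfl | rfl | hy
      · rw [if_pos rfl] at h1
        exact absurd h1 (Term.list_ne_var _ _)
      · rw [if_neg (by omega), if_pos rfl] at h1
        exact absurd h1 (Term.list_ne_var _ _)
      · have := he.lt_of_mem_shared hy
        rw [if_neg (by omega), if_neg (by omega), mixed, if_pos hy] at h1
        rcases h3 with rfl | rfl
        · exact Or.inl ⟨y, hy, rfl⟩
        · exact Or.inr ⟨y, hy, by rw [h1]; simp [Term.vars]⟩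
  have hπV : ∀ x ∈ V, π x = x := by
    intro x hx
    by_contra hne
    rcases hπ' x hne with ⟨y, hy, rfl⟩ | ⟨y, hy, hxy⟩
    · exact (h.rename y (mem_clause_vars_of_isSolved (by simp [hy]))).1 hx
    · exact (h.shared y hy x hxy).1 hx
  have hπN : ∀ x ∈ N, π x = x := by
    intro x hx
    by_contra hne
    rcases hπ' x hne with ⟨y, hy, rfl⟩ | ⟨y, hy, hxy⟩
    · exact (h.rename y (mem_clause_vars_of_isSolved (by simp [hy]))).2 hx
    · exact (h.shared y hy x hxy).2.1 hx
  have hπJ : ∀ x ∈ e.clause.vars, e.next + 3 ≤ x → π (ρ x) = ρ x := by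
    intro x hx hx'
    by_contra hne
    rcases hπ' _ hne with ⟨y, hy, hxy⟩ | ⟨y, hy, hxy⟩
    · have := he.lt_of_mem_shared hy
      have := ρ.injective hxy
      omega
    · exact (h.shared y hy _ hxy).2.2 x hx rfl
  have hts : substArgs (renameBy π) ts = ts :=
    substArgs_eq_self fun x hx => by rw [renameBy_apply, hπV x (hc.args x hx)]
  rw [hts, ← substArgs_comp] at hσ
  have hnotMem : ∀ x, π x = x → x ∉ varsArgs (substArgs (e.mixed η ρ) e.args) →
      x ∉ varsArgs (substArgs ((e.mixed η ρ).comp (renameBy π)) e.args) := by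
    intro x hx hx' hm
    rw [substArgs_comp] at hm
    obtain ⟨z, hz, hm⟩ := mem_varsArgs_substArgs.1 hm
    rw [renameBy_apply, Term.vars, Finset.mem_singleton] at hm
    obtain rfl : x = z := π.injective (hx.trans hm)
    exact hx' hz
  have hΘctx : ∀ x, Θ x = (δ x).subst Θ := fun x => (congrFun hδΘ x).symm
  refine ⟨π, σ, ⟨hσ, fun x hx => ?_, fun x hx h1 h2 h3 => ?_, fun x hx hx' => ?_, ?_,
    fun x hx hx' => ?_⟩, ?_, hπ'⟩
  · rw [← hσΘ x (hδs x (h.not_isSolved_of_mem_V hc hx)), hπV x hx]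
  · rw [← hσΘ x (hδs x (h.not_isSolved_of_mem_N hx h1 h2 h3)), hπN x hx]
    exact hσ.apply_eq_var (hnotMem x (hπN x hx) (h.notMem_mixed_args_of_mem_N hx))
        (fun hx' => Set.disjoint_left.1 hc.disjoint (hc.args x hx') hx)
  · have := he.vars_lt x hx'
    conv_lhs => rw [← hδΘ]
    rw [Subst.comp, hδ, h.solution_rename hc hx, if_neg (by omega), if_neg (by omega), Subst.comp,
      ← Term.subst_comp]
    refine Term.subst_congr fun y hy => ?_
    rw [Subst.comp, renameBy_apply, Term.subst, hσΘ y (hδs y (h.mixed_vars hc he hx hx' hy))]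
  · rw [hΘctx, hδ, h.solution_rename hc (mem_clause_vars_of_isSolved (by simp)),
      if_pos rfl, Term.subst_ctx]
  · have hs : x ∉ e.shared := fun hs => by
      have := he.lt_of_mem_shared hs
      omega
    rw [← hσΘ _ (hδs _ (h.not_isSolved_rename hc hx (by omega) (by omega) hs)), hπJ x hx hx']
    exact hσ.apply_eq_var (hnotMem _ (hπJ x hx hx') (h.rename_notMem_mixed_args he hx hx'))
        (fun hx' => (h.rename x hx).1 (hc.args _ hx'))
  · rw [hΘctx, hδ, h.solution_rename hc (mem_clause_vars_of_isSolved (by simp)),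
      if_neg (by omega), if_pos rfl, Term.subst_ctx]

end HypEntry

end Resolution

-- Resolution steps with program rules

section Resolution

variable {F : Type u} {P : Type v} {K : Type w}

namespace Rule

/-- The translation of the body of a program rule with identifier `n`. -/
def tbody (R : Rule F P K) (n : ℕ) : TGoal F P K :=
  (R.body.translate (.var (freshVar R.vars)) (varsArgs R.args) (freshVar R.vars + 1) (n + 1)).goal

/-- The hypotheses of the embedded implications in a program rule with identifier `n`. -/
def entries (R : Rule F P K) (n : ℕ) : List (HypEntry F P K) :=
  R.body.entries (.var (freshVar R.vars)) (varsArgs R.args) (freshVar R.vars + 1) (n + 1)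

/-- The head of the translation of a program rule with identifier `n`. -/
def head (R : Rule F P K) (n : ℕ) : List (Term F) :=
  R.args ++ [.nil, .int n, .nil, .var (freshVar R.vars)]

/-- The translation of a program rule with identifier `n`. -/
def clause (R : Rule F P K) (n : ℕ) : TClause F P K :=
  .rule R.pred (R.head n) (R.tbody n)

theorem lt_freshVar {R : Rule F P K} {x : ℕ} (hx : x ∈ R.vars) : x < freshVar R.vars :=
  Nat.lt_succ_of_le (Finset.le_sup (f := id) hx)

theorem mem_clause_vars {R : Rule F P K} {n x : ℕ} : x ∈ (R.clause n).vars ↔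
    x ∈ varsArgs R.args ∨ x = freshVar R.vars ∨ x ∈ (R.tbody n).vars := by
  have : x ∈ varsArgs (R.head n) ↔ x ∈ varsArgs R.args ∨ x = freshVar R.vars := by
    simp only [Rule.head, mem_varsArgs, List.mem_append, List.mem_cons, List.not_mem_nil, or_false]
    constructor
    · rintro ⟨t, (ht | rfl | rfl | rfl | rfl), hx⟩
      · exact Or.inl ⟨t, ht, hx⟩
      all_goals simp [Term.vars] at hx
      exact Or.inr hx
    · rintro (⟨t, ht, hx⟩ | hx)
      · exact ⟨t, Or.inl ht, hx⟩
      · exact ⟨.var (freshVar R.vars), by simp, by simp [Term.vars, hx]⟩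
  simp only [Rule.clause, TClause.vars, Finset.mem_union, this, or_assoc]

variable {R : Rule F P K} {n : ℕ} {ρ : Equiv.Perm ℕ}
  {c : List ℤ} {l i k : ℕ} {V N : Set ℕ} {ts : List (Term F)}

/-- The solution for the variables of a translated rule and of the call that do not occur in the
source. -/
def solution (R : Rule F P K) (n : ℕ) (ρ : Equiv.Perm ℕ) (c : List ℤ) (l i k : ℕ) : Subst F :=
  fun z => if z = l then .nil else if z = i then .int n else if z = k then .nil
    else if z = ρ (freshVar R.vars) then .ctx c else .var z

theorem solution_eq_var {z : ℕ} (h1 : z ≠ l) (h2 : z ≠ i) (h3 : z ≠ k)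
    (h4 : z ≠ ρ (freshVar R.vars)) : R.solution n ρ c l i k z = .var z := by
  simp [solution, h1, h2, h3, h4]

/-- All values are ground. For the same reason no renaming is required when a target step with a
program rule is reflected. -/
theorem solution_comp_self : (R.solution n ρ c l i k).comp (R.solution n ρ c l i k) =
    R.solution n ρ c l i k := by
  refine Subst.comp_self_of_solved fun x y hy hx => ?_
  simp only [solution] at hy hx
  split_ifs at hy hx
  · simp [Term.vars] at hy
  · simp [Term.vars] at hy
  · simp [Term.vars] at hy
  · simp at hy
  · exact absurd rfl hx

theorem unify_iff (hc : HypEntry.IsCall V N l i k ts) (hs : ρ (freshVar R.vars) ∉ N)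
    {τ : Subst F} :
    substArgs τ (substArgs (renameBy ρ) (R.head n)) =
        substArgs τ (ts ++ [.var l, .var i, .var k, .ctx c]) ↔
    (R.solution n ρ c l i k).comp τ = τ ∧
      substArgs τ (substArgs (renameBy ρ) R.args) = substArgs τ ts := by
  have hl : ρ (freshVar R.vars) ≠ l := fun h => hs (h ▸ hc.l_mem)
  have hi : ρ (freshVar R.vars) ≠ i := fun h => hs (h ▸ hc.i_mem)
  have hk : ρ (freshVar R.vars) ≠ k := fun h => hs (h ▸ hc.k_mem)
  have hsol : (R.solution n ρ c l i k).comp τ = τ ↔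
      τ l = .nil ∧ τ i = .int n ∧ τ k = .nil ∧ τ (ρ (freshVar R.vars)) = .ctx c := by
    constructor
    · intro h
      refine ⟨?_, ?_, ?_, ?_⟩
      · rw [← h]; simp [Subst.comp, solution, Term.subst]
      · rw [← h]; simp [Subst.comp, solution, Term.subst, hc.l_ne_i.symm]
      · rw [← h]; simp [Subst.comp, solution, Term.subst, hc.l_ne_k.symm, hc.i_ne_k.symm]
      · rw [← h]; simp [Subst.comp, solution, hl, hi, hk]
    · rintro ⟨h1, h2, h3, h4⟩
      funext z
      simp only [Subst.comp, solution]
      split_ifs with hz hz hz hz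
      · rw [hz, h1]; rfl
      · rw [hz, h2]; rfl
      · rw [hz, h3]; rfl
      · rw [hz, h4, Term.subst_ctx]
      · rfl
  rw [hsol, Rule.head, substArgs_append, substArgs_eq_append_iff (by simp [substArgs])]
  simp only [substArgs, List.map_cons, List.map_nil, List.cons.injEq, and_true, Term.subst_ctx,
    Term.subst, renameBy_apply]
  grind

/-- The renaming `ρ` of a translated rule uses new variables for a call in which `V` and `N` occur. -/
def FreshFor (R : Rule F P K) (n : ℕ) (ρ : Equiv.Perm ℕ) (V N : Set ℕ) : Prop :=
  ∀ x ∈ (R.clause n).vars, ρ x ∉ V ∧ ρ x ∉ N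

theorem mem_clause_vars_of_mem_args {x : ℕ} (hx : x ∈ varsArgs R.args) :
    x ∈ (R.clause n).vars := mem_clause_vars.2 (Or.inl hx)

theorem FreshFor.solution_eq_var_of_mem_V (h : R.FreshFor n ρ V N)
    (hc : HypEntry.IsCall V N l i k ts) {x : ℕ}
    (hx : x ∈ V) : R.solution n ρ c l i k x = .var x := by
  have hV := Set.disjoint_left.1 hc.disjoint hx
  refine solution_eq_var ?_ ?_ ?_ ?_ <;> rintro rfl
  · exact hV hc.l_mem
  · exact hV hc.i_mem
  · exact hV hc.k_mem
  · exact (h _ (mem_clause_vars.2 (Or.inr (Or.inl rfl)))).1 hx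

theorem FreshFor.solution_eq_var_of_mem_clause_vars (h : R.FreshFor n ρ V N)
    (hc : HypEntry.IsCall V N l i k ts) {x : ℕ}
    (hx : x ∈ (R.clause n).vars) (hx' : x ≠ freshVar R.vars) :
    R.solution n ρ c l i k (ρ x) = .var (ρ x) := by
  have h0 := h x hx
  exact solution_eq_var (fun h' => h0.2 (h' ▸ hc.l_mem)) (fun h' => h0.2 (h' ▸ hc.i_mem))
    (fun h' => h0.2 (h' ▸ hc.k_mem)) (fun h' => hx' (ρ.injective h'))

theorem FreshFor.solution_eq_var_of_mem_args (h : R.FreshFor n ρ V N)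
    (hc : HypEntry.IsCall V N l i k ts) {x : ℕ}
    (hx : x ∈ varsArgs (substArgs (renameBy ρ : Subst F) R.args)) :
    R.solution n ρ c l i k x = .var x := by
  obtain ⟨z, hz, hm⟩ := mem_varsArgs_substArgs.1 hx
  rw [renameBy_apply, Term.vars, Finset.mem_singleton] at hm
  have := lt_freshVar (R := R) (Finset.mem_union_left _ hz)
  rw [hm]
  exact h.solution_eq_var_of_mem_clause_vars hc (mem_clause_vars_of_mem_args hz) (by omega)

theorem FreshFor.notMem_args (h : R.FreshFor n ρ V N) {x : ℕ} (hx : x ∈ N) :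
    x ∉ varsArgs (substArgs (renameBy ρ : Subst F) R.args) := by
  intro hm
  obtain ⟨z, hz, hm⟩ := mem_varsArgs_substArgs.1 hm
  rw [renameBy_apply, Term.vars, Finset.mem_singleton] at hm
  exact (h z (mem_clause_vars_of_mem_args hz)).2 (hm ▸ hx)

/-- If the unifier of a translated call with a translated rule is determined by a unifier of the call
with the rule, then the two steps correspond. -/
theorem FreshFor.isResolution (h : R.FreshFor n ρ V N) (hc : HypEntry.IsCall V N l i k ts)
    {σ Θ : Subst F} (hσ : IsMGU σ (substArgs (renameBy ρ) R.args) ts)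
    (hΘ : (R.solution n ρ c l i k).comp Θ = Θ)
    (hΘσ : ∀ x, R.solution n ρ c l i k x = .var x → Θ x = σ x) :
    IsResolution V N c l i k ts R.args (R.clause n).vars R.vars (freshVar R.vars + 1)
      (freshVar R.vars) ρ (renameBy ρ) σ Θ := by
  refine ⟨hσ, fun x hx => hΘσ x (h.solution_eq_var_of_mem_V hc hx), fun x hx h1 h2 h3 => ?_,
    fun x hx hx' => ?_, ?_, fun x hx hx' => ?_⟩
  · rw [hΘσ x (solution_eq_var h1 h2 h3 fun h' =>
      (h _ (mem_clause_vars.2 (Or.inr (Or.inl rfl)))).2 (h' ▸ hx))]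
    exact hσ.apply_eq_var (h.notMem_args hx)
      (fun hx' => Set.disjoint_left.1 hc.disjoint (hc.args x hx') hx)
  · have := lt_freshVar hx'
    exact hΘσ _ (h.solution_eq_var_of_mem_clause_vars hc hx (by omega))
  · have h0 := h (freshVar R.vars) (mem_clause_vars.2 (by simp))
    have hl : ρ (freshVar R.vars) ≠ l := fun h' => h0.2 (h' ▸ hc.l_mem)
    have hi : ρ (freshVar R.vars) ≠ i := fun h' => h0.2 (h' ▸ hc.i_mem)
    have hk : ρ (freshVar R.vars) ≠ k := fun h' => h0.2 (h' ▸ hc.k_mem)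
    rw [← hΘ, Subst.comp, solution, if_neg hl, if_neg hi, if_neg hk, if_pos rfl, Term.subst_ctx]
  · rw [hΘσ _ (h.solution_eq_var_of_mem_clause_vars hc hx (by omega))]
    refine hσ.apply_eq_var (fun hm => ?_) (fun hx' => (h x hx).1 (hc.args _ hx'))
    obtain ⟨z, hz, hm⟩ := mem_varsArgs_substArgs.1 hm
    rw [renameBy_apply, Term.vars, Finset.mem_singleton] at hm
    obtain rfl := ρ.injective hm
    have := lt_freshVar (R := R) (Finset.mem_union_left _ hz)
    omega

/-- A resolution step with a program rule is simulated with its translation. -/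
theorem FreshFor.exists_target_resolution (h : R.FreshFor n ρ V N)
    (hc : HypEntry.IsCall V N l i k ts) {σ : Subst F}
    (hσ : IsMGU σ (substArgs (renameBy ρ) R.args) ts) :
    ∃ Θ : Subst F,
      IsMGU Θ (substArgs (renameBy ρ) (R.head n)) (ts ++ [.var l, .var i, .var k, .ctx c]) ∧
      IsResolution V N c l i k ts R.args (R.clause n).vars R.vars (freshVar R.vars + 1)
        (freshVar R.vars) ρ (renameBy ρ) σ Θ := by
  have hs := (h _ (mem_clause_vars.2 (Or.inr (Or.inl rfl)))).2
  have hΘ := hσ.eliminate (solution_comp_self (n := n)) (fun τ => unify_iff (c := c) hc hs)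
    (fun x hx => h.solution_eq_var_of_mem_args hc hx)
    (fun x hx => h.solution_eq_var_of_mem_V hc (hc.args x hx))
  refine ⟨_, isMGU_iff.2 hΘ, h.isResolution hc hσ ?_ fun x hx => ?_⟩
  · rw [← Subst.comp_assoc, solution_comp_self]
  · rw [Subst.comp, hx]; rfl

/-- A resolution step with a translated program rule is simulated with the rule. -/
theorem FreshFor.exists_source_resolution (h : R.FreshFor n ρ V N)
    (hc : HypEntry.IsCall V N l i k ts) {Θ : Subst F}
    (hΘ : IsMGU Θ (substArgs (renameBy ρ) (R.head n)) (ts ++ [.var l, .var i, .var k, .ctx c])) :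
    ∃ σ : Subst F,
      IsResolution V N c l i k ts R.args (R.clause n).vars R.vars (freshVar R.vars + 1)
        (freshVar R.vars) ρ (renameBy ρ) σ Θ := by
  have hs := (h _ (mem_clause_vars.2 (Or.inr (Or.inl rfl)))).2
  have hE := fun τ => unify_iff (n := n) (c := c) hc hs (τ := τ)
  obtain ⟨π, σ, hσ, hπ, hσΘ⟩ := (isMGU_iff.1 hΘ).exists_isMGU_rename solution_comp_self hE
    (fun x hx => h.solution_eq_var_of_mem_args hc hx)
    (fun x hx => h.solution_eq_var_of_mem_V hc (hc.args x hx))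
  -- A moved variable would need a binding of the solution to a variable, and there is none.
  have hπ1 : π = 1 := by
    ext x
    by_contra hne
    obtain ⟨z, u, h1, h2, -⟩ := hπ x hne
    simp only [solution] at h1 h2
    split_ifs at h1 h2
    · exact Term.list_ne_var _ _ h1
    · exact h2 rfl
  subst hπ1
  have hid : (renameBy 1 : Subst F) = Subst.id := rfl
  rw [hid, substArgs_id, substArgs_id] at hσ
  exact ⟨σ, h.isResolution hc hσ ((hE Θ).1 hΘ.1).1 fun x hx => (hσΘ x hx).symm⟩

end Rule

end Resolution

-- Corresponding resolvents

section Simulation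

variable {F : Type u} {P : Type v} {K : Type w}

/-- `α` is inspected only on rule variables that occur in the translated clause. The source may
therefore use its own renaming for the locals of nested hypotheses. -/
theorem IsResolution.congr {V N : Set ℕ} {c : List ℤ} {l i k : ℕ} {ts args : List (Term F)}
    {D R : Finset ℕ} {v s : ℕ} {ρ : Equiv.Perm ℕ} {α α' σ Θ : Subst F}
    (h : IsResolution V N c l i k ts args D R v s ρ α σ Θ)
    (hargs : ∀ x ∈ varsArgs args, x ∈ D ∧ x ∈ R) (hα : ∀ x ∈ D, x ∈ R → α x = α' x) :
    IsResolution V N c l i k ts args D R v s ρ α' σ Θ := by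
  refine ⟨?_, h.visible, h.hidden, fun x hx hx' => ?_, h.context, h.junk⟩
  · rw [← substArgs_congr fun x hx => hα x (hargs x hx).1 (hargs x hx).2]
    exact h.mgu
  · rw [← hα x hx hx']
    exact h.clause x hx hx'

/-- The variables on which the resolvents agree. -/
def resolvedVars (V : Set ℕ) (D R : Finset ℕ) (α : Subst F) : Set ℕ :=
  {y | y ∈ V ∨ ∃ x ∈ D, x ∈ R ∧ y ∈ (α x).vars}

/-- The new variables that belong to one of the two resolvents only. -/
def hiddenVars (L D : Finset ℕ) (v : ℕ) (κ : ℕ → ℕ) (ρ : Equiv.Perm ℕ) : Set ℕ :=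
  {y | (∃ x ∈ L, y = κ x) ∨ ∃ x ∈ D, v ≤ x ∧ y = ρ x}

theorem IsResolution.supportedOn {V N : Set ℕ} {c : List ℤ} {l i k : ℕ} {ts args : List (Term F)}
    {D R : Finset ℕ} {v s : ℕ} {ρ : Equiv.Perm ℕ} {α σ Θ : Subst F}
    (h : IsResolution V N c l i k ts args D R v s ρ α σ Θ) (hts : ∀ x ∈ varsArgs ts, x ∈ V)
    (hargs : ∀ x ∈ varsArgs args, x ∈ D ∧ x ∈ R) : SupportedOn σ (resolvedVars V D R α) := by
  refine h.mgu.supportedOn.mono ?_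
  rintro x (hx | hx)
  · obtain ⟨y, hy, hx⟩ := mem_varsArgs_substArgs.1 hx
    exact Or.inr ⟨y, (hargs y hy).1, (hargs y hy).2, hx⟩
  · exact Or.inl (hts x hx)

/-- The resolvents of corresponding goals correspond. -/
theorem IsResolution.corresponds {T : Set (HypEntry F P K)} {V N : Set ℕ} {c : List ℤ}
    {l i k : ℕ} {ts args : List (Term F)} {D R : Finset ℕ} {v s : ℕ} {ρ : Equiv.Perm ℕ}
    {α σ Θ : Subst F} (h : IsResolution V N c l i k ts args D R v s ρ α σ Θ)
    (hc : HypEntry.IsCall V N l i k ts) {q : Goal F P K} {q' : TGoal F P K} {J : Set ℕ}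
    (hq : Corresponds T V N (.ctx c) q q' J) (hl : l ∉ J) (hi : i ∉ J) (hk : k ∉ J)
    (hargs : ∀ x ∈ varsArgs args, x ∈ D ∧ x ∈ R) {body : Goal F P K} {outer : Finset ℕ} {n : ℕ}
    (hD : ∀ x ∈ (body.translate (.var s) outer v n).goal.vars, x ∈ D)
    (hR : ∀ x ∈ body.vars, x ∈ R) (hRv : ∀ x ∈ R, x < v) (hs : s < v)
    (hT : ∀ e ∈ body.entries (.var s) outer v n, e ∈ T) {κ : ℕ → ℕ}
    (hα : ∀ x ∈ body.locals outer, α x = .var (κ x)) (hκ : Set.InjOn κ (body.locals outer))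
    (hVN : Disjoint (resolvedVars V D R α) (N ∪ hiddenVars (body.locals outer) D v κ ρ))
    (hN : Disjoint (hiddenVars (body.locals outer) D v κ ρ) N) :
    ∃ J', J' ⊆ hiddenVars (body.locals outer) D v κ ρ ∧
      Corresponds T (resolvedVars V D R α) (N ∪ hiddenVars (body.locals outer) D v κ ρ) (.ctx c)
        (((body.subst α).append q).subst σ)
        ((((body.translate (.var s) outer v n).goal.subst (renameBy ρ)).append q').subst Θ)
        (J' ∪ J) := by
  set V' := resolvedVars V D R α with hV'
  set N' := hiddenVars (body.locals outer) D v κ ρ with hN'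
  have hsupp := h.supportedOn hc.args hargs
  have hVN1 := Set.disjoint_union_right.1 hVN
  have hvis : ∀ x ∈ (body.translate (.var s) outer v n).goal.vars, x ∈ body.vars →
      ∀ y ∈ (α.comp σ x).vars, y ∈ V' := by
    intro x hx hx' y hy
    obtain ⟨z, hz, hy⟩ := Term.mem_vars_subst.1 hy
    exact hsupp.2 z (Or.inr ⟨x, hD x hx, hR x hx', hz⟩) y hy
  have hloc : ∀ x ∈ body.locals outer, α.comp σ x = .var (κ x) ∧ κ x ∈ N' := by
    intro x hx
    have hmem : κ x ∈ N' := Or.inl ⟨x, hx, rfl⟩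
    refine ⟨?_, hmem⟩
    rw [Subst.comp, hα x hx]
    exact hsupp.1 _ fun h => Set.disjoint_left.1 hVN1.2 h hmem
  -- The body is instantiated by `ασ` in the source and by `ρΘ` in the target. Locals are named by
  -- `κ`, and the new variables of the translation by `ρ` itself.
  obtain ⟨J', hJ', hJs⟩ := Goal.corresponds_translate (T := T) (V := V') (N := N') (τ := α.comp σ)
    (τ' := (renameBy ρ).comp Θ) (κ := κ) (ι := ρ) body (.var s) outer v n
    (fun x hx => hRv x (hR x hx)) (fun x hx => by
      rw [Term.vars, Finset.mem_singleton] at hx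
      omega) hT (fun x hx hx' => ⟨h.clause x (hD x hx) (hR x hx'), hvis x hx hx'⟩)
    hloc hκ (fun x hx hx' => ⟨h.junk x (hD x hx) hx', Or.inr ⟨x, hD x hx, hx', rfl⟩⟩)
    ρ.injective.injOn
  have hJN : J' ⊆ N' := fun x hx => by
    obtain ⟨y, ⟨hy, hy', -⟩, rfl⟩ := hJs hx
    exact Or.inr ⟨y, hD y hy, hy', rfl⟩
  refine ⟨J', hJN, ?_⟩
  have hctx : (Term.var s).subst ((renameBy ρ).comp Θ) = .ctx c := h.context
  rw [hctx, Goal.subst_comp, TGoal.subst_comp] at hJ'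
  rw [Goal.subst_append, TGoal.subst_append]
  refine (hJ'.mono Set.subset_union_right).append ?_ ?_
  · have := hq.subst hsupp (fun x hx => Or.inl hx) hVN1.1 h.visible (fun x hx =>
      h.hidden x (hq.subset hx) (fun h => hl (h ▸ hx)) (fun h => hi (h ▸ hx))
        (fun h => hk (h ▸ hx)))
    rw [Term.subst_ctx] at this
    exact this.mono Set.subset_union_left
  · exact Set.disjoint_of_subset hJN hq.subset hN

/-! ### Programs -/

/-- `target` is the translation of the program `prog`, in which the hypotheses are those in `T`. -/
structure IsCompiled (prog : Set (Rule F P K)) (T : Set (HypEntry F P K))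
    (target : Set (TClause F P K)) : Prop where
  clause : ∀ C ∈ target, (∃ R ∈ prog, ∃ n, C = R.clause n ∧ ∀ e ∈ R.entries n, e ∈ T) ∨
    ∃ e ∈ T, C = e.clause
  rule : ∀ R ∈ prog, ∃ n, R.clause n ∈ target ∧ ∀ e ∈ R.entries n, e ∈ T
  hyp : ∀ e ∈ T, e.clause ∈ target
  wellFormed : ∀ e ∈ T, e.WellFormed T
  id_inj : ∀ e ∈ T, ∀ e' ∈ T, e.id = e'.id → e = e'

/-- `R` is a variant of the instance of a hypothesis that is described by `reg(i, X, _)`. -/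
def Registers (T : Set (HypEntry F P K)) (R : Rule F P K) (i : ℕ) (X : Term F) : Prop :=
  ∃ V N, Disjoint V N ∧ IsHypInstance T V N R i X

/-- The hypothetical program `prog` corresponds to the translated program `target'` in the context
`c`: the assumed hypotheses are those that are registered for a prefix of `c`. -/
structure ProgramInv (prog₀ : Set (Rule F P K)) (T : Set (HypEntry F P K))
    (target : Set (TClause F P K)) (prog : Set (Rule F P K)) (target' : Set (TClause F P K))
    (c : List ℤ) (ids : Finset ℤ) : Prop where
  base : prog₀ ⊆ prog
  base' : target ⊆ target'
  hyp : ∀ R ∈ prog, R ∈ prog₀ ∨ ∃ i X d, d <:+ c ∧ .regFact (.int (i : ℕ)) X (.ctx d) ∈ target' ∧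
    Registers T R i X
  clause : ∀ C ∈ target', C ∈ target ∨ ∃ (i : ℕ) (X : Term F) (j : ℤ) (s : List ℤ),
    C = .regFact (.int i) X (.ctx (j :: s)) ∧ j ∈ ids ∧
      ∃ R, Registers T R i X ∧ (j :: s <:+ c → R ∈ prog)

/-- The facts in `A` were asserted inside implications that are already solved. Their contexts are
strictly longer than `c`, so they fail the prefix test and add no hypothesis. -/
theorem ProgramInv.union {prog₀ prog : Set (Rule F P K)} {T : Set (HypEntry F P K)}
    {target target' A : Set (TClause F P K)} {c : List ℤ} {ids ids' : Finset ℤ}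
    (h : ProgramInv prog₀ T target prog target' c ids) (hids : ids ⊆ ids')
    (hA : ∀ C ∈ A, ∃ (i : ℕ) (X : Term F) (j : ℤ) (s : List ℤ),
      C = .regFact (.int i) X (.ctx (j :: s)) ∧ c <:+ s ∧ j ∈ ids' ∧ ∃ R, Registers T R i X) :
    ProgramInv prog₀ T target prog (target' ∪ A) c ids' := by
  refine ⟨h.base, h.base'.trans Set.subset_union_left, fun R hR => ?_, fun C hC => ?_⟩
  · rcases h.hyp R hR with h1 | ⟨i, X, d, h1, h2, h3⟩
    · exact Or.inl h1
    · exact Or.inr ⟨i, X, d, h1, Or.inl h2, h3⟩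
  · rcases hC with hC | hC
    · rcases h.clause C hC with h1 | ⟨i, X, j, s, h1, h2, h3⟩
      · exact Or.inl h1
      · exact Or.inr ⟨i, X, j, s, h1, hids h2, h3⟩
    · obtain ⟨i, X, j, s, h1, h2, h3, R, h4⟩ := hA C hC
      refine Or.inr ⟨i, X, j, s, h1, h3, R, h4, fun h5 => ?_⟩
      -- `j :: s` cannot be a suffix of `c` if `c` is one of `s`.
      have := h2.length_le
      have := h5.length_le
      simp only [List.length_cons] at this
      omega

/-- Because `z` has not been used, no older registration has the context `z :: c`; every older one
that is visible from `z :: c` was already visible from `c`. -/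
theorem ProgramInv.assume {prog₀ prog : Set (Rule F P K)} {T : Set (HypEntry F P K)}
    {target target' : Set (TClause F P K)} {c : List ℤ} {ids : Finset ℤ}
    (h : ProgramInv prog₀ T target prog target' c ids) {z : ℤ} (hz : z ∉ ids) {R : Rule F P K}
    {i : ℕ} {X : Term F} (hR : Registers T R i X) :
    ProgramInv prog₀ T target (prog ∪ {R})
      (target' ∪ {.regFact (.int i) X (.ctx (z :: c))}) (z :: c) (insert z ids) := by
  refine ⟨h.base.trans Set.subset_union_left, h.base'.trans Set.subset_union_left,
    fun R' hR' => ?_, fun C hC => ?_⟩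
  · rcases hR' with hR' | hR'
    · rcases h.hyp R' hR' with h1 | ⟨i, X, d, h1, h2, h3⟩
      · exact Or.inl h1
      · exact Or.inr ⟨i, X, d, h1.trans (List.suffix_cons z c), Or.inl h2, h3⟩
    · rw [Set.mem_singleton_iff] at hR'
      rw [hR']
      exact Or.inr ⟨i, X, z :: c, List.suffix_rfl, Or.inr rfl, hR⟩
  · rcases hC with hC | hC
    · rcases h.clause C hC with h1 | ⟨i, X, j, s, h1, h2, R', h3, h4⟩
      · exact Or.inl h1
      · refine Or.inr ⟨i, X, j, s, h1, Finset.mem_insert_of_mem h2, R', h3, fun h5 => ?_⟩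
        rcases List.suffix_cons_iff.1 h5 with h5 | h5
        · rw [List.cons.injEq] at h5
          exact absurd (h5.1 ▸ h2) hz
        · exact Or.inl (h4 h5)
    · rw [Set.mem_singleton_iff] at hC
      exact Or.inr ⟨i, X, z, c, hC, Finset.mem_insert_self _ _, R, hR, fun _ => Or.inr rfl⟩

/-! ### Corresponding computations -/

/-- Relation between the substitutions `σ` and `σ'` of corresponding computations from goals that
agree on the variables in `V`, with the private variables `N`, among them those in `J` that occur in the
target. `V'` are the visible variables at the end, and `A` are the facts that are asserted. -/
structure Outcome (T : Set (HypEntry F P K)) (target : Set (TClause F P K)) (V N J : Set ℕ)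
    (c : List ℤ) (used used' : Finset ℕ) (ids : Finset ℤ) (σ σ' : Subst F) (V' : Set ℕ)
    (used₁ used₁' : Finset ℕ) (ids₁ : Finset ℤ) (A : Set (TClause F P K)) : Prop where
  subset : V ⊆ V'
  bounded : ∀ x ∈ V', x ∈ used₁ ∨ x ∈ used₁'
  disjoint : Disjoint V' N
  supported : SupportedOn σ V'
  agree : ∀ x ∈ V, σ' x = σ x
  hidden : ∀ x ∈ N, x ∉ J → σ' x = .var x
  used_subset : used ⊆ used₁
  used_subset' : used' ⊆ used₁'
  ids_subset : ids ⊆ ids₁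
  facts : ∀ C ∈ A, ∃ (i : ℕ) (X : Term F) (j : ℤ) (s : List ℤ),
    C = .regFact (.int i) X (.ctx (j :: s)) ∧ c <:+ s ∧ j ∈ ids₁ ∧ ∃ R, Registers T R i X
  registrations : ∀ C ∈ A, IsRegistration target C

variable {T : Set (HypEntry F P K)} {target : Set (TClause F P K)} {V N J : Set ℕ}
  {c : List ℤ} {used used' : Finset ℕ} {ids : Finset ℤ} {σ σ' : Subst F}

theorem Outcome.refl (hV : ∀ x ∈ V, x ∈ used ∨ x ∈ used') (hVN : Disjoint V N) :
    Outcome T target V N J c used used' ids Subst.id Subst.id V used used' ids ∅ :=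
  ⟨subset_rfl, hV, hVN, supportedOn_id _, fun _ _ => rfl, fun _ _ _ => rfl, subset_rfl, subset_rfl,
    subset_rfl, by simp, by simp⟩

/-- The second computation may run in a longer context `c₁`, as the goal of an implication does.
Agreement carries over because `σ` maps visible variables to terms over the visible variables `V₁`
of the second computation. -/
theorem Outcome.comp {V₁ V₂ N₁ J₁ : Set ℕ} {c₁ : List ℤ} {used₁ used₁' used₂ used₂' : Finset ℕ}
    {ids₁ ids₂ : Finset ℤ} {τ τ' : Subst F} {A A₁ : Set (TClause F P K)}
    (h : Outcome T target V N J c used used' ids σ σ' V₁ used₁ used₁' ids₁ A)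
    (h₁ : Outcome T target V₁ N₁ J₁ c₁ used₁ used₁' ids₁ τ τ' V₂ used₂ used₂' ids₂ A₁)
    (hN : N ⊆ N₁) (hJ : ∀ x ∈ N, x ∉ J → x ∉ J₁) (hc : c <:+ c₁) :
    Outcome T target V N J c used used' ids (σ.comp τ) (σ'.comp τ') V₂ used₂ used₂' ids₂
      (A ∪ A₁) := by
  refine ⟨h.subset.trans h₁.subset, h₁.bounded, h₁.disjoint.mono_right hN,
    (h.supported.mono h₁.subset).comp h₁.supported, fun x hx => ?_, fun x hx hx' => ?_,
    h.used_subset.trans h₁.used_subset, h.used_subset'.trans h₁.used_subset',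
    h.ids_subset.trans h₁.ids_subset, ?_, ?_⟩
  · rw [Subst.comp, Subst.comp, h.agree x hx]
    exact Term.subst_congr fun y hy => h₁.agree y (h.supported.2 x (h.subset hx) y hy)
  · rw [Subst.comp, h.hidden x hx hx', Term.subst, h₁.hidden x (hN hx) (hJ x hx hx')]
  · rintro C (hC | hC)
    · obtain ⟨i, X, j, s, h1, h2, h3, h4⟩ := h.facts C hC
      exact ⟨i, X, j, s, h1, h2, h₁.ids_subset h3, h4⟩
    · obtain ⟨i, X, j, s, h1, h2, h3, h4⟩ := h₁.facts C hC
      exact ⟨i, X, j, s, h1, hc.trans h2, h3, h4⟩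
  · rintro C (hC | hC)
    · exact h.registrations C hC
    · exact h₁.registrations C hC

theorem SSteps.trans {B : K → Set (List (Term F))} {s t u : SState F P K}
    {A A' : Set (TClause F P K)} (h : SSteps B s A t) (h' : SSteps B t A' u) :
    SSteps B s (A ∪ A') u := by
  induction h with
  | refl s => simpa using h'
  | head hst _ ih =>
    rw [Set.union_assoc]
    exact .head hst (ih h')

theorem SSteps.head_of_asserted_eq_empty {B : K → Set (List (Term F))} {s t u : SState F P K}
    {A : Set (TClause F P K)} (hst : SStep B s t) (h : SSteps B t A u) (hs : s.asserted = ∅) :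
    SSteps B s A u := by
  have := SSteps.head hst h
  rwa [hs, Set.empty_union] at this

theorem IsHypInstance.registers {R : Rule F P K} {i : ℕ} {X : Term F}
    (h : IsHypInstance T V N R i X) (hVN : Disjoint V N) : Registers T R i X :=
  ⟨V, N, hVN, h⟩

theorem IsHypInstance.isRegistration {prog : Set (Rule F P K)} {R : Rule F P K} {i : ℕ}
    {X : Term F} (h : IsHypInstance T V N R i X) (hT : IsCompiled prog T target) (z : ℤ) :
    IsRegistration target (.regFact (.int i) X (.ctx (z :: c))) := by
  obtain ⟨e, he, η, κ, -, -, rfl, rfl⟩ := h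
  refine ⟨e.id, _, z, c, by rw [varList_subst_eq_list], e.pred, e.args, _, _, _, _, _, hT.hyp e he⟩

/-- Binding a variable to an integer leaves no freedom in the mgu, so a `get_ci` step is determined
by the integer returned. -/
theorem IsMGU.single_int {μ : Subst F} {x : ℕ} {z : ℤ} (h : IsMGU μ [.var x] [.int z]) :
    μ = Function.update Term.var x (.int z) := by
  have hx : μ x = .int z := by
    have := h.unifies
    simpa [substArgs, Term.subst] using this
  funext y
  by_cases hy : y = x
  · rw [hy, hx, Function.update_self]
  · rw [Function.update_of_ne hy]
    exact h.apply_eq_var (by simpa [Term.vars] using hy) (by simp [Term.vars])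

theorem isMGU_single_int (x : ℕ) (z : ℤ) :
    IsMGU (Function.update (Term.var : Subst F) x (.int z)) [.var x] [.int z] :=
  isMGU_iff.2 ((isPrincipal_eliminate (x := x) (t := .int z) (by simp [Term.vars])).congr fun τ => by
    simp [substArgs, Term.subst])

end Simulation

-- Steps between corresponding states

section Linked

variable {F : Type u} {P : Type v} {K : Type w}

/-- Corresponding states of the two languages. -/
structure Linked (prog₀ : Set (Rule F P K)) (T : Set (HypEntry F P K)) (target : Set (TClause F P K))
    (V N J : Set ℕ) (c : List ℤ) (used used' : Finset ℕ) (ids : Finset ℤ) (prog : Set (Rule F P K))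
    (target' : Set (TClause F P K)) (G : Goal F P K) (G' : TGoal F P K) : Prop where
  disjoint : Disjoint V N
  bounded : ∀ x, x ∈ V ∨ x ∈ N → x ∈ used ∨ x ∈ used'
  corresponds : Corresponds T V N (.ctx c) G G' J
  program : ProgramInv prog₀ T target prog target' c ids

variable {prog₀ prog : Set (Rule F P K)} {T : Set (HypEntry F P K)}
  {target target' : Set (TClause F P K)} {V N J : Set ℕ} {c : List ℤ}
  {used used' used₁ used₁' : Finset ℕ} {ids : Finset ℤ}

/-- The states after corresponding resolution steps for a user predicate correspond. -/
theorem IsResolution.exists_linked {l i k : ℕ} {ts args : List (Term F)} {D R : Finset ℕ} {v s : ℕ}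
    {ρ ρ' : Equiv.Perm ℕ} {η σ Θ : Subst F}
    (h : IsResolution V N c l i k ts args D R v s ρ (η.comp (renameBy ρ')) σ Θ)
    (hc : HypEntry.IsCall V N l i k ts) {q : Goal F P K} {q' : TGoal F P K}
    (hq : Corresponds T V N (.ctx c) q q' J) (hl : l ∉ J) (hi : i ∉ J) (hk : k ∉ J)
    (hb : ∀ x, x ∈ V ∨ x ∈ N → x ∈ used ∨ x ∈ used')
    (hP : ProgramInv prog₀ T target prog target' c ids) {body : Goal F P K} {outer : Finset ℕ}
    {n : ℕ} (hR : R = varsArgs args ∪ body.vars) (hargs : ∀ x ∈ varsArgs args, x ∈ D)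
    (hD : ∀ x ∈ (body.translate (.var s) outer v n).goal.vars, x ∈ D)
    (hRv : ∀ x ∈ R, x < v) (hs : s < v) (hT : ∀ e ∈ body.entries (.var s) outer v n, e ∈ T)
    {κ : ℕ → ℕ} (hη : ∀ x ∈ body.locals outer, η x = .var (κ x))
    (hκ : Set.InjOn κ (body.locals outer))
    (hsep : ∀ x ∈ D, x ∈ R → ∀ z ∈ body.locals outer, κ z ∉ (η x).vars)
    (hfresh : ∀ x ∈ D, v ≤ x → ρ x ∉ V ∧ ρ x ∉ N)
    (hfresh' : ∀ x ∈ R, ∀ y ∈ (η x).vars, ρ' y ∉ V ∧ ρ' y ∉ N ∧ ∀ z ∈ D, v ≤ z → ρ' y ≠ ρ z)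
    (hused : used ⊆ used₁) (hused' : used' ⊆ used₁')
    (hmem : ∀ x ∈ R, ∀ y ∈ (η x).vars, ρ' y ∈ used₁)
    (hmem' : ∀ x ∈ D, ρ x ∈ used₁') :
    ∃ V₁ N₁ J₁, Outcome T target V N ({l, i, k} ∪ J) c used used' ids σ Θ V₁ used₁ used₁' ids ∅ ∧
      N ⊆ N₁ ∧ (∀ x ∈ N, x ∉ {l, i, k} ∪ J → x ∉ J₁) ∧
      Linked prog₀ T target V₁ N₁ J₁ c used₁ used₁' ids prog target'
        (((body.subst (η.comp (renameBy ρ'))).append q).subst σ)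
        ((((body.translate (.var s) outer v n).goal.subst (renameBy ρ)).append q').subst Θ) := by
  have hVN := Set.disjoint_left.1 hc.disjoint
  have hargs' : ∀ x ∈ varsArgs args, x ∈ D ∧ x ∈ R := fun x hx =>
    ⟨hargs x hx, hR ▸ Finset.mem_union_left _ hx⟩
  have hbody : ∀ x ∈ body.vars, x ∈ R := fun x hx => hR ▸ Finset.mem_union_right _ hx
  have hloc : ∀ x ∈ body.locals outer, x ∈ R ∧ κ x ∈ (η x).vars := fun x hx =>
    ⟨hbody x (Goal.locals_subset hx).1, by rw [hη x hx]; simp [Term.vars]⟩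
  have hα : ∀ {x y : ℕ}, y ∈ (η.comp (renameBy ρ') x).vars → ∃ z ∈ (η x).vars, y = ρ' z := by
    intro x y hy
    obtain ⟨z, hz, hy⟩ := Term.mem_vars_renameBy.1 hy
    exact ⟨z, hz, by first | exact hy | exact hy.symm⟩
  have hN' : ∀ y ∈ hiddenVars (body.locals outer) D v (fun x => ρ' (κ x)) ρ,
      y ∉ V ∧ y ∉ N ∧ (y ∈ used₁ ∨ y ∈ used₁') := by
    rintro y (⟨x, hx, rfl⟩ | ⟨x, hx, hx', rfl⟩)
    · obtain ⟨h1, h2⟩ := hloc x hx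
      have := hfresh' x h1 _ h2
      exact ⟨this.1, this.2.1, Or.inl (hmem x h1 _ h2)⟩
    · exact ⟨(hfresh x hx hx').1, (hfresh x hx hx').2, Or.inr (hmem' x hx)⟩
  have hV' : ∀ y ∈ resolvedVars V D R (η.comp (renameBy ρ')), y ∉ N ∧
      y ∉ hiddenVars (body.locals outer) D v (fun x => ρ' (κ x)) ρ ∧ (y ∈ used₁ ∨ y ∈ used₁') := by
    rintro y (hy | ⟨x, hx, hxR, hy⟩)
    · exact ⟨hVN hy, fun hy' => (hN' y hy').1 hy, (hb y (Or.inl hy)).imp (@hused y) (@hused' y)⟩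
    · obtain ⟨z, hz, rfl⟩ := hα hy
      have := hfresh' x hxR z hz
      refine ⟨this.2.1, ?_, Or.inl (hmem x hxR z hz)⟩
      -- `hsep` keeps the renamed locals of nested hypotheses out of the visible terms, and
      -- `hfresh'` does so for the new variables of the translated body.
      rintro (⟨w, hw, hw'⟩ | ⟨w, hw, hw', hw''⟩)
      · exact hsep x hx hxR w hw (ρ'.injective hw' ▸ hz)
      · exact this.2.2 w hw hw' hw''
  have hVN₁ : Disjoint (resolvedVars V D R (η.comp (renameBy ρ')))
      (N ∪ hiddenVars (body.locals outer) D v (fun x => ρ' (κ x)) ρ) :=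
    Set.disjoint_left.2 fun y hy hy' => hy'.elim (hV' y hy).1 (hV' y hy).2.1
  obtain ⟨J', hJ', hcor⟩ := h.corresponds hc hq hl hi hk hargs' hD hbody hRv hs hT
    (κ := fun x => ρ' (κ x)) (fun x hx => by rw [Subst.comp, hη x hx]; rfl)
    (fun x hx y hy hxy => hκ hx hy (ρ'.injective hxy)) hVN₁
    (Set.disjoint_left.2 fun y hy => (hN' y hy).2.1)
  refine ⟨_, _, _, ⟨fun x hx => Or.inl hx, fun y hy => (hV' y hy).2.2,
    (Set.disjoint_union_right.1 hVN₁).1, h.supportedOn hc.args hargs', h.visible, fun x hx hx' => ?_,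
    hused, hused', subset_rfl, by simp, by simp⟩, Set.subset_union_left, fun x hx hx' => ?_,
    hVN₁, ?_, hcor, hP⟩
  · simp only [Set.mem_union, Set.mem_insert_iff, Set.mem_singleton_iff, not_or] at hx'
    exact h.hidden x hx hx'.1.1 hx'.1.2.1 hx'.1.2.2
  · rintro (hx'' | hx'')
    · exact (hN' x (hJ' hx'')).2.1 hx
    · exact hx' (Or.inr hx'')
  · rintro y (hy | hy | hy)
    · exact (hV' y hy).2.2
    · exact (hb y (Or.inr hy)).imp (@hused y) (@hused' y)
    · exact (hN' y hy).2.2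

theorem IsResolution.mono {l i k : ℕ} {ts args : List (Term F)} {D D' R : Finset ℕ} {v s : ℕ}
    {ρ : Equiv.Perm ℕ} {α σ Θ : Subst F}
    (h : IsResolution V N c l i k ts args D R v s ρ α σ Θ) (hD : D' ⊆ D) :
    IsResolution V N c l i k ts args D' R v s ρ α σ Θ :=
  ⟨h.mgu, h.visible, h.hidden, fun x hx => h.clause x (hD hx), h.context, fun x hx => h.junk x (hD hx)⟩

/-- Supplies the separation of visible and private variables for a program rule: locals of nested
hypotheses do not reach its translation. -/
theorem Rule.notMem_clause_vars_of_mem_locals {R : Rule F P K} {n x : ℕ}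
    (hx : x ∈ R.body.locals (varsArgs R.args)) : x ∉ (R.clause n).vars := by
  have h1 := Goal.locals_subset hx
  have h2 := Rule.lt_freshVar (R := R) (Finset.mem_union_right _ h1.1)
  rw [Rule.mem_clause_vars]
  rintro (h | h | h)
  · exact h1.2 h
  · omega
  · rcases Goal.translate_vars _ _ _ _ _ _ h with h | h | h
    · rw [Term.vars, Finset.mem_singleton] at h
      omega
    · omega
    · exact h.2 hx

/-- The states after corresponding resolution steps with a program rule correspond. -/
theorem Rule.exists_linked {R : Rule F P K} {n l i k : ℕ} {ts : List (Term F)}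
    {ρ ρ' : Equiv.Perm ℕ} {σ Θ : Subst F}
    (h : IsResolution V N c l i k ts R.args (R.clause n).vars R.vars (freshVar R.vars + 1)
      (freshVar R.vars) ρ (renameBy ρ') σ Θ)
    (hc : HypEntry.IsCall V N l i k ts) {q : Goal F P K} {q' : TGoal F P K}
    (hq : Corresponds T V N (.ctx c) q q' J) (hl : l ∉ J) (hi : i ∉ J) (hk : k ∉ J)
    (hb : ∀ x, x ∈ V ∨ x ∈ N → x ∈ used ∨ x ∈ used')
    (hP : ProgramInv prog₀ T target prog target' c ids) (hT : ∀ e ∈ R.entries n, e ∈ T)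
    (hfresh : ∀ x ∈ (R.clause n).vars, ρ x ∉ V ∧ ρ x ∉ N)
    (hfresh' : ∀ x ∈ R.vars, ρ' x ∉ V ∧ ρ' x ∉ N ∧
      ∀ z ∈ (R.clause n).vars, z ∉ R.vars → ρ' x ≠ ρ z) :
    ∃ V₁ N₁ J₁, Outcome T target V N ({l, i, k} ∪ J) c used used' ids σ Θ V₁
        (used ∪ (R.subst (renameBy ρ')).vars)
        (used' ∪ ((R.clause n).subst (renameBy ρ)).vars) ids ∅ ∧
      N ⊆ N₁ ∧ (∀ x ∈ N, x ∉ {l, i, k} ∪ J → x ∉ J₁) ∧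
      Linked prog₀ T target V₁ N₁ J₁ c (used ∪ (R.subst (renameBy ρ')).vars)
        (used' ∪ ((R.clause n).subst (renameBy ρ)).vars) ids prog target'
        (((R.body.subst (renameBy ρ')).append q).subst σ)
        ((((R.tbody n).subst (renameBy ρ)).append q').subst Θ) := by
  have hid : (renameBy ρ' : Subst F) = Subst.id.comp (renameBy ρ') := (Subst.id_comp _).symm
  have hx : ∀ {x y : ℕ}, y ∈ ((Subst.id : Subst F) x).vars → y = x := fun h => by
    simpa [Subst.id, Term.vars] using h
  rw [hid] at h ⊢
  refine h.exists_linked hc hq hl hi hk hb hP rfl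
    (fun x hx => Rule.mem_clause_vars.2 (Or.inl hx))
    (fun x hx => Rule.mem_clause_vars.2 (Or.inr (Or.inr hx)))
    (fun x hx => (Rule.lt_freshVar hx).trans (Nat.lt_succ_self _)) (Nat.lt_succ_self _) hT
    (κ := fun x => x) (fun x _ => rfl) (fun _ _ _ _ h => h) (fun x hD hR z hz hzx => ?_)
    (fun x hx _ => hfresh x hx) (fun x hR y hy => ?_) Finset.subset_union_left
    Finset.subset_union_left (fun x hR y hy => ?_) (fun x hD => ?_)
  · obtain rfl := hx hzx
    exact Rule.notMem_clause_vars_of_mem_locals hz hD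
  · obtain rfl := hx hy
    refine ⟨(hfresh' y hR).1, (hfresh' y hR).2.1, fun z hz hz' => (hfresh' y hR).2.2 z hz fun h => ?_⟩
    have := Rule.lt_freshVar h
    omega
  · obtain rfl := hx hy
    rw [← hid]
    exact Finset.mem_union_right _ (Rule.mem_vars_renameBy.2 ⟨y, hR, rfl⟩)
  · exact Finset.mem_union_right _ (TClause.mem_vars_renameBy.2 ⟨x, hD, rfl⟩)

namespace HypEntry

/-- The states after corresponding resolution steps with a hypothesis correspond. -/
theorem exists_linked {e : HypEntry F P K} {l i k : ℕ} {ts : List (Term F)}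
    {ρ ρ' : Equiv.Perm ℕ} {η σ Θ : Subst F} {κ : ℕ → ℕ} {V₀ N₀ : Set ℕ}
    (h : IsResolution V N c l i k ts e.args e.clause.vars e.vars (e.next + 3) (e.next + 1) ρ
      (η.comp (renameBy ρ')) σ Θ)
    (hc : IsCall V N l i k ts) {q : Goal F P K} {q' : TGoal F P K}
    (hq : Corresponds T V N (.ctx c) q q' J) (hl : l ∉ J) (hi : i ∉ J) (hk : k ∉ J)
    (hb : ∀ x, x ∈ V ∨ x ∈ N → x ∈ used ∨ x ∈ used')
    (hP : ProgramInv prog₀ T target prog target' c ids) (he : e.WellFormed T)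
    (hη : e.IsInstance η κ V₀ N₀) (hVN : Disjoint V₀ N₀)
    (hfresh : ∀ x ∈ e.clause.vars, ρ x ∉ V ∧ ρ x ∉ N)
    (hfresh' : ∀ x ∈ e.vars, ∀ y ∈ (η x).vars, ρ' y ∉ V ∧ ρ' y ∉ N ∧
      ∀ z ∈ e.clause.vars, z ∉ e.vars → ρ' y ≠ ρ z)
    (hused : used ⊆ used₁) (hused' : used' ⊆ used₁')
    (hmem : ∀ x ∈ e.vars, ∀ y ∈ (η x).vars, ρ' y ∈ used₁)
    (hmem' : ∀ x ∈ e.clause.vars, ρ x ∈ used₁') :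
    ∃ V₁ N₁ J₁, Outcome T target V N ({l, i, k} ∪ J) c used used' ids σ Θ V₁ used₁ used₁' ids ∅ ∧
      N ⊆ N₁ ∧ (∀ x ∈ N, x ∉ {l, i, k} ∪ J → x ∉ J₁) ∧
      Linked prog₀ T target V₁ N₁ J₁ c used₁ used₁' ids prog target'
        (((e.body.subst (η.comp (renameBy ρ'))).append q).subst σ)
        (((e.tbody.subst (renameBy ρ)).append q').subst Θ) := by
  have hloc : ∀ x ∈ e.body.locals (e.outer ∪ varsArgs e.args), x ∈ e.vars ∧ x ∉ e.outer ∧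
      x ∉ varsArgs e.args := fun x hx => by
    have := Goal.locals_subset hx
    rw [Finset.mem_union, not_or] at this
    exact ⟨Finset.mem_union_right _ this.1, this.2⟩
  -- Well-formedness does not bound the variables of `e.ctx`, so nothing prevents it from containing
  -- a nested local. Such variables are removed from the clause variables to be compared; the
  -- arguments and the translated body do not need them.
  have h' := h.mono (Finset.filter_subset
    (fun x => x ∉ e.body.locals (e.outer ∪ varsArgs e.args)) e.clause.vars)
  refine h'.exists_linked hc hq hl hi hk hb hP rfl (fun x hx => ?_) (fun x hx => ?_)
    (fun x hx => ?_) (by omega) he.entries_mem (κ := κ)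
    (fun x hx => (hη.rename x (hloc x hx).1 (hloc x hx).2.1).1) ?_
    (fun x hx hx' z hz hz' => ?_) (fun x hx _ => hfresh x (Finset.mem_filter.1 hx).1)
    (fun x hx y hy => ?_) hused hused' hmem (fun x hx => hmem' x (Finset.mem_filter.1 hx).1)
  · exact Finset.mem_filter.2 ⟨mem_clause_vars.2 (Or.inl hx), fun h => (hloc x h).2.2 hx⟩
  · refine Finset.mem_filter.2 ⟨mem_clause_vars.2 (by simp only [HypEntry.tbody, hx, or_true]), ?_⟩
    intro hx'
    have := he.vars_lt x (hloc x hx').1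
    rcases Goal.translate_vars _ _ _ _ _ _ hx with h | h | h
    · rw [Term.vars, Finset.mem_singleton] at h
      omega
    · omega
    · exact h.2 hx'
  · have := he.vars_lt x hx
    omega
  · refine hη.inj.mono fun x hx => ?_
    exact ⟨(hloc x hx).1, (hloc x hx).2.1⟩
  · obtain ⟨hz1, hz2, -⟩ := hloc z hz
    by_cases hx'' : x ∈ e.outer
    · exact Set.disjoint_left.1 hVN
        (hη.shared x (Finset.mem_inter.2 ⟨hx', hx''⟩) _ hz') (hη.rename z hz1 hz2).2
    · rw [(hη.rename x hx' hx'').1, Term.vars, Finset.mem_singleton] at hz'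
      rw [← hη.inj ⟨hz1, hz2⟩ ⟨hx', hx''⟩ hz'] at hx
      exact (Finset.mem_filter.1 hx).2 hz
  · refine ⟨(hfresh' x hx y hy).1, (hfresh' x hx y hy).2.1, fun z hz hz' =>
      (hfresh' x hx y hy).2.2 z (Finset.mem_filter.1 hz).1 fun h => ?_⟩
    have := he.vars_lt z h
    omega

end HypEntry

/-- The states after corresponding resolution steps for a built-in predicate correspond. -/
theorem Linked.exists_linked_builtin {k : K} {ts us : List (Term F)} {q : Goal F P K}
    {q' : TGoal F P K} {σ : Subst F}
    (h : Linked prog₀ T target V N J c used used' ids prog target' (.builtin k ts q)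
      (.builtin k ts q')) (hσ : IsMGU σ us ts) (hus : ∀ x ∈ varsArgs us, x ∉ N) :
    ∃ V₁, Outcome T target V N J c used used' ids σ σ V₁ (used ∪ varsArgs us)
        (used' ∪ varsArgs us) ids ∅ ∧
      Linked prog₀ T target V₁ N J c (used ∪ varsArgs us) (used' ∪ varsArgs us) ids prog target'
        (q.subst σ) (q'.subst σ) := by
  obtain ⟨hVN, hb, hcor, hP⟩ := h
  cases hcor with
  | builtin hts hq =>
    have hd : Disjoint (V ∪ {x | x ∈ varsArgs us}) N := Set.disjoint_left.2 fun x hx hx' =>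
      hx.elim (fun hx => Set.disjoint_left.1 hVN hx hx') (fun hx => hus x hx hx')
    have hsupp : SupportedOn σ (V ∪ {x | x ∈ varsArgs us}) := hσ.supportedOn.mono fun x hx =>
      hx.elim Or.inr fun hx => Or.inl (hts x hx)
    have hvar : ∀ x ∈ N, σ x = .var x := fun x hx =>
      hsupp.1 x fun hx' => Set.disjoint_left.1 hd hx' hx
    have hb' : ∀ x, x ∈ V ∨ x ∈ N → x ∈ used ∪ varsArgs us ∨ x ∈ used' ∪ varsArgs us := fun x hx =>
      (hb x hx).imp (Finset.mem_union_left _) (Finset.mem_union_left _)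
    have hb'' : ∀ x ∈ V ∪ {x | x ∈ varsArgs us}, x ∈ used ∪ varsArgs us ∨ x ∈ used' ∪ varsArgs us :=
      fun x hx => hx.elim (fun hx => hb' x (Or.inl hx)) fun hx => Or.inl (Finset.mem_union_right _ hx)
    have hcor := hq.subst hsupp Set.subset_union_left hd (fun _ _ => rfl)
      (fun x hx => hvar x (hq.subset hx))
    rw [Term.subst_ctx] at hcor
    exact ⟨_, ⟨Set.subset_union_left, hb'', hd, hsupp, fun _ _ => rfl, fun x hx _ => hvar x hx,
      Finset.subset_union_left, Finset.subset_union_left, subset_rfl, by simp, by simp⟩,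
      hd, fun x hx => hx.elim (hb'' x) fun hx => hb' x (Or.inr hx), hcor, hP⟩

/-- The states after the registration of a hypothesis correspond. -/
theorem Linked.assume {p : P} {ts : List (Term F)} {b g q : Goal F P K}
    {i v : ℕ} {X : Term F} {g' q' : TGoal F P K} {J' : Set ℕ} {z : ℤ}
    (hC : IsCompiled prog₀ T target)
    (hVN : Disjoint V N) (hb : ∀ x, x ∈ V ∨ x ∈ N → x ∈ used ∨ x ∈ used')
    (hP : ProgramInv prog₀ T target prog target' c ids)
    (hH : IsHypInstance T V N ⟨p, ts, b⟩ i X)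
    (hvN : v ∈ N) (hvJ : v ∉ J) (hvJ' : v ∉ J')
    (hg : Corresponds T V N (.cons (.var v) (.ctx c)) g g' J)
    (hq : Corresponds T V N (.ctx c) q q' J') (hz : z ∉ ids) {μ : Subst F}
    (hμ : μ = Function.update Term.var v (.int z)) :
    X.subst μ = X ∧
    Outcome T target V N ({v} ∪ J ∪ J') c used used' ids Subst.id μ V used used' (insert z ids)
      {.regFact (.int i) X (.ctx (z :: c))} ∧
    Linked prog₀ T target V N J (z :: c) used used' (insert z ids) (prog ∪ {⟨p, ts, b⟩})
      (target' ∪ {.regFact (.int i) X (.ctx (z :: c))}) g (g'.subst μ) ∧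
    Corresponds T V N (.ctx c) q (q'.subst μ) J' := by
  have hne : ∀ x, x ≠ v → μ x = .var x := fun x hx => by rw [hμ, Function.update_of_ne hx]
  have hv : μ v = .int z := by rw [hμ, Function.update_self]
  have hV : ∀ x ∈ V, μ x = .var x := fun x hx => hne x fun h =>
    Set.disjoint_left.1 hVN hx (h ▸ hvN)
  -- `μ` moves only the private variable `v`, so a correspondence survives when `μ` is applied on
  -- the target side alone.
  have hsub : ∀ {S : Term F} {G : Goal F P K} {G' : TGoal F P K} {J : Set ℕ},
      Corresponds T V N S G G' J → v ∉ J → Corresponds T V N (S.subst μ) G (G'.subst μ) J :=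
    fun h hv => by
      have := h.subst (supportedOn_id V) subset_rfl hVN hV fun x hx => hne x fun h => hv (h ▸ hx)
      rwa [Goal.subst_id] at this
  have hg' := hsub hg hvJ
  have hq' := hsub hq hvJ'
  rw [Term.subst_ctx] at hq'
  rw [Term.subst, Term.subst, hv, Term.subst_ctx] at hg'
  refine ⟨?_, ⟨subset_rfl, fun x hx => hb x (Or.inl hx), hVN, supportedOn_id V, hV,
    fun x hx hx' => hne x fun h => hx' (Or.inl (Or.inl h)), subset_rfl, subset_rfl,
    Finset.subset_insert _ _, ?_, ?_⟩, ⟨hVN, hb, hg', hP.assume hz (hH.registers hVN)⟩, hq'⟩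
  · obtain ⟨e, he, η, κ, hη, -, -, rfl⟩ := hH
    rw [← Term.subst_comp, varList_subst_eq_iff]
    intro x hx
    exact Term.subst_eq_self fun y hy => hV y (hη.shared x hx y hy)
  · rintro C rfl
    exact ⟨i, X, z, c, rfl, List.suffix_rfl, Finset.mem_insert_self _ _, _, hH.registers hVN⟩
  · rintro C rfl
    exact hH.isRegistration hC z

end Linked

-- From hypothetical derivations to SLD derivations

section Forward

variable {F : Type u} {P : Type v} {K : Type w}

variable {B : K → Set (List (Term F))} {prog₀ prog : Set (Rule F P K)} {T : Set (HypEntry F P K)}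
  {target target' : Set (TClause F P K)} {V N J : Set ℕ} {c : List ℤ}
  {used used' used₁ used₁' : Finset ℕ} {ids : Finset ℤ}

/-- A partial renaming `f` of some variables `S` with new variables in `Z` is extended to a renaming
that uses variables outside `Z` for the others. -/
theorem exists_perm_extension (D S Z : Finset ℕ) (f : ℕ → ℕ) (hf : Set.InjOn f S)
    (hZ : ∀ x ∈ S, f x ∈ Z) :
    ∃ ρ : Equiv.Perm ℕ, (∀ x ∈ S, ρ x = f x) ∧ ∀ x ∈ D, x ∉ S → ρ x ∉ Z := by
  classical
  have hM : ∀ x ∈ Z, x < freshVar Z := fun x hx => Nat.lt_succ_of_le (Finset.le_sup (f := id) hx)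
  -- Adding `freshVar Z` moves every variable beyond all of `Z`, and so away from the values of `f`.
  obtain ⟨ρ, hρ⟩ := exists_perm_eqOn (D ∪ S) (fun x => if x ∈ S then f x else x + freshVar Z) (by
    intro x _ y _ hxy
    simp only at hxy
    split_ifs at hxy with hx hy hy
    · exact hf hx hy hxy
    · have := hM _ (hZ x hx)
      omega
    · have := hM _ (hZ y hy)
      omega
    · omega)
  refine ⟨ρ, fun x hx => ?_, fun x hx hx' h => ?_⟩
  · rw [hρ x (Finset.mem_union_right _ hx), if_pos hx]
  · rw [hρ x (Finset.mem_union_left _ hx), if_neg hx'] at h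
    have := hM _ h
    omega

/-- A step of the source to the goal `G₁` that uses the unifier `σ` is simulated by steps from `G'` to
a corresponding goal. -/
def Simulates (B : K → Set (List (Term F))) (prog₀ : Set (Rule F P K)) (T : Set (HypEntry F P K))
    (target : Set (TClause F P K)) (V N J : Set ℕ) (c : List ℤ) (used used' : Finset ℕ)
    (ids : Finset ℤ) (prog : Set (Rule F P K)) (target' : Set (TClause F P K)) (Z used₁ : Finset ℕ)
    (σ : Subst F) (G₁ : Goal F P K) (G' : TGoal F P K) : Prop :=
  ∃ Θ V₁ N₁ J₁ used₁' G₁', Outcome T target V N J c used used' ids σ Θ V₁ used₁ used₁' ids ∅ ∧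
    N ⊆ N₁ ∧ (∀ x ∈ N, x ∉ J → x ∉ J₁) ∧
    Linked prog₀ T target V₁ N₁ J₁ c used₁ used₁' ids prog target' G₁ G₁' ∧
    (∀ x ∈ used₁', x ∈ Z → x ∈ used₁) ∧
    ∀ K θ, SSteps B ⟨G'.append K, θ, target', used', ids⟩ ∅
      ⟨G₁'.append (K.subst Θ), θ.comp Θ, target', used₁', ids⟩

/-- A resolution step with a program rule is simulated. -/
theorem ProgramInv.simulate_rule (hC : IsCompiled prog₀ T target)
    (hP : ProgramInv prog₀ T target prog target' c ids)
    (hb : ∀ x, x ∈ V ∨ x ∈ N → x ∈ used ∨ x ∈ used') {l i k : ℕ} {ts : List (Term F)}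
    (hc : HypEntry.IsCall V N l i k ts) {q : Goal F P K} {q' : TGoal F P K}
    (hq : Corresponds T V N (.ctx c) q q' J) (hl : l ∉ J) (hi : i ∉ J) (hk : k ∉ J)
    {R : Rule F P K} (hR : R ∈ prog₀) {ρ : Equiv.Perm ℕ} {σ : Subst F} {Z : Finset ℕ}
    (hfresh : ∀ x ∈ (R.subst (renameBy ρ)).vars, x ∉ used ∧ x ∉ used' ∧ x ∈ Z)
    (hZ : ∀ x ∈ used', x ∈ Z → x ∈ used)
    (hσ : IsMGU σ (R.subst (renameBy ρ)).args ts) :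
    Simulates B prog₀ T target V N ({l, i, k} ∪ J) c used used' ids prog target' Z
      (used ∪ (R.subst (renameBy ρ)).vars) σ (((R.subst (renameBy ρ)).body.append q).subst σ)
      (TGoal.user R.pred (ts ++ [.var l, .var i, .var k, .ctx c]) q') := by
  obtain ⟨n, hn, hT⟩ := hC.rule R hR
  have hmem : ∀ x ∈ R.vars, ρ x ∈ (R.subst (renameBy ρ)).vars := fun x hx =>
    Rule.mem_vars_renameBy.2 ⟨x, hx, rfl⟩
  -- The target copies the renaming of the source on the variables of `R`; the variables added by
  -- the translation go outside `Z`, so that the rest of the source derivation does not meet them.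
  obtain ⟨ρ₁, hin, hout⟩ := exists_perm_extension (R.clause n).vars R.vars (used ∪ used' ∪ Z) ρ
    ρ.injective.injOn (fun x hx => Finset.mem_union_right _ (hfresh _ (hmem x hx)).2.2)
  simp only [Finset.mem_union, not_or] at hout
  have hnew : ∀ x ∈ (R.clause n).vars, ρ₁ x ∉ used ∧ ρ₁ x ∉ used' := by
    intro x hx
    by_cases hxR : x ∈ R.vars
    · rw [hin x hxR]
      exact ⟨(hfresh _ (hmem x hxR)).1, (hfresh _ (hmem x hxR)).2.1⟩
    · exact (hout x hx hxR).1
  have hVN : ∀ {x : ℕ}, x ∉ used ∧ x ∉ used' → x ∉ V ∧ x ∉ N := fun hx =>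
    ⟨fun h => (hb _ (Or.inl h)).elim hx.1 hx.2, fun h => (hb _ (Or.inr h)).elim hx.1 hx.2⟩
  have hF : R.FreshFor n ρ₁ V N := fun x hx => hVN (hnew x hx)
  have hargs : substArgs (renameBy ρ : Subst F) R.args = substArgs (renameBy ρ₁) R.args :=
    substArgs_congr fun x hx => by
      rw [renameBy_apply, renameBy_apply, hin x (Finset.mem_union_left _ hx)]
  obtain ⟨Θ, hΘ, hres⟩ := hF.exists_target_resolution (c := c) hc (σ := σ) (hargs ▸ hσ)
  have hres' := hres.congr (α' := renameBy ρ) (fun x hx =>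
    ⟨Rule.mem_clause_vars.2 (Or.inl hx), Finset.mem_union_left _ hx⟩)
    (fun x _ hx => by rw [renameBy_apply, renameBy_apply, hin x hx])
  obtain ⟨V₁, N₁, J₁, hO, hN, hJ, hL⟩ := Rule.exists_linked hres' hc hq hl hi hk hb hP hT hF
    (fun x hx => ⟨(hVN ⟨(hfresh _ (hmem x hx)).1, (hfresh _ (hmem x hx)).2.1⟩).1,
      (hVN ⟨(hfresh _ (hmem x hx)).1, (hfresh _ (hmem x hx)).2.1⟩).2, fun z hz hz' h =>
      (hout z hz hz').2 (h ▸ (hfresh _ (hmem x hx)).2.2)⟩)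
  refine ⟨Θ, V₁, N₁, J₁, _, _, hO, hN, hJ, hL, fun x hx hxZ => ?_, fun K θ => ?_⟩
  · rcases Finset.mem_union.1 hx with hx | hx
    · exact Finset.mem_union_left _ (hZ x hx hxZ)
    · obtain ⟨y, hy, rfl⟩ := TClause.mem_vars_renameBy.1 hx
      by_cases hyR : y ∈ R.vars
      · rw [hin y hyR]
        exact Finset.mem_union_right _ (hmem y hyR)
      · exact absurd hxZ (hout y hy hyR).2
  · rw [← TGoal.subst_append, TGoal.append_assoc]
    refine SSteps.head_of_asserted_eq_empty (.rule ρ₁ (hP.base' hn) rfl ?_ hΘ) (.refl _) rfl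
    refine Finset.disjoint_left.2 fun x hx hx' => ?_
    obtain ⟨y, hy, rfl⟩ := TClause.mem_vars_renameBy.1 hx
    exact (hnew y hy).2 hx'

/-- Resolution with a translated hypothesis whose registration is found. -/
theorem SSteps.hypothesis {e : HypEntry F P K} {X : Term F} {d : List ℤ} {q : TGoal F P K}
    {ts : List (Term F)} {ρ ρ' : Equiv.Perm ℕ} {σ₁ σ₂ : Subst F} (he : e.clause ∈ target')
    (hX : TClause.regFact (.int e.id) X (.ctx d) ∈ target') (hd : d <:+ c)
    (hfresh : Disjoint (e.clause.subst (renameBy ρ)).vars used)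
    (hfresh' : Disjoint (X.subst (renameBy ρ')).vars
      (used ∪ (e.clause.subst (renameBy ρ)).vars))
    (hσ₁ : IsMGU σ₁ (substArgs (renameBy ρ) e.head) ts)
    (hσ₂ : IsMGU σ₂ [.int e.id, X.subst (renameBy ρ'), .ctx d] (substArgs σ₁
        [.int e.id, (varList e.shared).subst (renameBy ρ), .var (ρ (e.next + 2))]))
    (hc : σ₁.comp σ₂ (ρ (e.next + 1)) = .ctx c) (hd' : σ₁.comp σ₂ (ρ (e.next + 2)) = .ctx d)
    (θ : Subst F) :
    SSteps B ⟨.user e.pred ts q, θ, target', used, ids⟩ ∅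
      ⟨((e.tbody.subst (renameBy ρ)).append q).subst (σ₁.comp σ₂), θ.comp (σ₁.comp σ₂), target',
        used ∪ (e.clause.subst (renameBy ρ)).vars ∪ (X.subst (renameBy ρ')).vars, ids⟩ := by
  have hvars : ((TClause.regFact (.int e.id) X (.ctx d) : TClause F P K).subst
      (renameBy ρ')).vars = (X.subst (renameBy ρ')).vars := by
    simp [TClause.subst, TClause.vars, Term.subst, Term.vars, Term.subst_ctx]
  have hreg : (TClause.regFact (.int e.id) X (.ctx d) : TClause F P K).subst (renameBy ρ') =
      .regFact (.int e.id) (X.subst (renameBy ρ')) (.ctx d) := by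
    simp [TClause.subst, Term.subst, Term.subst_ctx]
  refine .head_of_asserted_eq_empty (.rule ρ he rfl hfresh hσ₁) ?_ rfl
  simp only [HypEntry.guarded, TGoal.subst, TGoal.append]
  refine .head_of_asserted_eq_empty (.reg ρ' hX hreg (by rwa [hvars]) hσ₂) ?_ rfl
  simp only [TGoal.subst, ← Term.subst_comp, ← TGoal.subst_comp, Subst.comp_assoc]
  have h1 : (Term.var (e.next + 2)).subst ((renameBy ρ).comp (σ₁.comp σ₂)) = .ctx d := hd'
  have h2 : (Term.var (e.next + 1)).subst ((renameBy ρ).comp (σ₁.comp σ₂)) = .ctx c := hc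
  rw [h1, h2, hvars]
  exact .head_of_asserted_eq_empty (.chk hd) (.refl _) rfl

theorem HypEntry.IsInstance.mem_vars {e : HypEntry F P K} {η : Subst F} {x y : ℕ} (hx : x ∈ e.vars)
    (hy : y ∈ (η x).vars) :
    y ∈ (⟨e.pred, substArgs η e.args, e.body.subst η⟩ : Rule F P K).vars := by
  simp only [Rule.vars, Finset.mem_union, mem_varsArgs_substArgs, Goal.mem_vars_subst]
  rcases Finset.mem_union.1 hx with hx | hx
  · exact Or.inl ⟨x, hx, hy⟩
  · exact Or.inr ⟨x, hx, hy⟩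

/-- A resolution step with an assumed hypothesis is simulated. -/
theorem ProgramInv.simulate_hypothesis (hC : IsCompiled prog₀ T target)
    (hP : ProgramInv prog₀ T target prog target' c ids)
    (hb : ∀ x, x ∈ V ∨ x ∈ N → x ∈ used ∨ x ∈ used') {l i k : ℕ} {ts : List (Term F)}
    (hc : HypEntry.IsCall V N l i k ts) {q : Goal F P K} {q' : TGoal F P K}
    (hq : Corresponds T V N (.ctx c) q q' J) (hl : l ∉ J) (hi : i ∉ J) (hk : k ∉ J)
    {R : Rule F P K} {id : ℕ} {X : Term F} {d : List ℤ} (hd : d <:+ c)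
    (hX : TClause.regFact (.int id) X (.ctx d) ∈ target') (hR : Registers T R id X)
    {ρ : Equiv.Perm ℕ} {σ : Subst F} {Z : Finset ℕ}
    (hfresh : ∀ x ∈ (R.subst (renameBy ρ)).vars, x ∉ used ∧ x ∉ used' ∧ x ∈ Z)
    (hZ : ∀ x ∈ used', x ∈ Z → x ∈ used)
    (hσ : IsMGU σ (R.subst (renameBy ρ)).args ts) :
    Simulates B prog₀ T target V N ({l, i, k} ∪ J) c used used' ids prog target' Z
      (used ∪ (R.subst (renameBy ρ)).vars) σ (((R.subst (renameBy ρ)).body.append q).subst σ)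
      (TGoal.user R.pred (ts ++ [.var l, .var i, .var k, .ctx c]) q') := by
  obtain ⟨V₀, N₀, hVN₀, e, heT, η, κ, hη, hRe, rfl, rfl⟩ := hR
  have he := hC.wellFormed e heT
  have hmem : ∀ x ∈ e.vars, ∀ y ∈ (η x).vars, ρ y ∈ (R.subst (renameBy ρ)).vars := by
    intro x hx y hy
    exact Rule.mem_vars_renameBy.2 ⟨y, hRe ▸ HypEntry.IsInstance.mem_vars hx hy, rfl⟩
  have hargs : (R.subst (renameBy ρ)).args = substArgs (η.comp (renameBy ρ)) e.args := by
    rw [hRe, substArgs_comp]; rfl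
  have hbody : (R.subst (renameBy ρ)).body = e.body.subst (η.comp (renameBy ρ)) := by
    rw [hRe, Goal.subst_comp]; rfl
  have hpred : R.pred = e.pred := by rw [hRe]
  rw [hargs] at hσ
  rw [hbody, hpred]
  clear hargs hbody hRe hpred
  generalize hR' : (R.subst (renameBy ρ)).vars = R' at hfresh hmem ⊢
  clear hR' R
  have hκ : ∀ x ∈ e.vars \ e.outer, κ x ∈ (η x).vars := fun x hx => by
    rw [(hη.rename x (Finset.mem_sdiff.1 hx).1 (Finset.mem_sdiff.1 hx).2).1]
    simp [Term.vars]
  -- In the stored rule the local variable `x` has become `κ x`, so the clause must rename `x` to `ρ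
  -- (κ x)` to match the source. The shared variables get fresh copies here; their terms come from
  -- the registration, which is renamed by the source's `ρ`.
  obtain ⟨ρ₁, hin, hout⟩ := exists_perm_extension e.clause.vars (e.vars \ e.outer)
    (used ∪ used' ∪ Z) (fun x => ρ (κ x))
    (fun x hx y hy hxy => hη.inj (by simpa using hx) (by simpa using hy) (ρ.injective hxy))
    (fun x hx => Finset.mem_union_right _
      (hfresh _ (hmem x (Finset.mem_sdiff.1 hx).1 _ (hκ x hx))).2.2)
  simp only [Finset.mem_union, not_or] at hout
  have hnew : ∀ x ∈ e.clause.vars, ρ₁ x ∉ used ∧ ρ₁ x ∉ used' := by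
    intro x hx
    by_cases hxR : x ∈ e.vars \ e.outer
    · rw [hin x hxR]
      have := hfresh _ (hmem x (Finset.mem_sdiff.1 hxR).1 _ (hκ x hxR))
      exact ⟨this.1, this.2.1⟩
    · exact (hout x hx hxR).1
  have hVN : ∀ {x : ℕ}, x ∉ used ∧ x ∉ used' → x ∉ V ∧ x ∉ N := fun hx =>
    ⟨fun h => (hb _ (Or.inl h)).elim hx.1 hx.2, fun h => (hb _ (Or.inr h)).elim hx.1 hx.2⟩
  have hVN' : ∀ x ∈ R', x ∉ V ∧ x ∉ N := fun x hx => hVN ⟨(hfresh x hx).1, (hfresh x hx).2.1⟩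
  have hsh : ∀ x ∈ e.shared, ∀ y ∈ (η.comp (renameBy ρ) x).vars, y ∈ R' ∧
      ∀ z ∈ e.clause.vars, y ≠ ρ₁ z := by
    intro x hx y hy
    obtain ⟨w, hw, rfl⟩ := Term.mem_vars_renameBy.1 hy
    have hyR := hmem x (Finset.mem_inter.1 hx).1 w hw
    refine ⟨hyR, fun z hz h => ?_⟩
    by_cases hzR : z ∈ e.vars \ e.outer
    · rw [hin z hzR] at h
      have h := ρ.injective h
      have h2 := (hη.rename z (Finset.mem_sdiff.1 hzR).1 (Finset.mem_sdiff.1 hzR).2).2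
      exact Set.disjoint_left.1 hVN₀ (hη.shared x hx w hw) (h ▸ h2)
    · exact (hout z hz hzR).2 (h ▸ (hfresh _ hyR).2.2)
  have hF : e.FreshFor (η.comp (renameBy ρ)) ρ₁ V N := ⟨fun x hx => hVN (hnew x hx),
    fun x hx y hy => ⟨(hVN' y (hsh x hx y hy).1).1, (hVN' y (hsh x hx y hy).1).2, (hsh x hx y hy).2⟩⟩
  -- Shared variables from the registration and locals from the clause together give exactly the
  -- variant that the source uses.
  have hα : ∀ x ∈ e.clause.vars, x ∈ e.vars →
      e.mixed (η.comp (renameBy ρ)) ρ₁ x = η.comp (renameBy ρ) x := by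
    intro x _ hx
    rw [HypEntry.mixed]
    split_ifs with hs
    · rfl
    · have hxo : x ∉ e.outer := fun h => hs (Finset.mem_inter.2 ⟨hx, h⟩)
      rw [hin x (Finset.mem_sdiff.2 ⟨hx, hxo⟩), Subst.comp, (hη.rename x hx hxo).1]
      rfl
  have hD : ∀ x ∈ varsArgs e.args, x ∈ e.clause.vars ∧ x ∈ e.vars := fun x hx =>
    HypEntry.mem_clause_vars_of_mem_args hx
  have hargs : substArgs (e.mixed (η.comp (renameBy ρ)) ρ₁) e.args =
      substArgs (η.comp (renameBy ρ)) e.args :=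
    substArgs_congr fun x hx => hα x (hD x hx).1 (hD x hx).2
  obtain ⟨σ₁, σ₂, hσ₁, hσ₂, hres, hctx⟩ := hF.exists_target_resolution (c := c) (d := d) hc he
    (σ := σ) (hargs ▸ hσ)
  have hres' := hres.congr hD hα
  have hXvars : ∀ x ∈ (((varList e.shared).subst η).subst (renameBy ρ)).vars, x ∈ R' ∧
      ∀ z ∈ e.clause.vars, x ≠ ρ₁ z := by
    intro x hx
    rw [← Term.subst_comp] at hx
    obtain ⟨y, hy, hx⟩ := Term.mem_vars_subst.1 hx
    exact hsh y (mem_varList_vars.1 hy) x hx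
  obtain ⟨V₁, N₁, J₁, hO, hN, hJ, hL⟩ := HypEntry.exists_linked hres' hc hq hl hi hk hb hP he hη hVN₀
    hF.rename (used₁ := used ∪ R') (used₁' := used' ∪ (e.clause.subst (renameBy ρ₁)).vars ∪
      (((varList e.shared).subst η).subst (renameBy ρ)).vars)
    (fun x hx y hy => ⟨(hVN' _ (hmem x hx y hy)).1, (hVN' _ (hmem x hx y hy)).2, fun z hz hz' h =>
      (hout z hz fun h => hz' (Finset.mem_sdiff.1 h).1).2 (h ▸ (hfresh _ (hmem x hx y hy)).2.2)⟩)
    Finset.subset_union_left (Finset.subset_union_left.trans Finset.subset_union_left)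
    (fun x hx y hy => Finset.mem_union_right _ (hmem x hx y hy))
    (fun x hx => Finset.mem_union_left _ (Finset.mem_union_right _
      (TClause.mem_vars_renameBy.2 ⟨x, hx, rfl⟩)))
  refine ⟨_, V₁, N₁, J₁, _, _, hO, hN, hJ, hL, fun x hx hxZ => ?_, fun K θ => ?_⟩
  · rcases Finset.mem_union.1 hx with hx | hx
    · rcases Finset.mem_union.1 hx with hx | hx
      · exact Finset.mem_union_left _ (hZ x hx hxZ)
      · obtain ⟨y, hy, rfl⟩ := TClause.mem_vars_renameBy.1 hx
        by_cases hyR : y ∈ e.vars \ e.outer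
        · rw [hin y hyR]
          exact Finset.mem_union_right _ (hmem y (Finset.mem_sdiff.1 hyR).1 _ (hκ y hyR))
        · exact absurd hxZ (hout y hy hyR).2
    · exact Finset.mem_union_right _ (hXvars x hx).1
  · rw [← TGoal.subst_append, TGoal.append_assoc]
    refine SSteps.hypothesis (hP.base' (hC.hyp e heT)) hX hd ?_ ?_ hσ₁
      (by rw [← Term.subst_comp]; exact hσ₂) hres.context hctx θ
    · refine Finset.disjoint_left.2 fun x hx hx' => ?_
      obtain ⟨y, hy, rfl⟩ := TClause.mem_vars_renameBy.1 hx
      exact (hnew y hy).2 hx'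
    · refine Finset.disjoint_left.2 fun x hx hx' => ?_
      rcases Finset.mem_union.1 hx' with hx' | hx'
      · exact (hfresh x (hXvars x hx).1).2.1 hx'
      · obtain ⟨y, hy, rfl⟩ := TClause.mem_vars_renameBy.1 hx'
        exact (hXvars _ hx).2 y hy rfl

/-- Successful hypothetical derivations are simulated by derivations from the translated goal. -/
theorem HBig.simulate (hC : IsCompiled prog₀ T target) {prog : Set (Rule F P K)}
    {used used₁ : Finset ℕ} {G : Goal F P K} {σ : Subst F} (h : HBig B prog used G σ used₁) :
    ∀ {Z used' : Finset ℕ} {V N J : Set ℕ} {c : List ℤ} {ids : Finset ℤ}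
      {target' : Set (TClause F P K)} {G' : TGoal F P K}, used₁ ⊆ Z →
      (∀ x ∈ used', x ∈ Z → x ∈ used) →
      Linked prog₀ T target V N J c used used' ids prog target' G G' →
      ∃ σ' V₁ used₁' ids₁ A,
        Outcome T target V N J c used used' ids σ σ' V₁ used₁ used₁' ids₁ A ∧
        (∀ x ∈ used₁', x ∈ Z → x ∈ used₁) ∧
        ∀ K θ, SSteps B ⟨G'.append K, θ, target', used', ids⟩ A
          ⟨K.subst σ', θ.comp σ', target' ∪ A, used₁', ids₁⟩ := by
  induction h with
  | nil =>
    intro Z used' V N J c ids target' G' _ hZ hL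
    cases hL.corresponds
    refine ⟨_, _, _, _, _, .refl (fun x hx => hL.bounded x (Or.inl hx)) hL.disjoint, hZ,
      fun K θ => ?_⟩
    rw [TGoal.subst_id, Subst.comp_id, Set.union_empty]
    exact .refl _
  | @rule p ts q σ τ prog used used₁ R ρ hR hfresh hp hσ h ih =>
    intro Z used' V N J c ids target' G' hsub hZ hL
    -- `Z` contains all variables of the source derivation. If the target had already used one of
    -- these, then so would the source.
    have hfresh' : ∀ x ∈ (R.subst (renameBy ρ)).vars, x ∉ used ∧ x ∉ used' ∧ x ∈ Z := by
      intro x hx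
      have h1 := Finset.disjoint_left.1 hfresh hx
      have h2 := hsub (h.used_subset (Finset.mem_union_right _ hx))
      exact ⟨h1, fun h3 => h1 (hZ x h3 h2), h2⟩
    obtain ⟨hVN, hb, hcor, hP⟩ := hL
    subst hp
    cases hcor with
    | @user _ _ _ _ q' l i k J hts hlN hiN hkN hli hlk hik hlJ hiJ hkJ hq =>
      have hc : HypEntry.IsCall V N l i k ts := ⟨hVN, hts, hlN, hiN, hkN, hli, hlk, hik⟩
      have hstep : Simulates B prog₀ T target V N ({l, i, k} ∪ J) c used used' ids prog target' Z
          (used ∪ (R.subst (renameBy ρ)).vars) σ (((R.subst (renameBy ρ)).body.append q).subst σ)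
          (TGoal.user R.pred (ts ++ [.var l, .var i, .var k, .ctx c]) q') := by
        rcases hP.hyp R hR with hR | ⟨id, X, d, hd, hX, hR⟩
        · exact hP.simulate_rule (B := B) hC hb hc hq hlJ hiJ hkJ hR hfresh' hZ hσ
        · exact hP.simulate_hypothesis (B := B) hC hb hc hq hlJ hiJ hkJ hd hX hR hfresh' hZ hσ
      obtain ⟨Θ, V₁, N₁, J₁, used₂', G₁, hO, hN, hJ, hL, hZ', hsteps⟩ := hstep
      obtain ⟨σ', V₂, used₁', ids₁, A, hO', hZ'', hsteps'⟩ := ih hsub hZ' hL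
      have hO'' := hO.comp hO' hN hJ List.suffix_rfl
      rw [Set.empty_union] at hO''
      refine ⟨_, _, _, _, _, hO'', hZ'', fun K θ => ?_⟩
      have := (hsteps K θ).trans (hsteps' (K.subst Θ) (θ.comp Θ))
      rwa [Set.empty_union, ← TGoal.subst_comp, Subst.comp_assoc] at this
  | @builtin k ts us q σ τ prog used used₁ ρ hB hfresh hσ h ih =>
    intro Z used' V N J c ids target' G' hsub hZ hL
    have hfresh' : ∀ x ∈ varsArgs (substArgs (renameBy ρ : Subst F) us), x ∉ used ∧ x ∉ used' := by
      intro x hx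
      have h1 := Finset.disjoint_left.1 hfresh hx
      exact ⟨h1, fun h3 => h1 (hZ x h3 (hsub (h.used_subset (Finset.mem_union_right _ hx))))⟩
    cases hL.corresponds with
    | @builtin _ _ _ _ q' J hts hq =>
      obtain ⟨V₁, hO, hL'⟩ := hL.exists_linked_builtin hσ
        (fun x hx hx' => (hL.bounded x (Or.inr hx')).elim (hfresh' x hx).1 (hfresh' x hx).2)
      obtain ⟨σ', V₂, used₁', ids₁, A, hO', hZ', hsteps'⟩ := ih hsub (fun x hx hxZ =>
        (Finset.mem_union.1 hx).elim (fun hx => Finset.mem_union_left _ (hZ x hx hxZ))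
          (fun hx => Finset.mem_union_right _ hx)) hL'
      have hO'' := hO.comp hO' subset_rfl (fun x _ h => h) List.suffix_rfl
      rw [Set.empty_union] at hO''
      refine ⟨_, _, _, _, _, hO'', hZ', fun K θ => ?_⟩
      have := hsteps' (K.subst σ) (θ.comp σ)
      rw [← TGoal.subst_comp, ← TGoal.subst_append, Subst.comp_assoc] at this
      exact .head_of_asserted_eq_empty (.builtin ρ hB rfl
        (Finset.disjoint_left.2 fun x hx => (hfresh' x hx).2) hσ) this rfl
  | @hyp p ts b g q σ τ prog used used₁ used₂ hg hq ihg ihq =>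
    intro Z used' V N J c ids target' G' hsub hZ hL
    obtain ⟨hVN, hb, hcor, hP⟩ := hL
    cases hcor with
    | @imp _ _ _ _ _ _ g' q' i v X J J' hH hvN hvJ hvJ' hJ hcg hcq =>
      obtain ⟨z, hz⟩ := Infinite.exists_notMem_finset ids
      obtain ⟨hX, hO, hL, hcq'⟩ := Linked.assume hC hVN hb hP hH hvN hvJ hvJ' hcg hcq hz rfl
      set μ : Subst F := Function.update Term.var v (.int z) with hμ
      obtain ⟨σ', V₁, used₁', ids₁, A, hO₁, hZ₁, hsteps₁⟩ := ihg (hq.used_subset.trans hsub) hZ hL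
      -- Solving `g` does not touch the new variables `J'` of the rest of the goal, because they are
      -- disjoint from those in `g`.
      have hcq₁ := hcq'.subst hO₁.supported hO₁.subset hO₁.disjoint hO₁.agree
        (fun x hx => hO₁.hidden x (hcq'.subset hx) (Set.disjoint_right.1 hJ hx))
      rw [Term.subst_ctx] at hcq₁
      have hO' := hO.comp hO₁ subset_rfl (fun x _ h hx => h (Or.inl (Or.inr hx)))
        (List.suffix_cons z c)
      -- The hypothesis is dropped again while its registration stays in the target program.
      have hP' := hP.union (A := {.regFact (.int i) X (.ctx (z :: c))} ∪ A) hO'.ids_subset hO'.facts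
      obtain ⟨τ', V₂, used₂', ids₂, A', hO₂, hZ₂, hsteps₂⟩ := ihq hsub hZ₁
        ⟨hO₁.disjoint, fun x hx => hx.elim (hO₁.bounded x) fun hx =>
          (hb x (Or.inr hx)).imp (@hO'.used_subset x) (@hO'.used_subset' x), hcq₁, hP'⟩
      have hO'' := hO'.comp hO₂ subset_rfl (fun x _ h hx => h (Or.inr hx)) List.suffix_rfl
      rw [Subst.id_comp] at hO''
      refine ⟨_, _, _, _, _, hO'', hZ₂, fun K θ => ?_⟩
      -- The target runs `g` with the rest of the goal behind it. The simulation holds for every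
      -- continuation, so the two parts can be concatenated.
      have h1 := (hsteps₁ ((q'.append K).subst μ) (θ.comp μ)).trans (by
        have := hsteps₂ ((K.subst μ).subst σ') ((θ.comp μ).comp σ')
        rwa [← TGoal.subst_append, ← TGoal.subst_append, ← Set.union_assoc] at this)
      rw [Set.union_assoc _ A A', ← Set.union_assoc target']
      refine .head_of_asserted_eq_empty .imp (.head_of_asserted_eq_empty
        (.getCi z hz (isMGU_single_int v z)) (.head_of_asserted_eq_empty .regRule ?_ rfl) rfl) rfl
      rw [← hμ]
      simp only [TGoal.subst]
      have hv : (Term.var v).subst μ = .int z := by rw [Term.subst, hμ, Function.update_self]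
      rw [hX, hv, Term.subst_ctx, Term.subst, ← Term.ctx_cons]
      rw [← TGoal.subst_comp, ← TGoal.subst_comp, Subst.comp_assoc, Subst.comp_assoc,
        Set.union_assoc _ A A'] at h1
      rw [Subst.comp_assoc]
      exact .head .assertReg (.head_of_asserted_eq_empty .call h1 rfl)

end Forward

-- From SLD derivations to hypothetical derivations

section Backward

variable {F : Type u} {P : Type v} {K : Type w}

variable {B : K → Set (List (Term F))} {prog₀ prog : Set (Rule F P K)} {T : Set (HypEntry F P K)}
  {target target' : Set (TClause F P K)} {V N J : Set ℕ} {c : List ℤ}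
  {used used' used₁ used₁' : Finset ℕ} {ids : Finset ℤ}

/-! ### Derivations with a given length -/

/-- Derivations of length `n`. -/
inductive SStepsN (B : K → Set (List (Term F))) :
    ℕ → SState F P K → Set (TClause F P K) → SState F P K → Prop where
  | refl (s : SState F P K) : SStepsN B 0 s ∅ s
  | head {n : ℕ} {s t u : SState F P K} {A : Set (TClause F P K)} (hst : SStep B s t)
      (htu : SStepsN B n t A u) : SStepsN B (n + 1) s (s.asserted ∪ A) u

/-- `call` merges the goal of an implication with the rest, so its derivation is not a separate
premise but an initial segment that has to be found. Recursion on the length makes the remainder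
accessible to the induction. -/
theorem SSteps.exists_length {s t : SState F P K} {A : Set (TClause F P K)}
    (h : SSteps B s A t) : ∃ n, SStepsN B n s A t := by
  induction h with
  | refl s => exact ⟨0, .refl s⟩
  | head hst _ ih =>
    obtain ⟨n, hn⟩ := ih
    exact ⟨n + 1, .head hst hn⟩

theorem SStep.used_subset {s t : SState F P K} (h : SStep B s t) : s.used ⊆ t.used := by
  cases h <;> first | exact subset_rfl | exact Finset.subset_union_left

theorem SStepsN.used_subset {n : ℕ} {s t : SState F P K} {A : Set (TClause F P K)}
    (h : SStepsN B n s A t) : s.used ⊆ t.used := by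
  induction h with
  | refl s => exact subset_rfl
  | head hst _ ih => exact hst.used_subset.trans ih

theorem SStepsN.exists_head {n : ℕ} {s t : SState F P K} {A : Set (TClause F P K)}
    (h : SStepsN B n s A t) (ht : t.goal = .nil) (hs : s.goal ≠ .nil) :
    ∃ m s' A', n = m + 1 ∧ SStep B s s' ∧ SStepsN B m s' A' t ∧ A = s.asserted ∪ A' := by
  cases h with
  | refl => exact absurd ht hs
  | head hst htu => exact ⟨_, _, _, rfl, hst, htu, rfl⟩

section Inversion

variable {prog : Set (TClause F P K)} {s : SState F P K} {q : TGoal F P K} {θ : Subst F}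

theorem SStep.user_inv {p : P} {ts : List (Term F)}
    (h : SStep B ⟨.user p ts q, θ, prog, used, ids⟩ s) :
    ∃ (us : List (Term F)) (b : TGoal F P K) (C : TClause F P K) (ρ : Equiv.Perm ℕ) (σ : Subst F),
      C ∈ prog ∧ C.subst (renameBy ρ) = .rule p us b ∧
      Disjoint (C.subst (renameBy ρ)).vars used ∧ IsMGU σ us ts ∧
      s = ⟨(b.append q).subst σ, θ.comp σ, prog, used ∪ (C.subst (renameBy ρ)).vars, ids⟩ := by
  cases h with
  | rule ρ hC hC' hfresh hσ => exact ⟨_, _, _, ρ, _, hC, hC', hfresh, hσ, rfl⟩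

theorem SStep.reg_inv {i xs c : Term F} (h : SStep B ⟨.reg i xs c q, θ, prog, used, ids⟩ s) :
    ∃ (i' xs' c' : Term F) (C : TClause F P K) (ρ : Equiv.Perm ℕ) (σ : Subst F),
      C ∈ prog ∧ C.subst (renameBy ρ) = .regFact i' xs' c' ∧
      Disjoint (C.subst (renameBy ρ)).vars used ∧ IsMGU σ [i', xs', c'] [i, xs, c] ∧
      s = ⟨q.subst σ, θ.comp σ, prog, used ∪ (C.subst (renameBy ρ)).vars, ids⟩ := by
  cases h with
  | reg ρ hC hC' hfresh hσ => exact ⟨_, _, _, _, ρ, _, hC, hC', hfresh, hσ, rfl⟩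

theorem SStep.builtin_inv {k : K} {ts : List (Term F)}
    (h : SStep B ⟨.builtin k ts q, θ, prog, used, ids⟩ s) :
    ∃ (us : List (Term F)) (ρ : Equiv.Perm ℕ) (σ : Subst F), us ∈ B k ∧
      Disjoint (varsArgs (substArgs (renameBy ρ : Subst F) us)) used ∧
      IsMGU σ (substArgs (renameBy ρ) us) ts ∧
      s = ⟨q.subst σ, θ.comp σ, prog, used ∪ varsArgs (substArgs (renameBy ρ : Subst F) us), ids⟩ := by
  cases h with
  | builtin ρ hB hus' hfresh hσ =>
    subst hus'
    exact ⟨_, ρ, _, hB, hfresh, hσ, rfl⟩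

theorem SStep.chk_inv {x y : Term F} (h : SStep B ⟨.chk x y q, θ, prog, used, ids⟩ s) :
    ∃ c d : List ℤ, x = .ctx c ∧ y = .ctx d ∧ c <:+ d ∧ s = ⟨q, θ, prog, used, ids⟩ := by
  cases h with
  | chk h => exact ⟨_, _, rfl, rfl, h, rfl⟩

/-- The steps for an embedded implication. -/
theorem SStepsN.imp_inv {n : ℕ} {i v : ℕ} {X S : Term F} {g : TGoal F P K}
    {A : Set (TClause F P K)} {t : SState F P K}
    (h : SStepsN B n ⟨.imp (.int i) X g (.var v) S q, θ, prog, used, ids⟩ A t)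
    (ht : t.goal = .nil) :
    ∃ m < n, ∃ z ∉ ids, ∃ A', ∀ μ : Subst F, μ = Function.update Term.var v (.int z) →
      A = {.regFact (.int i) (X.subst μ) (.cons (.int z) (S.subst μ))} ∪ A' ∧
      SStepsN B m ⟨(g.subst μ).append (q.subst μ), θ.comp μ,
        prog ∪ {.regFact (.int i) (X.subst μ) (.cons (.int z) (S.subst μ))}, used, insert z ids⟩
        A' t := by
  obtain ⟨m, s, A', rfl, hs, h, rfl⟩ := h.exists_head ht (by simp)
  cases hs
  obtain ⟨m, s, A', rfl, hs, h, rfl⟩ := h.exists_head ht (by simp)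
  cases hs with
  | @getCi _ _ _ μ _ _ _ z hz hμ =>
    have hv : (Term.var v).subst μ = .int z := by
      rw [hμ.single_int, Term.subst, Function.update_self]
    simp only [TGoal.subst, hv] at h
    obtain ⟨m, s, A', rfl, hs, h, rfl⟩ := h.exists_head ht (by simp)
    cases hs
    obtain ⟨m, s, A', rfl, hs, h, rfl⟩ := h.exists_head ht (by simp)
    cases hs
    obtain ⟨m, s, A', rfl, hs, h, rfl⟩ := h.exists_head ht (by simp)
    cases hs
    -- The mgu of the `get_ci` step can be replaced by the given substitution because it is unique.
    refine ⟨m, by omega, z, hz, A', fun ν hν => ?_⟩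
    rw [← hμ.single_int] at hν
    subst hν
    refine ⟨?_, h⟩
    simp [SState.asserted, Term.subst]

end Inversion

end Backward

-- Reflection of single resolution steps

section Backward

variable {F : Type u} {P : Type v} {K : Type w}

variable {B : K → Set (List (Term F))} {prog₀ prog : Set (Rule F P K)} {T : Set (HypEntry F P K)}
  {target target' : Set (TClause F P K)} {V N J : Set ℕ} {c : List ℤ}
  {used used' used₁ used₁' : Finset ℕ} {ids : Finset ℤ}

/-- Steps of the target to the goal `G₁'` that use the unifier `Θ` are simulated by a resolution step
from the source goal with the leftmost atom `p(ts)` to a corresponding goal. -/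
def Reflects (prog₀ : Set (Rule F P K)) (T : Set (HypEntry F P K))
    (target : Set (TClause F P K)) (V N J : Set ℕ) (c : List ℤ) (used used' : Finset ℕ)
    (ids : Finset ℤ) (prog : Set (Rule F P K)) (target' : Set (TClause F P K)) (Z used₁' : Finset ℕ)
    (p : P) (ts : List (Term F)) (q : Goal F P K) (Θ : Subst F) (G₁' : TGoal F P K) : Prop :=
  ∃ (R : Rule F P K) (ρ : Equiv.Perm ℕ) (σ : Subst F) (V₁ N₁ J₁ : Set ℕ) (used₁ : Finset ℕ),
    R ∈ prog ∧ R.pred = p ∧ used₁ = used ∪ (R.subst (renameBy ρ)).vars ∧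
    Disjoint (R.subst (renameBy ρ)).vars used ∧ IsMGU σ (R.subst (renameBy ρ)).args ts ∧
    Outcome T target V N J c used used' ids σ Θ V₁ used₁ used₁' ids ∅ ∧
    N ⊆ N₁ ∧ (∀ x ∈ N, x ∉ J → x ∉ J₁) ∧
    Linked prog₀ T target V₁ N₁ J₁ c used₁ used₁' ids prog target'
      (((R.subst (renameBy ρ)).body.append q).subst σ) G₁' ∧
    (∀ x ∈ used₁, x ∈ Z → x ∈ used₁')

/-- A resolution step with a translated program rule is simulated. -/
theorem ProgramInv.reflect_rule (hP : ProgramInv prog₀ T target prog target' c ids)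
    (hb : ∀ x, x ∈ V ∨ x ∈ N → x ∈ used ∨ x ∈ used') {l i k : ℕ} {ts : List (Term F)}
    (hc : HypEntry.IsCall V N l i k ts) {q : Goal F P K} {q' : TGoal F P K}
    (hq : Corresponds T V N (.ctx c) q q' J) (hl : l ∉ J) (hi : i ∉ J) (hk : k ∉ J)
    {R : Rule F P K} (hR : R ∈ prog₀) {n : ℕ} (hT : ∀ e ∈ R.entries n, e ∈ T)
    {ρ : Equiv.Perm ℕ} {Θ : Subst F} {Z : Finset ℕ}
    (hfresh : ∀ x ∈ ((R.clause n).subst (renameBy ρ)).vars, x ∉ used' ∧ x ∈ Z)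
    (hZ : ∀ x ∈ used, x ∈ Z → x ∈ used')
    (hΘ : IsMGU Θ (substArgs (renameBy ρ) (R.head n)) (ts ++ [.var l, .var i, .var k, .ctx c])) :
    Reflects prog₀ T target V N ({l, i, k} ∪ J) c used used' ids prog target' Z
      (used' ∪ ((R.clause n).subst (renameBy ρ)).vars) R.pred ts q Θ
      ((((R.tbody n).subst (renameBy ρ)).append q').subst Θ) := by
  have hmem : ∀ x ∈ (R.clause n).vars, ρ x ∈ ((R.clause n).subst (renameBy ρ)).vars := fun x hx =>
    TClause.mem_vars_renameBy.2 ⟨x, hx, rfl⟩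
  have hnew : ∀ x ∈ (R.clause n).vars, ρ x ∉ used ∧ ρ x ∉ used' := fun x hx =>
    have h := hfresh _ (hmem x hx)
    ⟨fun h' => h.1 (hZ _ h' h.2), h.1⟩
  have hVN : ∀ {x : ℕ}, x ∉ used ∧ x ∉ used' → x ∉ V ∧ x ∉ N := fun hx =>
    ⟨fun h => (hb _ (Or.inl h)).elim hx.1 hx.2, fun h => (hb _ (Or.inr h)).elim hx.1 hx.2⟩
  -- The source keeps the target's renaming on common variables. Variables of `R` that the
  -- translated clause lacks, such as locals of nested hypotheses, go outside `Z`.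
  obtain ⟨ρ', hin, hout⟩ := exists_perm_extension R.vars (R.vars ∩ (R.clause n).vars)
    (used ∪ used' ∪ Z) ρ ρ.injective.injOn (fun x hx => Finset.mem_union_right _
      (hfresh _ (hmem x (Finset.mem_inter.1 hx).2)).2)
  simp only [Finset.mem_union, not_or] at hout
  have hnew' : ∀ x ∈ R.vars, ρ' x ∉ used ∧ ρ' x ∉ used' := by
    intro x hx
    by_cases hxC : x ∈ R.vars ∩ (R.clause n).vars
    · rw [hin x hxC]
      exact hnew x (Finset.mem_inter.1 hxC).2
    · exact (hout x hx hxC).1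
  have hargs : ∀ x ∈ varsArgs R.args, x ∈ (R.clause n).vars ∧ x ∈ R.vars := fun x hx =>
    ⟨Rule.mem_clause_vars.2 (Or.inl hx), Finset.mem_union_left _ hx⟩
  obtain ⟨σ, hres⟩ := Rule.FreshFor.exists_source_resolution (fun x hx => hVN (hnew x hx)) hc hΘ
  have hres' := hres.congr (α' := renameBy ρ') hargs (fun x hx hx' => by
    rw [renameBy_apply, renameBy_apply, hin x (Finset.mem_inter.2 ⟨hx', hx⟩)])
  have hsep : ∀ x ∈ R.vars, ∀ z ∈ (R.clause n).vars, z ∉ R.vars → ρ' x ≠ ρ z := by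
    intro x hx z hz hz' h
    by_cases hxC : x ∈ R.vars ∩ (R.clause n).vars
    · rw [hin x hxC] at h
      exact hz' (ρ.injective h ▸ hx)
    · exact (hout x hx hxC).2 (h ▸ (hfresh _ (hmem z hz)).2)
  obtain ⟨V₁, N₁, J₁, hO, hN, hJ, hL⟩ := Rule.exists_linked hres' hc hq hl hi hk hb hP hT
    (fun x hx => hVN (hnew x hx)) (fun x hx => ⟨(hVN (hnew' x hx)).1, (hVN (hnew' x hx)).2,
      hsep x hx⟩)
  refine ⟨R, ρ', σ, V₁, N₁, J₁, _, hP.base hR, rfl, rfl, ?_, hres'.mgu, hO, hN, hJ, hL,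
    fun x hx hxZ => ?_⟩
  · refine Finset.disjoint_left.2 fun x hx => ?_
    obtain ⟨y, hy, rfl⟩ := Rule.mem_vars_renameBy.1 hx
    exact (hnew' y hy).1
  · rcases Finset.mem_union.1 hx with hx | hx
    · exact Finset.mem_union_left _ (hZ x hx hxZ)
    · obtain ⟨y, hy, rfl⟩ := Rule.mem_vars_renameBy.1 hx
      by_cases hyC : y ∈ R.vars ∩ (R.clause n).vars
      · rw [hin y hyC]
        exact Finset.mem_union_right _ (hmem y (Finset.mem_inter.1 hyC).2)
      · exact absurd hxZ (hout y hy hyC).2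

/-- A permutation of variables in a set does not move variables outside this set into it. -/
theorem perm_apply_mem_of_moved {π : Equiv.Perm ℕ} {M : Set ℕ} (hπ : ∀ x, π x ≠ x → x ∈ M) (x : ℕ) :
    π x = x ∨ x ∈ M ∧ π x ∈ M := by
  by_cases h : π x = x
  · exact Or.inl h
  · exact Or.inr ⟨hπ x h, hπ _ fun h' => h (π.injective h')⟩

/-- A resolution step with a translated hypothesis whose registration is found is simulated. -/
theorem ProgramInv.reflect_hypothesis (hC : IsCompiled prog₀ T target)
    (hP : ProgramInv prog₀ T target prog target' c ids)
    (hb : ∀ x, x ∈ V ∨ x ∈ N → x ∈ used ∨ x ∈ used') {l i k : ℕ} {ts : List (Term F)}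
    (hc : HypEntry.IsCall V N l i k ts) {q : Goal F P K} {q' : TGoal F P K}
    (hq : Corresponds T V N (.ctx c) q q' J) (hl : l ∉ J) (hi : i ∉ J) (hk : k ∉ J)
    {e : HypEntry F P K} (heT : e ∈ T) {η₀ : Subst F} {κ : ℕ → ℕ} {V₀ N₀ : Set ℕ}
    (hη : e.IsInstance η₀ κ V₀ N₀) (hVN₀ : Disjoint V₀ N₀)
    {d : List ℤ} (hR : d <:+ c → (⟨e.pred, substArgs η₀ e.args, e.body.subst η₀⟩ : Rule F P K) ∈ prog)
    {ρ ρ₂ : Equiv.Perm ℕ} {σ₁ σ₂ : Subst F} {Z : Finset ℕ}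
    (hfresh : ∀ x ∈ (e.clause.subst (renameBy ρ)).vars, x ∉ used' ∧ x ∈ Z)
    (hfresh₂ : ∀ x ∈ (((varList e.shared).subst η₀).subst (renameBy ρ₂)).vars, x ∉ used' ∧
      x ∉ (e.clause.subst (renameBy ρ)).vars ∧ x ∈ Z)
    (hZ : ∀ x ∈ used, x ∈ Z → x ∈ used')
    (hσ₁ : IsMGU σ₁ (substArgs (renameBy ρ) e.head) (ts ++ [.var l, .var i, .var k, .ctx c]))
    (hσ₂ : IsMGU σ₂ [.int e.id, ((varList e.shared).subst η₀).subst (renameBy ρ₂), .ctx d]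
      (substArgs σ₁
        [.int e.id, (varList e.shared).subst (renameBy ρ), .var (ρ (e.next + 2))])) :
    σ₁.comp σ₂ (ρ (e.next + 1)) = .ctx c ∧ σ₁.comp σ₂ (ρ (e.next + 2)) = .ctx d ∧
    (d <:+ c → Reflects prog₀ T target V N ({l, i, k} ∪ J) c used used' ids prog target' Z
      (used' ∪ (e.clause.subst (renameBy ρ)).vars ∪
        (((varList e.shared).subst η₀).subst (renameBy ρ₂)).vars) e.pred ts q (σ₁.comp σ₂)
      (((e.tbody.subst (renameBy ρ)).append q').subst (σ₁.comp σ₂))) := by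
  classical
  have he := hC.wellFormed e heT
  set X := (((varList e.shared).subst η₀).subst (renameBy ρ₂)).vars with hX
  set C := (e.clause.subst (renameBy ρ)).vars with hCdef
  have hmemC : ∀ x ∈ e.clause.vars, ρ x ∈ C := fun x hx => TClause.mem_vars_renameBy.2 ⟨x, hx, rfl⟩
  have hmemX : ∀ x ∈ e.shared, ∀ y ∈ (η₀.comp (renameBy ρ₂) x).vars, y ∈ X := fun x hx y hy => by
    rw [hX, ← Term.subst_comp]
    exact Term.mem_vars_subst.2 ⟨x, mem_varList_vars.2 hx, hy⟩
  have hnewC : ∀ x ∈ C, x ∉ used ∧ x ∉ used' := fun x hx =>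
    ⟨fun h => (hfresh x hx).1 (hZ x h (hfresh x hx).2), (hfresh x hx).1⟩
  have hnewX : ∀ x ∈ X, x ∉ used ∧ x ∉ used' := fun x hx =>
    ⟨fun h => (hfresh₂ x hx).1 (hZ x h (hfresh₂ x hx).2.2), (hfresh₂ x hx).1⟩
  have hVN : ∀ {x : ℕ}, x ∉ used ∧ x ∉ used' → x ∉ V ∧ x ∉ N := fun hx =>
    ⟨fun h => (hb _ (Or.inl h)).elim hx.1 hx.2, fun h => (hb _ (Or.inr h)).elim hx.1 hx.2⟩
  have hF : e.FreshFor (η₀.comp (renameBy ρ₂)) ρ V N := by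
    refine ⟨fun x hx => hVN (hnewC _ (hmemC x hx)), fun x hx y hy => ?_⟩
    have hy := hmemX x hx y hy
    exact ⟨(hVN (hnewX y hy)).1, (hVN (hnewX y hy)).2, fun z hz h =>
      (hfresh₂ y hy).2.1 (h ▸ hmemC z hz)⟩
  obtain ⟨π, σ, hres, hctx, hπ⟩ := hF.exists_source_resolution (c := c) (d := d) hc he hσ₁
    (by rw [Term.subst_comp]; exact hσ₂)
  refine ⟨hres.context, hctx, fun hd => ?_⟩
  have hRmem := hR hd
  set R : Rule F P K := ⟨e.pred, substArgs η₀ e.args, e.body.subst η₀⟩ with hRdef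
  set S₁ := e.shared.biUnion fun x => (η₀ x).vars with hS₁
  set L := e.clause.vars.filter (fun x => x ∈ e.vars ∧ x ∉ e.outer) with hL
  have hS₁V : ∀ x ∈ S₁, x ∈ V₀ ∧ ρ₂ x ∈ X := by
    intro x hx
    obtain ⟨y, hy, hx⟩ := Finset.mem_biUnion.1 hx
    exact ⟨hη.shared y hy x hx, hmemX y hy _ (Term.mem_vars_renameBy.2 ⟨x, hx, rfl⟩)⟩
  have hLN : ∀ x ∈ L, x ∈ e.clause.vars ∧ (x ∈ e.vars ∧ x ∉ e.outer) ∧ κ x ∈ N₀ := by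
    intro x hx
    have := Finset.mem_filter.1 hx
    exact ⟨this.1, this.2, (hη.rename x this.2.1 this.2.2).2⟩
  -- The source needs one renaming of the stored rule where the target has two: `ρ₂` for the
  -- registration and `ρ` for the clause. They combine because the terms for shared variables lie
  -- over `V₀` and the locals in `N₀`, which are disjoint.
  obtain ⟨f, hf₁, hf₂⟩ : ∃ f : ℕ → ℕ, (∀ x ∈ S₁, f x = ρ₂ x) ∧ ∀ x ∈ L, f (κ x) = ρ x := by
    refine ⟨fun y => if h : ∃ x ∈ L, κ x = y then ρ h.choose else ρ₂ y, fun x hx => ?_,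
      fun x hx => ?_⟩
    · beta_reduce
      rw [dif_neg]
      rintro ⟨y, hy, rfl⟩
      exact Set.disjoint_left.1 hVN₀ (hS₁V _ hx).1 (hLN y hy).2.2
    · have h : ∃ y ∈ L, κ y = κ x := ⟨x, hx, rfl⟩
      simp only [dif_pos h]
      rw [hη.inj (hLN _ h.choose_spec.1).2.1 (hLN x hx).2.1 h.choose_spec.2]
  have hS : ∀ y ∈ S₁ ∪ L.image κ, (y ∈ S₁ ∧ f y = ρ₂ y ∧ f y ∈ X) ∨
      ∃ x ∈ L, κ x = y ∧ f y = ρ x ∧ f y ∈ C := by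
    intro y hy
    rcases Finset.mem_union.1 hy with hy | hy
    · exact Or.inl ⟨hy, hf₁ y hy, by rw [hf₁ y hy]; exact (hS₁V y hy).2⟩
    · obtain ⟨x, hx, rfl⟩ := Finset.mem_image.1 hy
      exact Or.inr ⟨x, hx, rfl, hf₂ x hx, by rw [hf₂ x hx]; exact hmemC x (hLN x hx).1⟩
  obtain ⟨ρ₃, hin, hout⟩ := exists_perm_extension R.vars (S₁ ∪ L.image κ) (used ∪ used' ∪ Z) f
    (fun y hy z hz hyz => by
      rcases hS y hy with ⟨-, h1, h2⟩ | ⟨x, hx, rfl, h1, h2⟩ <;>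
        rcases hS z hz with ⟨-, h3, h4⟩ | ⟨x', hx', rfl, h3, h4⟩
      · exact ρ₂.injective (h1.symm.trans (hyz.trans h3))
      · exact absurd (hyz ▸ h4) (hfresh₂ _ h2).2.1
      · exact absurd (hyz ▸ h2) (hfresh₂ _ h4).2.1
      · rw [ρ.injective (h1.symm.trans (hyz.trans h3))])
    (fun y hy => Finset.mem_union_right _ (by
      rcases hS y hy with ⟨-, -, h2⟩ | ⟨x, hx, rfl, -, h2⟩
      · exact (hfresh₂ _ h2).2.2
      · exact (hfresh _ h2).2))
  simp only [Finset.mem_union, not_or] at hout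
  have hρ₃ : ∀ y ∈ R.vars, (ρ₃ y ∈ X ∪ C ∨ ρ₃ y ∉ Z) ∧ ρ₃ y ∉ used ∧ ρ₃ y ∉ used' := by
    intro y hy
    by_cases hyS : y ∈ S₁ ∪ L.image κ
    · rw [hin y hyS]
      rcases hS y hyS with ⟨-, -, h2⟩ | ⟨x, hx, rfl, -, h2⟩
      · exact ⟨Or.inl (Finset.mem_union_left _ h2), hnewX _ h2⟩
      · exact ⟨Or.inl (Finset.mem_union_right _ h2), hnewC _ h2⟩
    · have := hout y hy (by simpa only [Finset.mem_union, not_or] using hyS)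
      exact ⟨Or.inr this.2, this.1⟩
  -- `π` only permutes variables that these steps have just introduced. Composing it with the
  -- renaming `ρ₃` therefore keeps the source variant new.
  have hπM : ∀ x, π x ≠ x → x ∈ ((X ∪ C : Finset ℕ) : Set ℕ) := by
    intro x hx
    rcases hπ x hx with ⟨y, hy, rfl⟩ | ⟨y, hy, hx⟩
    · exact Finset.mem_coe.2 (Finset.mem_union_right _
        (hmemC y (HypEntry.mem_clause_vars.2 (Or.inr (Or.inl hy)))))
    · exact Finset.mem_coe.2 (Finset.mem_union_left _ (hmemX y hy x hx))
  have hnew : ∀ x ∈ X ∪ C, x ∉ used ∧ x ∉ used' := fun x hx =>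
    (Finset.mem_union.1 hx).elim (hnewX x) (hnewC x)
  have hρ' : ∀ y ∈ R.vars, (π (ρ₃ y) ∈ X ∪ C ∨ π (ρ₃ y) ∉ Z) ∧ π (ρ₃ y) ∉ used ∧ π (ρ₃ y) ∉ used' := by
    intro y hy
    rcases perm_apply_mem_of_moved hπM (ρ₃ y) with h | ⟨-, h⟩
    · rw [h]
      exact hρ₃ y hy
    · exact ⟨Or.inl (Finset.mem_coe.1 h), hnew _ (Finset.mem_coe.1 h)⟩
  have hmemR : ∀ x ∈ e.vars, ∀ y ∈ (η₀ x).vars, y ∈ R.vars := fun x hx y hy =>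
    HypEntry.IsInstance.mem_vars hx hy
  have hα : ∀ x ∈ e.clause.vars, x ∈ e.vars →
      ((e.mixed (η₀.comp (renameBy ρ₂)) ρ).comp (renameBy π)) x =
        η₀.comp (renameBy (ρ₃.trans π)) x := by
    intro x hx hx'
    rw [← renameBy_comp, ← Subst.comp_assoc, Subst.comp, Subst.comp, HypEntry.mixed]
    congr 1
    split_ifs with hs
    · refine Term.subst_congr fun y hy => ?_
      have hy : y ∈ S₁ := Finset.mem_biUnion.2 ⟨x, hs, hy⟩
      rw [renameBy_apply, renameBy_apply, hin y (Finset.mem_union_left _ hy), hf₁ y hy]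
    · have hxo : x ∉ e.outer := fun h => hs (Finset.mem_inter.2 ⟨hx', h⟩)
      have hxL : x ∈ L := Finset.mem_filter.2 ⟨hx, hx', hxo⟩
      rw [Subst.comp, (hη.rename x hx' hxo).1, Term.subst, renameBy_apply,
        hin _ (Finset.mem_union_right _ (Finset.mem_image_of_mem κ hxL)), hf₂ x hxL]
  have hargs : ∀ x ∈ varsArgs e.args, x ∈ e.clause.vars ∧ x ∈ e.vars := fun x hx =>
    HypEntry.mem_clause_vars_of_mem_args hx
  have hres' := hres.congr hargs hα
  obtain ⟨V₁, N₁, J₁, hO, hN, hJ, hlink⟩ := HypEntry.exists_linked hres' hc hq hl hi hk hb hP he hη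
    hVN₀ hF.rename (used₁ := used ∪ (R.subst (renameBy (ρ₃.trans π))).vars)
    (used₁' := used' ∪ C ∪ X)
    (fun x hx y hy => by
      have hyR := hmemR x hx y hy
      refine ⟨(hVN (hρ' y hyR).2).1, (hVN (hρ' y hyR).2).2, fun z hz hz' h => ?_⟩
      -- A moved variable is the copy of a shared variable or comes from the registration; `ρ z` is
      -- neither.
      have hπz : π (ρ z) = ρ z := by
        by_contra hne
        rcases hπ _ hne with ⟨w, hw, h⟩ | ⟨w, hw, h⟩
        · exact hz' (ρ.injective h ▸ (Finset.mem_inter.1 hw).1)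
        · exact (hF.shared w hw _ h).2.2 z hz rfl
      have h : ρ₃ y = ρ z := π.injective (h.trans hπz.symm)
      by_cases hyS : y ∈ S₁ ∪ L.image κ
      · rw [hin y hyS] at h
        rcases hS y hyS with ⟨-, -, h2⟩ | ⟨x, hx, rfl, h1, -⟩
        · exact (hfresh₂ _ h2).2.1 (h ▸ hmemC z hz)
        · exact hz' (ρ.injective (h1.symm.trans h) ▸ (hLN x hx).2.1.1)
      · have := hout y hyR (by simpa only [Finset.mem_union, not_or] using hyS)
        exact this.2 (h ▸ (hfresh _ (hmemC z hz)).2))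
    Finset.subset_union_left (Finset.subset_union_left.trans Finset.subset_union_left)
    (fun x hx y hy => Finset.mem_union_right _
      (Rule.mem_vars_renameBy.2 ⟨y, hmemR x hx y hy, rfl⟩))
    (fun x hx => Finset.mem_union_left _ (Finset.mem_union_right _ (hmemC x hx)))
  refine ⟨R, ρ₃.trans π, σ, V₁, N₁, J₁, _, hRmem, rfl, rfl, ?_, ?_, hO, hN, hJ, ?_,
    fun x hx hxZ => ?_⟩
  · refine Finset.disjoint_left.2 fun x hx => ?_
    obtain ⟨y, hy, rfl⟩ := Rule.mem_vars_renameBy.1 hx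
    exact (hρ' y hy).2.1
  · have := hres'.mgu
    rwa [substArgs_comp] at this
  · rwa [Goal.subst_comp] at hlink
  · rcases Finset.mem_union.1 hx with hx | hx
    · exact Finset.mem_union_left _ (Finset.mem_union_left _ (hZ x hx hxZ))
    · obtain ⟨y, hy, rfl⟩ := Rule.mem_vars_renameBy.1 hx
      rcases (hρ' y hy).1 with h | h
      · rcases Finset.mem_union.1 h with h | h
        · exact Finset.mem_union_right _ h
        · exact Finset.mem_union_left _ (Finset.mem_union_right _ h)
      · exact absurd hxZ h

end Backward

-- Reflection of entire derivations

section Backward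

variable {F : Type u} {P : Type v} {K : Type w}

variable {B : K → Set (List (Term F))} {prog₀ prog : Set (Rule F P K)} {T : Set (HypEntry F P K)}
  {target target' : Set (TClause F P K)} {V N J : Set ℕ} {c : List ℤ}
  {used used' used₁ used₁' : Finset ℕ} {ids : Finset ℤ}

theorem TClause.subst_eq_regFact {C : TClause F P K} {σ : Subst F} {i xs c : Term F}
    (h : C.subst σ = .regFact i xs c) : ∃ i' xs' c', C = .regFact i' xs' c' := by
  cases C with
  | rule => simp [TClause.subst] at h
  | regFact i' xs' c' => exact ⟨_, _, _, rfl⟩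

theorem SStepsN.used_subset_of_mem {n : ℕ} {s t : SState F P K} {A : Set (TClause F P K)}
    (h : SStepsN B n s A t) {Z : Finset ℕ} (ht : t.used ⊆ Z) {X : Finset ℕ} (hX : X ⊆ s.used) :
    ∀ x ∈ X, x ∈ Z := fun _ hx => ht (h.used_subset (hX hx))

/-- The first resolution steps of a successful derivation from a translated call are simulated. -/
theorem SStepsN.reflect_user (hC : IsCompiled prog₀ T target)
    (hP : ProgramInv prog₀ T target prog target' c ids)
    (hb : ∀ x, x ∈ V ∨ x ∈ N → x ∈ used ∨ x ∈ used') {l i k : ℕ} {ts : List (Term F)}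
    (hc : HypEntry.IsCall V N l i k ts) {q : Goal F P K} {q' : TGoal F P K}
    (hq : Corresponds T V N (.ctx c) q q' J) (hl : l ∉ J) (hi : i ∉ J) (hk : k ∉ J)
    {n : ℕ} {p : P} {K' : TGoal F P K} {θ : Subst F} {A : Set (TClause F P K)} {t : SState F P K}
    (h : SStepsN B n ⟨(TGoal.user p (ts ++ [.var l, .var i, .var k, .ctx c]) q').append K', θ,
      target', used', ids⟩ A t) (ht : t.goal = .nil) {Z : Finset ℕ} (htZ : t.used ⊆ Z)
    (hZ : ∀ x ∈ used, x ∈ Z → x ∈ used') :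
    ∃ m < n, ∃ Θ used₁' G₁', Reflects prog₀ T target V N ({l, i, k} ∪ J) c used used' ids prog
        target' Z used₁' p ts q Θ G₁' ∧
      SStepsN B m ⟨G₁'.append (K'.subst Θ), θ.comp Θ, target', used₁', ids⟩ A t := by
  obtain ⟨m, s, A', rfl, hs, h, rfl⟩ := h.exists_head ht (by simp [TGoal.append])
  obtain ⟨us, b, C, ρ, σ₁, hCmem, hC', hfresh, hσ₁, rfl⟩ := hs.user_inv
  have hCt : C ∈ target := by
    rcases hP.clause C hCmem with h | ⟨i, X, j, s, rfl, -⟩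
    · exact h
    · simp [TClause.subst] at hC'
  have hZC := h.used_subset_of_mem htZ Finset.subset_union_right
  have hfreshC : ∀ x ∈ (C.subst (renameBy ρ)).vars, x ∉ used' ∧ x ∈ Z := fun x hx =>
    ⟨Finset.disjoint_left.1 hfresh hx, hZC x hx⟩
  have hA : (SState.mk ((TGoal.user p (ts ++ [.var l, .var i, .var k, .ctx c]) q').append K') θ
      target' used' ids).asserted = ∅ := rfl
  rw [hA, Set.empty_union]
  rw [← TGoal.append_assoc, TGoal.subst_append] at h
  rcases hC.clause C hCt with ⟨R, hR, n, rfl, hT⟩ | ⟨e, he, rfl⟩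
  · simp only [Rule.clause, TClause.subst, TClause.rule.injEq] at hC'
    obtain ⟨rfl, rfl, rfl⟩ := hC'
    exact ⟨m, by omega, σ₁, _, _, hP.reflect_rule hb hc hq hl hi hk hR hT hfreshC hZ hσ₁, h⟩
  · simp only [HypEntry.clause, TClause.subst, TClause.rule.injEq] at hC'
    obtain ⟨rfl, rfl, rfl⟩ := hC'
    rw [← TGoal.subst_append, TGoal.append_assoc] at h
    simp only [HypEntry.guarded, TGoal.subst, TGoal.append] at h
    obtain ⟨m, s, A', rfl, hs, h, rfl⟩ := h.exists_head ht (by simp)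
    obtain ⟨i', xs', c', C, ρ₂, σ₂, hCmem, hC', hfresh₂, hσ₂, rfl⟩ := hs.reg_inv
    -- The translated program itself contains no `reg` facts, so the clause found was asserted
    -- earlier and describes an instance of some hypothesis `e'`.
    obtain ⟨id, X, j, s, rfl, -, R, ⟨V₀, N₀, hVN₀, e', he', η, κ, hη, rfl, rfl, rfl⟩, hR⟩ :
        ∃ (i : ℕ) (X : Term F) (j : ℤ) (s : List ℤ),
          C = .regFact (.int i) X (.ctx (j :: s)) ∧ j ∈ ids ∧
            ∃ R, Registers T R i X ∧ (j :: s <:+ c → R ∈ prog) := by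
      obtain ⟨i', xs', c', rfl⟩ := TClause.subst_eq_regFact hC'
      rcases hP.clause _ hCmem with h | h
      · rcases hC.clause _ h with ⟨R, -, n, h, -⟩ | ⟨e, -, h⟩
        · simp [Rule.clause] at h
        · simp [HypEntry.clause] at h
      · exact h
    simp only [TClause.subst, Term.subst, Term.subst_ctx, TClause.regFact.injEq] at hC'
    obtain ⟨rfl, rfl, rfl⟩ := hC'
    -- The first arguments of the two `reg` atoms are integers. Their equality identifies the
    -- hypothesis of the registration with that of the clause.
    have hid : e'.id = e.id := by
      have := hσ₂.unifies
      simpa [substArgs, Term.subst] using (List.cons.inj this).1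
    obtain rfl := hC.id_inj e' he' e he hid
    have hvars : ((TClause.regFact (.int e'.id) ((varList e'.shared).subst η) (.ctx (j :: s)) :
        TClause F P K).subst (renameBy ρ₂)).vars =
        (((varList e'.shared).subst η).subst (renameBy ρ₂)).vars := by
      simp [TClause.subst, TClause.vars, Term.subst, Term.vars, Term.subst_ctx]
    rw [hvars] at hfresh₂ h
    have hZX := h.used_subset_of_mem htZ Finset.subset_union_right
    obtain ⟨hctx, hctx', href⟩ := hP.reflect_hypothesis hC hb hc hq hl hi hk he hη hVN₀ hR hfreshC
      (fun x hx => ⟨fun h => Finset.disjoint_left.1 hfresh₂ hx (Finset.mem_union_left _ h),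
        fun h => Finset.disjoint_left.1 hfresh₂ hx (Finset.mem_union_right _ h), hZX x hx⟩) hZ hσ₁ hσ₂
    obtain ⟨m, s', A', rfl, hs, h, rfl⟩ := h.exists_head ht (by simp [TGoal.subst])
    simp only [TGoal.subst] at hs
    obtain ⟨c₁, c₂, h1, h2, hsuf, rfl⟩ := hs.chk_inv
    have h1 : σ₁.comp σ₂ (ρ (e'.next + 2)) = .ctx c₁ := h1
    have h2 : σ₁.comp σ₂ (ρ (e'.next + 1)) = .ctx c₂ := h2
    rw [hctx'] at h1
    rw [hctx] at h2
    -- The arguments of `chk` are already the registered and the current context, so its success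
    -- gives the prefix relation under which the rule is available in the source.
    obtain rfl := Term.ctx_injective h1
    obtain rfl := Term.ctx_injective h2
    refine ⟨m, by omega, _, _, _, href hsuf, ?_⟩
    rw [← TGoal.subst_comp, ← TGoal.append_assoc, TGoal.subst_append, Subst.comp_assoc] at h
    simpa [SState.asserted, TGoal.subst] using h

/-- Successful derivations from a translated goal are simulated by hypothetical derivations. -/
theorem SStepsN.reflect (hC : IsCompiled prog₀ T target) (n : ℕ) :
    ∀ {V N J : Set ℕ} {c : List ℤ} {used used' : Finset ℕ} {ids : Finset ℤ}
      {prog : Set (Rule F P K)} {target' : Set (TClause F P K)} {G : Goal F P K}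
      {G' K' : TGoal F P K} {θ : Subst F} {A : Set (TClause F P K)} {t : SState F P K}
      {Z : Finset ℕ}, Linked prog₀ T target V N J c used used' ids prog target' G G' →
      SStepsN B n ⟨G'.append K', θ, target', used', ids⟩ A t → t.goal = .nil → t.used ⊆ Z →
      (∀ x ∈ used, x ∈ Z → x ∈ used') →
      ∃ m ≤ n, ∃ σ σ' V₁ used₁ used₁' ids₁ A₁ A₂, HBig B prog used G σ used₁ ∧
        Outcome T target V N J c used used' ids σ σ' V₁ used₁ used₁' ids₁ A₁ ∧
        (∀ x ∈ used₁, x ∈ Z → x ∈ used₁') ∧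
        SStepsN B m ⟨K'.subst σ', θ.comp σ', target' ∪ A₁, used₁', ids₁⟩ A₂ t ∧ A = A₁ ∪ A₂ := by
  induction n using Nat.strong_induction_on with
  | _ n ih =>
    intro V N J c used used' ids prog target' G G' K' θ A t Z hL h ht htZ hZ
    obtain ⟨hVN, hb, hcor, hP⟩ := hL
    cases hcor with
    | nil =>
      refine ⟨n, le_rfl, _, _, _, _, _, _, _, A, .nil, .refl (fun x hx => hb x (Or.inl hx)) hVN, hZ,
        ?_, (Set.empty_union A).symm⟩
      rw [TGoal.subst_id, Subst.comp_id, Set.union_empty]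
      exact h
    | @user _ p ts q q' l i k J hts hlN hiN hkN hli hlk hik hlJ hiJ hkJ hq =>
      have hc : HypEntry.IsCall V N l i k ts := ⟨hVN, hts, hlN, hiN, hkN, hli, hlk, hik⟩
      obtain ⟨m, hm, Θ, used₁', G₁', ⟨R, ρ, σ, V₁, N₁, J₁, used₁, hR, hp, rfl, hdisj, hσ, hO, hN, hJ,
        hL, hZ'⟩, h⟩ := h.reflect_user hC hP hb hc hq hlJ hiJ hkJ ht htZ hZ
      obtain ⟨m', hm', σ', Θ', V₂, used₂, used₂', ids₂, A₁, A₂, hbig, hO', hZ'', h', rfl⟩ :=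
        ih m hm hL h ht htZ hZ'
      have hO'' := hO.comp hO' hN hJ List.suffix_rfl
      rw [Set.empty_union] at hO''
      refine ⟨m', by omega, _, _, _, _, _, _, _, A₂, .rule ρ hR hdisj hp hσ hbig, hO'', hZ'', ?_, rfl⟩
      rwa [← TGoal.subst_comp, Subst.comp_assoc] at h'
    | @builtin _ k ts q q' J hts hq =>
      obtain ⟨m, s, A', rfl, hs, h, rfl⟩ := h.exists_head ht (by simp [TGoal.append])
      obtain ⟨us, ρ, σ, hB, hfresh, hσ, rfl⟩ := hs.builtin_inv
      have hZu := h.used_subset_of_mem htZ Finset.subset_union_right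
      have hfresh' : Disjoint (varsArgs (substArgs (renameBy ρ : Subst F) us)) used :=
        Finset.disjoint_left.2 fun x hx hx' =>
          Finset.disjoint_left.1 hfresh hx (hZ x hx' (hZu x hx))
      obtain ⟨V₁, hO, hL⟩ := Linked.exists_linked_builtin ⟨hVN, hb, .builtin (k := k) hts hq, hP⟩ hσ
        (fun x hx hx' => (hb x (Or.inr hx')).elim (Finset.disjoint_left.1 hfresh' hx)
          (Finset.disjoint_left.1 hfresh hx))
      rw [TGoal.subst_append] at h
      obtain ⟨m', hm', σ', Θ', V₂, used₂, used₂', ids₂, A₁, A₂, hbig, hO', hZ'', h', rfl⟩ :=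
        ih m (by omega) hL h ht htZ (fun x hx hxZ => (Finset.mem_union.1 hx).elim
          (fun hx => Finset.mem_union_left _ (hZ x hx hxZ)) (fun hx => Finset.mem_union_right _ hx))
      have hO'' := hO.comp hO' subset_rfl (fun x _ h => h) List.suffix_rfl
      rw [Set.empty_union] at hO''
      refine ⟨m', by omega, _, _, _, _, _, _, _, A₂, .builtin ρ hB hfresh' hσ hbig, hO'', hZ'', ?_, ?_⟩
      · rwa [← TGoal.subst_comp, Subst.comp_assoc] at h'
      · simp [SState.asserted, TGoal.append]
    | @imp _ p ts b g q g' q' i v X J J' hH hvN hvJ hvJ' hJ hcg hcq =>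
      obtain ⟨m, hm, z, hz, A', hstep⟩ := h.imp_inv ht
      obtain ⟨hA, h⟩ := hstep _ rfl
      obtain ⟨hX, hO, hL, hcq'⟩ := Linked.assume hC hVN hb hP hH hvN hvJ hvJ' hcg hcq hz rfl
      set μ : Subst F := Function.update Term.var v (.int z) with hμ
      rw [hX, Term.subst_ctx, ← Term.ctx_cons] at hA h
      -- The goal of the implication is solved first, with the rest of the goal as continuation. The
      -- induction hypothesis returns the point where it is finished, and what remains is at most as
      -- long as the derivation after the `call`.
      obtain ⟨m₁, hm₁, σ, σ', V₁, used₁, used₁', ids₁, A₁, A₂, hbig₁, hO₁, hZ₁, h₁, rfl⟩ :=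
        ih m hm hL h ht htZ hZ
      have hcq₁ := hcq'.subst hO₁.supported hO₁.subset hO₁.disjoint hO₁.agree
        (fun x hx => hO₁.hidden x (hcq'.subset hx) (Set.disjoint_right.1 hJ hx))
      rw [Term.subst_ctx] at hcq₁
      have hO' := hO.comp hO₁ subset_rfl (fun x _ h hx => h (Or.inl (Or.inr hx)))
        (List.suffix_cons z c)
      have hP' := hP.union (A := {.regFact (.int i) X (.ctx (z :: c))} ∪ A₁) hO'.ids_subset hO'.facts
      rw [TGoal.subst_append, TGoal.subst_append, Set.union_assoc target'] at h₁
      obtain ⟨m₂, hm₂, τ, τ', V₂, used₂, used₂', ids₂, A₃, A₄, hbig₂, hO₂, hZ₂, h₂, rfl⟩ :=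
        ih m₁ (by omega) ⟨hO₁.disjoint, fun x hx => hx.elim (hO₁.bounded x) fun hx =>
          (hb x (Or.inr hx)).imp (@hO'.used_subset x) (@hO'.used_subset' x), hcq₁, hP'⟩ h₁ ht htZ hZ₁
      have hO'' := hO'.comp hO₂ subset_rfl (fun x _ h hx => h (Or.inr hx)) List.suffix_rfl
      rw [Subst.id_comp] at hO''
      refine ⟨m₂, by omega, _, _, _, _, _, _, _, A₄, .hyp hbig₁ hbig₂, hO'', hZ₂, ?_, ?_⟩
      · rw [← TGoal.subst_comp, ← TGoal.subst_comp, Subst.comp_assoc, Subst.comp_assoc,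
          Set.union_assoc target'] at h₂
        rwa [Subst.comp_assoc]
      · rw [hA]
        simp only [Set.union_assoc]

end Backward

-- The translated program and the initial states

section Translation

variable {F : Type u} {P : Type v} {K : Type w}

theorem HypEntry.WellFormed.mono {T T' : Set (HypEntry F P K)} {e : HypEntry F P K}
    (h : e.WellFormed T) (hT : T ⊆ T') : e.WellFormed T' :=
  ⟨h.vars_lt, h.outer_lt, fun e' he' => hT (h.entries_mem e' he')⟩

/-- The hypotheses of the embedded implications in a list of program rules with identifiers from `i` on. -/
def rulesEntries : List (Rule F P K) → ℕ → List (HypEntry F P K)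
  | [], _ => []
  | R :: Rs, i => R.entries i ++ rulesEntries Rs (R.translate i).2

theorem Rule.translate_eq (R : Rule F P K) (i : ℕ) :
    (R.translate i).1 = R.clause i :: (R.entries i).map HypEntry.clause := by
  rw [Rule.translate, Rule.entries, ← Goal.translate_hyps]
  rfl

theorem translateRules_cons (R : Rule F P K) (Rs : List (Rule F P K)) (i : ℕ) :
    translateRules (R :: Rs) i = (R.clause i :: (R.entries i).map HypEntry.clause ++
      (translateRules Rs (R.translate i).2).1, (translateRules Rs (R.translate i).2).2) := by
  rw [translateRules, Rule.translate_eq]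

theorem Rule.entries_id (R : Rule F P K) (i : ℕ) : i < (R.translate i).2 ∧
    (∀ e ∈ R.entries i, i ≤ e.id ∧ e.id < (R.translate i).2) ∧
      ((R.entries i).map HypEntry.id).Nodup := by
  have h := Goal.entries_id R.body (.var (freshVar R.vars)) (varsArgs R.args) (freshVar R.vars + 1)
    (i + 1)
  have h' := (Goal.translate_le R.body (.var (freshVar R.vars)) (varsArgs R.args)
    (freshVar R.vars + 1) (i + 1)).2
  refine ⟨h', fun e he => ?_, h.2⟩
  have := h.1 e he
  exact ⟨by omega, this.2⟩

/-- Successive rules receive successive ranges of identifiers, so no identifier is used twice in the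
table. -/
theorem rulesEntries_id (Rs : List (Rule F P K)) : ∀ i, i ≤ (translateRules Rs i).2 ∧
    (∀ e ∈ rulesEntries Rs i, i ≤ e.id ∧ e.id < (translateRules Rs i).2) ∧
      ((rulesEntries Rs i).map HypEntry.id).Nodup := by
  induction Rs with
  | nil => intro i; simp [rulesEntries, translateRules]
  | cons R Rs ih =>
    intro i
    have h1 := R.entries_id i
    have h2 := ih (R.translate i).2
    simp only [translateRules_cons, rulesEntries, List.mem_append, List.map_append]
    refine ⟨by omega, ?_, List.nodup_append.2 ⟨h1.2.2, h2.2.2, ?_⟩⟩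
    · rintro e (he | he)
      · have := h1.2.1 e he
        omega
      · have := h2.2.1 e he
        omega
    · intro x hx y hy
      obtain ⟨e, he, rfl⟩ := List.mem_map.1 hx
      obtain ⟨e', he', rfl⟩ := List.mem_map.1 hy
      have := h1.2.1 e he
      have := h2.2.1 e' he'
      omega

theorem rulesEntries_wellFormed (Rs : List (Rule F P K)) : ∀ i, ∀ e ∈ rulesEntries Rs i,
    e.WellFormed {e | e ∈ rulesEntries Rs i} := by
  induction Rs with
  | nil => simp [rulesEntries]
  | cons R Rs ih =>
    intro i e he
    rcases List.mem_append.1 he with he | he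
    · refine (Goal.entries_wellFormed R.body _ _ _ _ (fun x hx => ?_) (fun x hx => ?_) e he).mono
        fun e' he' => List.mem_append_left _ he'
      · have := Rule.lt_freshVar (R := R) (Finset.mem_union_right _ hx)
        omega
      · have := Rule.lt_freshVar (R := R) (Finset.mem_union_left _ hx)
        omega
    · exact (ih _ e he).mono fun e' he' => List.mem_append_right _ he'

theorem mem_translateRules (Rs : List (Rule F P K)) : ∀ (i : ℕ) (C : TClause F P K),
    C ∈ (translateRules Rs i).1 → (∃ R ∈ Rs, ∃ n, C = R.clause n ∧
      ∀ e ∈ R.entries n, e ∈ rulesEntries Rs i) ∨ ∃ e ∈ rulesEntries Rs i, C = e.clause := by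
  induction Rs with
  | nil => simp [translateRules]
  | cons R Rs ih =>
    intro i C hC
    simp only [translateRules_cons, List.mem_append, List.mem_cons, List.mem_map] at hC
    simp only [rulesEntries, List.mem_append]
    rcases hC with (rfl | ⟨e, he, rfl⟩) | hC
    · exact Or.inl ⟨R, List.mem_cons_self, i, rfl, fun e he => Or.inl he⟩
    · exact Or.inr ⟨e, Or.inl he, rfl⟩
    · rcases ih _ C hC with ⟨R', hR', n, h1, h2⟩ | ⟨e, he, h⟩
      · exact Or.inl ⟨R', List.mem_cons_of_mem _ hR', n, h1, fun e he => Or.inr (h2 e he)⟩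
      · exact Or.inr ⟨e, Or.inr he, h⟩

theorem clause_mem_translateRules (Rs : List (Rule F P K)) : ∀ i : ℕ,
    (∀ R ∈ Rs, ∃ n, R.clause n ∈ (translateRules Rs i).1 ∧
      ∀ e ∈ R.entries n, e ∈ rulesEntries Rs i) ∧
    ∀ e ∈ rulesEntries Rs i, e.clause ∈ (translateRules Rs i).1 := by
  induction Rs with
  | nil => simp [rulesEntries]
  | cons R Rs ih =>
    intro i
    have h := ih (R.translate i).2
    simp only [rulesEntries, translateRules_cons, List.mem_append, List.mem_cons, List.mem_map]
    refine ⟨?_, ?_⟩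
    · rintro R' (rfl | hR')
      · exact ⟨i, Or.inl (Or.inl rfl), fun e he => Or.inl he⟩
      · obtain ⟨n, h1, h2⟩ := h.1 R' hR'
        exact ⟨n, Or.inr h1, fun e he => Or.inr (h2 e he)⟩
    · rintro e (he | he)
      · exact Or.inl (Or.inr ⟨e, he, rfl⟩)
      · exact Or.inr (h.2 e he)

/-- The hypotheses of the embedded implications of the initial goal. -/
def queryEntries (prog : List (Rule F P K)) (Q : Goal F P K) : List (HypEntry F P K) :=
  Q.entries .nil ∅ (freshVar Q.vars) (translateRules prog 0).2

theorem translateQuery_hyps (prog : List (Rule F P K)) (Q : Goal F P K) :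
    (translateQuery prog Q).hyps = (queryEntries prog Q).map HypEntry.clause :=
  Goal.translate_hyps ..

theorem Goal.lt_freshVar {Q : Goal F P K} {x : ℕ} (hx : x ∈ Q.vars) : x < freshVar Q.vars :=
  Nat.lt_succ_of_le (Finset.le_sup (f := id) hx)

/-- The translation of a program and an initial goal. -/
theorem isCompiled_programTranslation (prog : List (Rule F P K)) (Q : Goal F P K) :
    IsCompiled {R | R ∈ prog} {e | e ∈ rulesEntries prog 0 ++ queryEntries prog Q}
      (programTranslation prog Q) := by
  have hr := clause_mem_translateRules prog 0
  refine ⟨fun C hC => ?_, fun R hR => ?_, fun e he => ?_, fun e he => ?_, ?_⟩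
  · rcases List.mem_append.1 hC with hC | hC
    · rcases mem_translateRules prog 0 C hC with ⟨R, hR, n, h1, h2⟩ | ⟨e, he, h⟩
      · exact Or.inl ⟨R, hR, n, h1, fun e he => List.mem_append_left _ (h2 e he)⟩
      · exact Or.inr ⟨e, List.mem_append_left _ he, h⟩
    · rw [translateQuery_hyps] at hC
      obtain ⟨e, he, rfl⟩ := List.mem_map.1 hC
      exact Or.inr ⟨e, List.mem_append_right _ he, rfl⟩
  · obtain ⟨n, h1, h2⟩ := hr.1 R hR
    exact ⟨n, List.mem_append_left _ h1, fun e he => List.mem_append_left _ (h2 e he)⟩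
  · rcases List.mem_append.1 he with he | he
    · exact List.mem_append_left _ (hr.2 e he)
    · refine List.mem_append_right _ ?_
      rw [translateQuery_hyps]
      exact List.mem_map_of_mem he
  · rcases List.mem_append.1 he with he | he
    · exact (rulesEntries_wellFormed prog 0 e he).mono fun e' he' => List.mem_append_left _ he'
    · exact (Goal.entries_wellFormed Q _ _ _ _ (fun x hx => Goal.lt_freshVar hx) (by simp) e he).mono
        fun e' he' => List.mem_append_right _ he'
  · have h1 := rulesEntries_id prog 0
    have h2 := Goal.entries_id Q .nil ∅ (freshVar Q.vars) (translateRules prog 0).2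
    -- The identifiers for the initial goal start where those of the program end.
    refine List.inj_on_of_nodup_map ?_
    rw [List.map_append]
    refine List.nodup_append.2 ⟨h1.2.2, h2.2, fun x hx y hy => ?_⟩
    obtain ⟨e, he, rfl⟩ := List.mem_map.1 hx
    obtain ⟨e', he', rfl⟩ := List.mem_map.1 hy
    have := h1.2.1 e he
    have := h2.1 e' he'
    omega

/-- The initial states correspond. -/
theorem exists_linked_init (prog : List (Rule F P K)) (Q : Goal F P K) {W : Finset ℕ}
    (hW : Q.vars ∪ (goalTranslation prog Q).vars ⊆ W) :
    ∃ V N J, (∀ x ∈ Q.vars, x ∈ V ∨ x ∈ N ∧ x ∉ J) ∧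
      Linked {R | R ∈ prog} {e | e ∈ rulesEntries prog 0 ++ queryEntries prog Q}
        (programTranslation prog Q) V N J [] W W ∅ {R | R ∈ prog} (programTranslation prog Q) Q
        (goalTranslation prog Q) := by
  have hlt : ∀ {x}, x ∈ Q.vars → x < freshVar Q.vars := fun hx => Goal.lt_freshVar hx
  have hloc : ∀ {x}, x ∈ Q.locals ∅ → x ∈ Q.vars := fun hx => (Goal.locals_subset hx).1
  -- Variables of `Q` that are local to an assumed hypothesis are private from the start, as the
  -- translated goal does not contain them.
  set V : Set ℕ := {x | x ∈ Q.vars ∧ x ∉ Q.locals ∅} with hV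
  set N : Set ℕ := {x | x ∈ Q.locals ∅ ∨ x ∈ (goalTranslation prog Q).vars ∧ freshVar Q.vars ≤ x}
    with hN
  have hVN : Disjoint V N := Set.disjoint_left.2 fun x hx hx' => by
    rcases hx' with hx' | hx'
    · exact hx.2 hx'
    · have := hlt hx.1
      omega
  obtain ⟨J, hJ, hJs⟩ := Goal.corresponds_translate
    (T := {e | e ∈ rulesEntries prog 0 ++ queryEntries prog Q}) (V := V) (N := N)
    (τ := Subst.id) (τ' := Subst.id) (κ := fun x => x) (ι := fun x => x) Q .nil ∅ (freshVar Q.vars)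
    (translateRules prog 0).2 (fun x hx => hlt hx) (by simp [Term.vars])
    (fun e he => List.mem_append_right _ he) (fun x hx hx' => ⟨rfl, fun y hy => by
      rw [Subst.id, Term.vars, Finset.mem_singleton] at hy
      subst hy
      rcases Goal.translate_vars _ _ _ _ _ _ hx with h | h | h
      · simp [Term.vars] at h
      · have := hlt hx'
        omega
      · exact h⟩) (fun x hx => ⟨rfl, Or.inl hx⟩) (fun _ _ _ _ h => h)
    (fun x hx hx' => ⟨rfl, Or.inr ⟨hx, hx'⟩⟩) (fun _ _ _ _ h => h)
  rw [Goal.subst_id, TGoal.subst_id] at hJ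
  refine ⟨V, N, J, fun x hx => ?_, hVN, fun x hx => Or.inl ?_, hJ, ?_⟩
  · by_cases hx' : x ∈ Q.locals ∅
    · refine Or.inr ⟨Or.inl hx', fun hxJ => ?_⟩
      obtain ⟨y, ⟨-, h, -⟩, rfl⟩ := hJs hxJ
      exact absurd h (not_le_of_gt (hlt hx))
    · exact Or.inl ⟨hx, hx'⟩
  · rcases hx with hx | hx | hx
    · exact hW (Finset.mem_union_left _ hx.1)
    · exact hW (Finset.mem_union_left _ (hloc hx))
    · exact hW (Finset.mem_union_right _ hx.1)
  · exact ⟨subset_rfl, subset_rfl, fun R hR => Or.inl hR, fun C hC => Or.inl hC⟩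

/-- Visible variables have equal values by agreement. A private variable outside `J` is moved by
neither substitution. -/
theorem Outcome.eq_of_mem {T : Set (HypEntry F P K)} {target : Set (TClause F P K)} {V N J : Set ℕ}
    {c : List ℤ} {used used' : Finset ℕ} {ids : Finset ℤ} {σ σ' : Subst F} {V₁ : Set ℕ}
    {used₁ used₁' : Finset ℕ} {ids₁ : Finset ℤ} {A : Set (TClause F P K)}
    (h : Outcome T target V N J c used used' ids σ σ' V₁ used₁ used₁' ids₁ A) {x : ℕ}
    (hx : x ∈ V ∨ x ∈ N ∧ x ∉ J) : σ x = σ' x := by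
  rcases hx with hx | ⟨hx, hx'⟩
  · exact (h.agree x hx).symm
  · rw [h.hidden x hx hx', h.supported.1 x (Set.disjoint_right.1 h.disjoint hx)]

end Translation

end HypLP

theorem proposition3p6 {F P K : Type*} (B : K → Set (List (Term F)))
    (prog : List (Rule F P K)) (Q : Goal F P K)
    (W : Finset ℕ) (hW : Q.vars ∪ (goalTranslation prog Q).vars ⊆ W) :
    (∀ σ : Subst F, HSucceeds B {R | R ∈ prog} W Q σ →
      ∃ (σ' : Subst F) (A prog' : Set (TClause F P K)),
        SSucceeds B (programTranslation prog Q) W (goalTranslation prog Q) σ' A prog' ∧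
        prog' = programTranslation prog Q ∪ A ∧
        (∀ C ∈ A, IsRegistration (programTranslation prog Q) C) ∧
        ∀ x ∈ Q.vars, σ x = σ' x) ∧
    (∀ (σ' : Subst F) (A prog' : Set (TClause F P K)),
      SSucceeds B (programTranslation prog Q) W (goalTranslation prog Q) σ' A prog' →
        prog' = programTranslation prog Q ∪ A ∧
        (∀ C ∈ A, IsRegistration (programTranslation prog Q) C) ∧
        ∃ σ : Subst F, HSucceeds B {R | R ∈ prog} W Q σ ∧ ∀ x ∈ Q.vars, σ x = σ' x) := by
  have hC := isCompiled_programTranslation prog Q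
  obtain ⟨V, N, J, hvars, hL⟩ := exists_linked_init prog Q hW
  constructor
  · intro σ hσ
    obtain ⟨used₁, hbig⟩ := hSucceeds_iff.1 hσ
    -- `Z` is taken to be the final set of used variables; the condition on it holds at the start
    -- because both derivations avoid the same set `W`.
    obtain ⟨σ', V₁, used₁', ids₁, A, hO, -, hsteps⟩ :=
      hbig.simulate hC subset_rfl (fun x hx _ => hx) hL
    have := hsteps .nil Subst.id
    rw [TGoal.append_nil, Subst.id_comp] at this
    exact ⟨σ', A, _, ⟨_, _, this⟩, rfl, hO.registrations, fun x hx => hO.eq_of_mem (hvars x hx)⟩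
  · rintro σ' A prog' ⟨used₁', ids₁, hsteps⟩
    obtain ⟨n, hn⟩ := hsteps.exists_length
    rw [← TGoal.append_nil (goalTranslation prog Q)] at hn
    obtain ⟨m, -, σ, τ, V₁, used₂, used₂', ids₂, A₁, A₂, hbig, hO, -, hrest, rfl⟩ :=
      SStepsN.reflect hC n hL hn rfl subset_rfl (fun x hx _ => hx)
    -- The translated goal has been solved with the empty continuation, and no step is possible from
    -- the empty goal, so the given derivation ends here.
    cases hrest with
    | refl =>
      rw [Set.union_empty]
      refine ⟨rfl, hO.registrations, σ, hSucceeds_iff.2 ⟨_, hbig⟩, fun x hx => ?_⟩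
      rw [Subst.id_comp]
      exact hO.eq_of_mem (hvars x hx)
    | head hst _ => cases hst
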